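/- Let $m\ge 1$ be an integer. Let $\mathcal F=\bigoplus_{k\in\mathbb Z}\mathcal F_k$ be the state space of the rank one lattice theory of charge square $m$: the direct sum of the Fock modules of a current $H(z)=\sum_{n\in\mathbb Z}H_nz^{-n-1}$ with $[H_n,H_{n'}]=m\,n\,\delta_{n,-n'}$, where $H_0=mk$ on $\mathcal F_k$, and with vacuum vector $|0\rangle\in\mathcal F_0$ and vacuum expectation value $\langle\,\cdot\,\rangle_0$. Let $L_n$ be the modes of $T(z)=\sum_n L_nz^{-n-2}=\frac1{2m}{:}H^2(z){:}$, and let $$\phi^{\pm}(z)=e^{\pm}z^{\pm H_0}\exp\Bigl(\pm\sum_{n\ge1}\tfrac{z^n}{n}H_{-n}\Bigr)\exp\Bigl(\mp\sum_{n\ge1}\tfrac{z^{-n}}{n}H_n\Bigr)$$ be the charged fields ($e^{\pm}:\mathcal F_k\to\mathcal F_{k\pm1}$ the shift). Write $z_{ij}=z_i-z_j$ and $$V_m(z_1,z_2)=z_{12}^{m-1}\phi^+(z_1)\phi^-(z_2)-z_{12}^{-1},$$ a formal distribution with values in operators on $\mathcal F$ ($z_{12}^{-1}$ being expanded in $|z_1|>|z_2|$).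 For every $v\in\mathcal F$, $V_m(z_1,z_2)v$ has only finitely many negative powers of $z_1$ and of $z_2$, so that $V_m$ can be re-expanded in powers of $z_{12}$ with coefficients depending on $z_2$, and can be restricted, together with its derivatives, to $z_1=z_2$. For $|z_3|,|z_4|<|z_1|,|z_2|$, $z_1\ne z_2$, $z_3\neq z_4$, its 4-point function is $$\langle V_m(z_1,z_2)V_m(z_3,z_4)\rangle_0=\frac{1}{z_{12}z_{34}}\bigl\{(1-\eta)^{-m}-1\bigr\},\qquad \eta=\frac{z_{12}z_{34}}{z_{13}z_{24}} .$$ **Theorem.** There are fields $V^l(z,m)$, $l=0,1,2,\dots$, on $\mathcal F$, mutually local and with $V^l$ quasiprimary of dimension $l+1$, i.e. $[L_n,V^l(z,m)]=z^n\bigl(z\partial_z+(n+1)(l+1)\bigr)V^l(z,m)$ for $n=0,\pm1$, and real constants $C_{lm}$, such that the following holds. 1. As formal power series in $z_{12}$, $$V_m(z_1,z_2)=\sum_{l=0}^\infty\frac{z_{12}^l}{l!}\int_{z_2}^{z_1}p_l(z;z_1,z_2)\,V^l(z,m)\,dz,\qquad p_l(z;z_1,z_2)=\frac{(2l+1)!}{(l!)^2z_{12}^{2l+1}}(z_1-z)^l(z-z_2)^l,$$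 where $V^l(z,m)$ is expanded in the Taylor series in $z-z_2$ under the integral; the weight is normalized, $\int_{z_2}^{z_1}p_l(z;z_1,z_2)\,dz=1$ for $z_1\ne z_2$. 2. For $|z_1|>|z_2|$ and all $l,l'$, $$\frac{l+1}{l!}\langle V^l(z_1,m)V^{l'}(z_2,m)\rangle_0=C_{lm}\,z_{12}^{-2l-2}\,\delta_{l,l'} .$$ 3. For $|z_1|,|z_2|>|z_3|$ and all $l$, $$(l+1)\langle V_m(z_1,z_2)V^l(z_3,m)\rangle_0=C_{lm}\frac{z_{12}^l}{(z_{13}z_{23})^{l+1}} .$$ 4. $C_{lm}>0$ for all $l$, and $(C_{lm})_{l\ge0}$ is the unique real solution of the triangular system of linear equations obtained by comparing the coefficients of the powers of $\eta$ in $$(1-\eta)^{-m}=1+\sum_{l=0}^\infty C_{lm}\frac{\eta^{l+1}}{(l+1)!}\,F(l+1,l+1;2l+2;\eta),$$ where $F$ is the Gauss hypergeometric series. 5. Conversely, $$V^l(z,m)=\frac{l!}{(2l)!}\lim_{z_1,z_2\to z}\Bigl\{\partial_1^l(-\partial_2)^l\bigl(z_{12}^lV_m(z_1,z_2)\bigr)\Bigr\}.$$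 6. Moreover, $$V^l(z,m)=\frac{(l!)^2}{(2l)!}\sum_{k=0}^l(-1)^k\binom lk\binom{2l-k}{l}(l-k)!\;\partial^k\,{:}S_{l-k+1}\Bigl(H,\frac{\partial H}{2!},\dots,\frac{\partial^{l-k}H}{(l-k+1)!}\Bigr){:}(z),$$ where $S_N(t_1,t_2,\dots)=\sum_{\sum_k k n_k=N}\prod_k t_k^{n_k}/n_k!$ are the Schur polynomials and $:\ :$ is the normal product. The vacuum expectation values above are (absolutely convergent) sums of the series of their formal coefficients in the stated domains. -/

import Mathlib

open Finset MvPolynomial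

noncomputable section

namespace Bilocal

/-- The state space `⨁_{k ∈ ℤ} ℂ[x₀, x₁, …] ⊗ eᵏ`: the summand of index `k` is the `u(1)` Fock space
of charge number `k` (charge `k √m`), and `xⱼ` stands for the creation operator `H_{-(j+1)}`. -/
abbrev Fock : Type := ℤ →₀ MvPolynomial ℕ ℂ

/-- A formal distribution `A(z) = ∑_{a ∈ ℤ} A a • z ^ a` with operator coefficients. -/
abbrev Dist : Type := ℤ → Module.End ℂ Fock

/-- A formal distribution `D(z₁,z₂) = ∑_{a,b ∈ ℤ} D a b • z₁ ^ a z₂ ^ b`. -/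
abbrev BiDist : Type := ℤ → ℤ → Module.End ℂ Fock

/-- The vacuum vector `|0⟩`. -/
def vacuum : Fock := Finsupp.single 0 1

/-- The vacuum expectation value `⟨0| A |0⟩` (`⟨0|` reads off the component along `|0⟩` in the
decomposition into charge sectors and monomials). -/
def vev (A : Module.End ℂ Fock) : ℂ := MvPolynomial.coeff 0 (A vacuum 0)

/-! ### Formal calculus in one variable -/

open Classical in
/-- The sum of a family of operators that is locally finite, i.e. only finitely many members are
nonzero on each given vector. (Value `0` for all other families.) -/
def locSum {ι : Type} (A : ι → Module.End ℂ Fock) : Module.End ℂ Fock :=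
  if h : ∀ v, {i | A i v ≠ 0}.Finite then
    { toFun := fun v => ∑ᶠ i, A i v
      map_add' := fun v w => by
        simp only [map_add]
        exact finsum_add_distrib (h v) (h w)
      map_smul' := fun c v => by
        simp only [map_smul, RingHom.id_apply]
        exact (smul_finsum' c (h v)).symm }
  else 0

/-- The derivative `∂A(z)`. -/
def deriv (A : Dist) : Dist := fun a => ((a : ℂ) + 1) • A (a + 1)

/-- The unit operator as a field. -/
def one : Dist := fun a => if a = 0 then 1 else 0

/-- The normal product `:A(z)B(z): = A₊(z)B(z) + B(z)A₋(z)`, where `A₊` consists of the nonnegative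
and `A₋` of the negative powers of `z` in `A`. -/
def nprod (A B : Dist) : Dist := fun a =>
  locSum fun j : ℤ => if 0 ≤ j then A j * B (a - j) else B (a - j) * A j

/-- The normally ordered differential polynomial `:P(A, ∂A, ∂²A, …):`; the variable `X k` of `P`
stands for `∂ᵏA`. -/
def npoly (A : Dist) (P : MvPolynomial ℕ ℂ) : Dist := fun a =>
  ∑ s ∈ P.support, P.coeff s •
    (((Finsupp.toMultiset s).sort (· ≤ ·)).map fun k => deriv^[k] A).foldr nprod one a

/-! ### Schur polynomials -/

/-- The Schur polynomial `S_N(t₁,t₂,…) = ∑_{∑ k n_k = N} ∏_k t_k ^ n_k / n_k!`, the variable `X k`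
standing for `t_k`, `k ≥ 1`. -/
def schur (N : ℕ) : MvPolynomial ℕ ℂ :=
  ∑ p : N.Partition, ∏ k ∈ p.parts.toFinset,
    C (((p.parts.count k).factorial : ℂ)⁻¹) * X k ^ p.parts.count k

/-- `S_N(H, ∂H/2!, …, ∂^{N-1}H/N!)` as a differential polynomial in `H`. -/
def schurDiff (N : ℕ) : MvPolynomial ℕ ℂ :=
  aeval (R := ℂ) (fun k : ℕ => C ((k.factorial : ℂ)⁻¹) * X (k - 1)) (schur N)

/-! ### The current, the stress-energy tensor and the charged fields -/

/-- The modes `H_n` of the current on the polynomial factor of the sector of charge number `k`: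
`H_n = m n ∂/∂x_{n-1}` for `n > 0`, `H_0 = m k`, `H_{-n} = x_{n-1}` for `n > 0`. -/
def heisSector (m : ℕ) (k n : ℤ) : Module.End ℂ (MvPolynomial ℕ ℂ) :=
  if 0 < n then ((m : ℂ) * n) • (pderiv (R := ℂ) (n - 1).toNat).toLinearMap
  else if n = 0 then ((m : ℂ) * k) • 1
  else LinearMap.mulLeft ℂ (X (-n - 1).toNat)

/-- The modes `H_n` of the current on the state space; `[H_n, H_{n'}] = m n δ_{n,-n'}`. -/
def heis (m : ℕ) (n : ℤ) : Module.End ℂ Fock :=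
  Finsupp.lsum ℂ fun k => Finsupp.lsingle k ∘ₗ heisSector m k n

/-- The current `H(z) = ∑_n H_n z^{-n-1}`. -/
def current (m : ℕ) : Dist := fun a => heis m (-a - 1)

/-- The stress-energy tensor `T(z) = (1/2m) :H²(z):`. -/
def stress (m : ℕ) : Dist := (1 / (2 * (m : ℂ))) • nprod (current m) (current m)

/-- The modes `L_n` in `T(z) = ∑_n L_n z^{-n-2}`. -/
def virasoro (m : ℕ) (n : ℤ) : Module.End ℂ Fock := stress m (-n - 2)

/-- The coefficient of `z^n` in `exp(ε ∑_{r≥1} H_{-r} z^r / r)`, a polynomial in the creation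
operators (multiplication by which is the operator in question). -/
def creation (ε n : ℤ) : MvPolynomial ℕ ℂ :=
  if 0 ≤ n then aeval (R := ℂ) (fun k : ℕ => C ((ε : ℂ) / k) * X (k - 1)) (schur n.toNat) else 0

/-- The operator `exp(-ε ∑_{r≥1} H_r z^{-r} / r) = exp(-ε m ∑_{r≥1} z^{-r} ∂/∂x_{r-1})`, i.e. the
translation `x_{r-1} ↦ x_{r-1} - ε m z^{-r}`; the polynomial variable is `z⁻¹`. -/
def annihilation (m : ℕ) (ε : ℤ) :
    MvPolynomial ℕ ℂ →ₐ[ℂ] Polynomial (MvPolynomial ℕ ℂ) :=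
  aeval fun j => Polynomial.C (X j) - Polynomial.C (C ((ε : ℂ) * m)) * Polynomial.X ^ (j + 1)

/-- The charged field of charge `ε √m` (`ε = ± 1`):
`φ^ε(z) = :exp(ε ∫ H): = e^ε z^{ε H_0} exp(ε ∑_{r≥1} H_{-r} z^r / r) exp(-ε ∑_{r≥1} H_r z^{-r} / r)`,
where `e^ε` maps the sector of charge number `k` to that of charge number `k + ε`. -/
def charged (m : ℕ) (ε : ℤ) : Dist := fun a =>
  Finsupp.lsum ℂ fun k => Finsupp.lsingle (k + ε) ∘ₗ
    (Polynomial.lsum fun j : ℕ =>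
      LinearMap.mulLeft ℂ (creation ε (a - ε * m * k + j))) ∘ₗ (annihilation m ε).toLinearMap

/-! ### Formal calculus in two variables -/

/-- Multiplication by `z₁₂ = z₁ - z₂`. -/
def mulZ12 (D : BiDist) : BiDist := fun a b => D (a - 1) b - D a (b - 1)

/-- `z₁₂⁻¹ = ∑_{b ≥ 0} z₁^{-b-1} z₂^b`, the expansion in the domain `|z₁| > |z₂|`. -/
def invZ12 : BiDist := fun a b => if 0 ≤ b ∧ a = -b - 1 then 1 else 0

/-- `∂₁ D(z₁,z₂)`. -/
def deriv₁ (D : BiDist) : BiDist := fun a b => ((a : ℂ) + 1) • D (a + 1) b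

/-- `∂₂ D(z₁,z₂)`. -/
def deriv₂ (D : BiDist) : BiDist := fun a b => ((b : ℂ) + 1) • D a (b + 1)

/-- `D(z₁,z₂)v` has only finitely many negative powers of `z₁` and of `z₂`, for every vector `v`; for
such `D` the coincidence limit and the Taylor expansion below are well defined. -/
def Regular (D : BiDist) : Prop :=
  ∀ v : Fock, ∃ N : ℤ, ∀ a b : ℤ, a < N ∨ b < N → D a b v = 0

/-- The coincidence limit `lim_{z₁,z₂ → z} D(z₁,z₂)`. -/
def diag (D : BiDist) : Dist := fun c => locSum fun a : ℤ => D a (c - a)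

/-- The coefficient of `z₁₂ ^ k` (a distribution in `z₂`) in the expansion of `D(z₁,z₂)` in powers of
`z₁₂`, obtained from `z₁ ^ a = (z₂ + z₁₂) ^ a = ∑_k (a choose k) z₁₂ ^ k z₂ ^ (a - k)`. -/
def taylor (D : BiDist) (k : ℕ) : Dist := fun c =>
  locSum fun a : ℤ => ((Ring.choose a k : ℤ) : ℂ) • D a (c + k - a)

/-- The bilocal field `V_m(z₁,z₂) = z₁₂^{m-1} φ⁺(z₁) φ⁻(z₂) - z₁₂⁻¹`. -/
def bilocal (m : ℕ) : BiDist :=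
  mulZ12^[m - 1] (fun a b => charged m 1 a * charged m (-1) b) - invZ12

/-- The weight function `p_l(z; z₁, z₂)`. -/
def weight (l : ℕ) (z z₁ z₂ : ℂ) : ℂ :=
  ((2 * l + 1).factorial : ℂ) / ((l.factorial : ℂ) ^ 2 * (z₁ - z₂) ^ (2 * l + 1))
    * (z₁ - z) ^ l * (z - z₂) ^ l

/-- The coefficient of `z₁₂ ^ n` (a distribution in `z₂`) in `∫_{z₂}^{z₁} p_l(z; z₁, z₂) A(z) dz`.
Substituting `z = z₂ + t z₁₂`, `0 ≤ t ≤ 1`, one has `p_l(z; z₁, z₂) dz = p_l(t; 1, 0) dt` and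
`A(z) = ∑_n (t z₁₂) ^ n / n! ∂ⁿA(z₂)`. -/
def weightedIntegral (l : ℕ) (A : Dist) (n : ℕ) : Dist :=
  ((∫ t in (0 : ℝ)..1, weight l t 1 0 * (t : ℂ) ^ n) / (n.factorial : ℂ)) • deriv^[n] A

/-! ### Local quasiprimary fields -/

/-- Mutual locality of Bose fields: `z₁₂ ^ N [A(z₁), B(z₂)] = 0` for some `N`. -/
def MutuallyLocal (A B : Dist) : Prop :=
  ∃ N : ℕ, mulZ12^[N] (fun a b => A a * B b - B b * A a) = 0

/-- `A` is quasiprimary of dimension `h`: `[L_n, A(z)] = z^n (z ∂ + (n+1) h) A(z)`, `n = -1, 0, 1`. -/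
def Quasiprimary (m : ℕ) (h : ℕ) (A : Dist) : Prop :=
  ∀ n : ℤ, n = -1 ∨ n = 0 ∨ n = 1 → ∀ a : ℤ,
    virasoro m n * A a - A a * virasoro m n =
      (((a - n : ℤ) : ℂ) + ((n : ℂ) + 1) * h) • A (a - n)

/-- The triangular linear system
`(1 - η)^{-m} = 1 + ∑_l c_l η^{l+1} / (l+1)! F(l+1, l+1; 2l+2; η)`,
the equality of the coefficients of `η^{N+1}` for all `N` (the constant terms agree). -/
def TriangularSystem (m : ℕ) (c : ℕ → ℝ) : Prop :=
  ∀ N : ℕ, PowerSeries.coeff (N + 1) (((1 - PowerSeries.X : PowerSeries ℝ) ^ m)⁻¹) =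
    ∑ l ∈ range (N + 1), c l / ((l + 1).factorial : ℝ) *
      ordinaryHypergeometricCoefficient ((l : ℝ) + 1) ((l : ℝ) + 1) (2 * (l : ℝ) + 2) (N - l)

end Bilocal

end

noncomputable section

namespace Bilocal

/-! Everything is reduced to the distribution `expField`, E(z₁,z₂) = z₁₂^m φ⁺(z₁)φ⁻(z₂) =
:exp(∫_{z₂}^{z₁} H):, because z₁₂ V_m = E - 1 (`mulZ12_bilocal`). The state space is generated from
the vectors |k⟩ by creation operators, so an operator identity is checked on |k⟩ and then propagated
through H_{-1}, H_{-2}, … (`fock_induction`, `eq_zero_of_vac_of_heis`). This yields the commutators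
of the charged fields with H_n and with L_0, L_{±1}, and the regularity of V_m: the contraction of
φ⁺ with φ⁻ is (1 - z₂/z₁)^{-m}, the factor z₁₂^{m-1} reduces it to a simple pole, and on |k⟩ that
pole is cancelled by z₁₂^{-1} (`crossSum_one_of_nonpos`).

Let T_k be the Taylor coefficients of V_m in z₁₂. The equation ∂₁E = :H E: (`deriv_expField`) turns
into a recursion for the Taylor coefficients of E which is the recursion of the Schur polynomials;
this expresses T_k through S_{k+1} (`expTaylor_eq_npoly`). The field V^l is defined as an
alternating combination of the derivatives ∂^k T_{l-k} (`quasiField`). Its description by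
∂₁^l(-∂₂)^l z₁₂^l is the calculus of ∂₁, ∂₂ and z₁₂ on Taylor coefficients. The expansion of V_m is
the inversion of the triangular relation between V^l and T_k; it rests on one alternating factorial
sum, evaluated by telescoping (`sum_orthogonality`).

Since V_m has Möbius dimension 1/2 in each variable, the commutators of the T_k with L_0 and L_{±1}
are explicit; in the combination V^l the unwanted terms of [L_1, ·] telescope away. Locality is a
form of Dong's lemma: the commutator of H with a Taylor coefficient of E is a finite combination of
lower ones, and the recursion carries locality from one coefficient to the next
(`localDist_comm_nprod`).

The vacuum is Möbius invariant on both sides, so Ward identities determine the coefficients of the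
2-point and 3-point functions up to constants, and both constants are multiples of `threePointNorm`.
Pairing the expansion of V_m with one row of coefficients of V_m, for which ⟨0|V_m is an evaluation
of polynomials, gives the triangular system. The explicit `normConst` solves the same system by
`sum_orthogonality`, and the system has a nonzero diagonal, so the two agree. A binomial identity
turns the alternating solution into a sum of nonnegative terms, whence positivity.

For the 4-point function, ⟨E E⟩ is treated as a power series in z₁^{-1}, z₂^{-1}, z₃, z₄. Moving
creation operators to the left gives a first-order equation for the Euler operator z₃∂₃ + z₄∂₄, with
solution (z₁₃z₂₄/(z₁₄z₂₃))^m. Division by z₁₂z₃₄ is exact in the ring of power series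
(`bilocalPair_mul_pow`), and what remains is a polynomial times geometric series, which is summed by
absolute convergence. -/

theorem op_mul_sub (A B C : Module.End ℂ Fock) : A * (B - C) = A * B - A * C := mul_sub A B C

theorem op_sub_mul (A B C : Module.End ℂ Fock) : (A - B) * C = A * C - B * C := sub_mul A B C

theorem op_smul_sub (c : ℂ) (A B : Module.End ℂ Fock) : c • (A - B) = c • A - c • B :=
  smul_sub c A B

theorem op_sub_eq_iff {A B C : Module.End ℂ Fock} : A - B = C ↔ A = C + B :=
  ⟨fun h => by rw [← h]; abel, fun h => by rw [h]; abel⟩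

theorem op_sub_eq_zero {A B : Module.End ℂ Fock} : A - B = 0 ↔ A = B :=
  op_sub_eq_iff.trans (by rw [zero_add])

theorem op_sub_zero (A : Module.End ℂ Fock) : A - 0 = A := sub_zero A

theorem op_sub_self (A : Module.End ℂ Fock) : A - A = 0 := sub_self A

/-! ### Locally finite sums of operators -/

section LocSum

variable {ι κ : Type}

/-- Only finitely many members of the family are nonzero on each given vector. -/
def LocFin (A : ι → Module.End ℂ Fock) : Prop := ∀ v, {i | A i v ≠ 0}.Finite

theorem locSum_apply {A : ι → Module.End ℂ Fock} (h : LocFin A) (v : Fock) :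
    locSum A v = ∑ᶠ i, A i v := by
  rw [locSum, dif_pos (show ∀ v, {i | A i v ≠ 0}.Finite from h)]; rfl

theorem LocFin.of_finite {A : ι → Module.End ℂ Fock} (h : {i | A i ≠ 0}.Finite) : LocFin A :=
  fun v => h.subset fun i hi h0 => hi (by simp [h0])

theorem LocFin.add {A B : ι → Module.End ℂ Fock} (hA : LocFin A) (hB : LocFin B) :
    LocFin fun i => A i + B i := fun v =>
  ((hA v).union (hB v)).subset fun i hi => by
    by_contra h
    simp only [Set.mem_union, Set.mem_ofPred_eq, not_or, not_not] at h
    exact hi (by simp [h.1, h.2])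

theorem LocFin.sub {A B : ι → Module.End ℂ Fock} (hA : LocFin A) (hB : LocFin B) :
    LocFin fun i => A i - B i := fun v =>
  ((hA v).union (hB v)).subset fun i hi => by
    by_contra h
    simp only [Set.mem_union, Set.mem_ofPred_eq, not_or, not_not] at h
    exact hi (by simp [h.1, h.2])

theorem LocFin.smul {A : ι → Module.End ℂ Fock} (hA : LocFin A) (c : ι → ℂ) :
    LocFin fun i => c i • A i := fun v =>
  (hA v).subset fun i hi h0 => hi (by simp [h0])

theorem LocFin.mul_left {A : ι → Module.End ℂ Fock} (hA : LocFin A) (X : Module.End ℂ Fock) :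
    LocFin fun i => X * A i := fun v =>
  (hA v).subset fun i hi h0 => hi (by simp [h0])

theorem LocFin.mul_right {A : ι → Module.End ℂ Fock} (hA : LocFin A) (X : Module.End ℂ Fock) :
    LocFin fun i => A i * X := fun v => (hA (X v)).subset fun _ hi => hi

theorem LocFin.comp {A : ι → Module.End ℂ Fock} (hA : LocFin A) {f : κ → ι}
    (hf : Function.Injective f) : LocFin fun i => A (f i) := fun v =>
  (hA v).preimage hf.injOn

theorem LocFin.finsetSum {J : Type*} {A : J → ι → Module.End ℂ Fock} (s : Finset J)
    (hA : ∀ j ∈ s, LocFin (A j)) : LocFin fun i => ∑ j ∈ s, A j i := fun v =>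
  (s.finite_toSet.biUnion fun j hj => hA j hj v).subset fun i hi => by
    by_contra h
    refine hi ?_
    rw [LinearMap.sum_apply]
    refine Finset.sum_eq_zero fun j hj => ?_
    by_contra h0
    exact h (Set.mem_biUnion (Finset.mem_coe.2 hj) h0)

theorem locSum_add {A B : ι → Module.End ℂ Fock} (hA : LocFin A) (hB : LocFin B) :
    locSum (fun i => A i + B i) = locSum A + locSum B := by
  refine LinearMap.ext fun v => ?_
  rw [locSum_apply (hA.add hB), LinearMap.add_apply, locSum_apply hA, locSum_apply hB]
  exact finsum_add_distrib (hA v) (hB v)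

theorem locSum_sub {A B : ι → Module.End ℂ Fock} (hA : LocFin A) (hB : LocFin B) :
    locSum (fun i => A i - B i) = locSum A - locSum B := by
  refine LinearMap.ext fun v => ?_
  rw [locSum_apply (hA.sub hB), LinearMap.sub_apply, locSum_apply hA, locSum_apply hB]
  exact finsum_sub_distrib (hA v) (hB v)

theorem locSum_smul {A : ι → Module.End ℂ Fock} (hA : LocFin A) (c : ℂ) :
    locSum (fun i => c • A i) = c • locSum A := by
  refine LinearMap.ext fun v => ?_
  rw [locSum_apply (hA.smul fun _ => c), LinearMap.smul_apply, locSum_apply hA]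
  exact (smul_finsum' c (hA v)).symm

theorem mul_locSum {A : ι → Module.End ℂ Fock} (hA : LocFin A) (X : Module.End ℂ Fock) :
    X * locSum A = locSum fun i => X * A i := by
  refine LinearMap.ext fun v => ?_
  rw [locSum_apply (hA.mul_left X), Module.End.mul_apply, locSum_apply hA]
  exact X.toAddMonoidHom.map_finsum (hA v)

theorem locSum_mul {A : ι → Module.End ℂ Fock} (hA : LocFin A) (X : Module.End ℂ Fock) :
    locSum A * X = locSum fun i => A i * X := by
  refine LinearMap.ext fun v => ?_
  rw [locSum_apply (hA.mul_right X), Module.End.mul_apply, locSum_apply hA]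
  rfl

theorem locSum_comp_equiv {A : ι → Module.End ℂ Fock} (hA : LocFin A) (e : κ ≃ ι) :
    locSum (fun i => A (e i)) = locSum A := by
  refine LinearMap.ext fun v => ?_
  rw [locSum_apply (hA.comp e.injective), locSum_apply hA]
  exact finsum_comp_equiv e (f := fun i => A i v)

theorem locSum_shift {A : ℤ → Module.End ℂ Fock} (hA : LocFin A) (n : ℤ) :
    locSum (fun i => A (i + n)) = locSum A :=
  locSum_comp_equiv hA (Equiv.addRight n)

theorem locSum_zero : locSum (fun _ : ι => (0 : Module.End ℂ Fock)) = 0 := by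
  refine LinearMap.ext fun v => ?_
  rw [locSum_apply (.of_finite (by simp))]; simp

theorem locSum_finsetSum {J : Type*} {A : J → ι → Module.End ℂ Fock} (s : Finset J)
    (hA : ∀ j ∈ s, LocFin (A j)) :
    locSum (fun i => ∑ j ∈ s, A j i) = ∑ j ∈ s, locSum (A j) := by
  classical
  induction s using Finset.induction_on with
  | empty => simpa using locSum_zero
  | insert j s hj ih =>
    simp only [Finset.sum_insert hj]
    rw [locSum_add (hA j (by simp)) (LocFin.finsetSum s fun i hi => hA i (by simp [hi])),
      ih fun i hi => hA i (by simp [hi])]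

theorem locSum_eq_single {A : ι → Module.End ℂ Fock} (i : ι) (h : ∀ j, j ≠ i → A j = 0) :
    locSum A = A i := by
  have hA : LocFin A := .of_finite ((Set.finite_singleton i).subset fun j hj => by
    by_contra h'; exact hj (h j h'))
  refine LinearMap.ext fun v => ?_
  rw [locSum_apply hA]
  exact finsum_eq_single _ i fun j hj => by simp [h j hj]

theorem locSum_apply_eq_sum {A : ι → Module.End ℂ Fock} (h : LocFin A) (v : Fock) (s : Finset ι)
    (hs : ∀ i, i ∉ s → A i v = 0) : locSum A v = ∑ i ∈ s, A i v := by
  rw [locSum_apply h]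
  exact finsum_eq_sum_of_support_subset _ fun i hi => by
    by_contra h'; exact hi (hs i h')

theorem LocFin.curry {A : ι → κ → Module.End ℂ Fock} (h : LocFin fun p : ι × κ => A p.1 p.2)
    (i : ι) : LocFin (A i) := fun v =>
  ((h v).image Prod.snd).subset fun j hj => ⟨(i, j), hj, rfl⟩

theorem LocFin.locSum_curry {A : ι → κ → Module.End ℂ Fock}
    (h : LocFin fun p : ι × κ => A p.1 p.2) : LocFin fun i => locSum (A i) := fun v =>
  ((h v).image Prod.fst).subset fun i hi => by
    by_contra h'
    refine hi ?_
    rw [locSum_apply (h.curry i)]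
    refine finsum_eq_zero_of_forall_eq_zero fun j => ?_
    by_contra h0
    exact h' ⟨(i, j), h0, rfl⟩

theorem locSum_uncurry {A : ι → κ → Module.End ℂ Fock} (h : LocFin fun p : ι × κ => A p.1 p.2) :
    locSum (fun i => locSum (A i)) = locSum fun p : ι × κ => A p.1 p.2 := by
  refine LinearMap.ext fun v => ?_
  rw [locSum_apply h.locSum_curry, locSum_apply h, finsum_curry _ (h v)]
  exact finsum_congr fun i => locSum_apply (h.curry i) v

theorem LocFin.swap {A : ι → κ → Module.End ℂ Fock} (h : LocFin fun p : ι × κ => A p.1 p.2) :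
    LocFin fun p : κ × ι => A p.2 p.1 :=
  h.comp (f := Prod.swap) Prod.swap_injective

/-- Fubini. Finiteness is needed for the pairs of indices jointly; local finiteness of the two
iterated sums would not be enough. -/
theorem locSum_comm {A : ι → κ → Module.End ℂ Fock} (h : LocFin fun p : ι × κ => A p.1 p.2) :
    locSum (fun i => locSum (A i)) = locSum fun j => locSum fun i => A i j := by
  rw [locSum_uncurry h, locSum_uncurry (A := fun j i => A i j) h.swap]
  exact (locSum_comp_equiv h (Equiv.prodComm κ ι)).symm

end LocSum

/-! ### Fields -/

/-- On each vector only finitely many negative powers occur. -/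
def IsField (A : Dist) : Prop := ∀ v : Fock, ∃ N : ℤ, ∀ a < N, A a v = 0

theorem IsField.exists_nonpos {A : Dist} (h : IsField A) (v : Fock) :
    ∃ N : ℤ, N ≤ 0 ∧ ∀ a < N, A a v = 0 := by
  obtain ⟨N, hN⟩ := h v
  exact ⟨min N 0, min_le_right _ _, fun a ha => hN a (lt_of_lt_of_le ha (min_le_left _ _))⟩

theorem isField_zero : IsField 0 := fun _ => ⟨0, fun _ _ => rfl⟩

theorem isField_one : IsField one := fun v => ⟨0, fun a ha => by simp [one, ha.ne]⟩

theorem IsField.add {A B : Dist} (hA : IsField A) (hB : IsField B) : IsField (A + B) := fun v => by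
  obtain ⟨N, hN⟩ := hA v
  obtain ⟨M, hM⟩ := hB v
  exact ⟨min N M, fun a ha => by simp [hN a (by omega), hM a (by omega)]⟩

theorem IsField.smul {A : Dist} (hA : IsField A) (c : ℂ) : IsField (c • A) := fun v => by
  obtain ⟨N, hN⟩ := hA v
  exact ⟨N, fun a ha => by simp [hN a ha]⟩

theorem IsField.smul_fun {A : Dist} (hA : IsField A) (c : ℤ → ℂ) :
    IsField fun a => c a • A a := fun v => by
  obtain ⟨N, hN⟩ := hA v
  exact ⟨N, fun a ha => by simp [hN a ha]⟩

theorem IsField.sub {A B : Dist} (hA : IsField A) (hB : IsField B) : IsField (A - B) := fun v => by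
  obtain ⟨N, hN⟩ := hA v
  obtain ⟨M, hM⟩ := hB v
  exact ⟨min N M, fun a ha => by simp [hN a (by omega), hM a (by omega)]⟩

theorem IsField.shift {A : Dist} (hA : IsField A) (n : ℤ) : IsField fun a => A (a + n) := fun v => by
  obtain ⟨N, hN⟩ := hA v
  exact ⟨N - n, fun a ha => hN _ (by omega)⟩

theorem IsField.mul_left {A : Dist} (hA : IsField A) (X : Module.End ℂ Fock) :
    IsField fun a => X * A a := fun v => by
  obtain ⟨N, hN⟩ := hA v
  exact ⟨N, fun a ha => by simp [hN a ha]⟩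

theorem IsField.mul_right {A : Dist} (hA : IsField A) (X : Module.End ℂ Fock) :
    IsField fun a => A a * X := fun v => by
  obtain ⟨N, hN⟩ := hA (X v)
  exact ⟨N, fun a ha => hN a ha⟩

theorem IsField.finsetSum {J : Type*} {A : J → Dist} (s : Finset J)
    (hA : ∀ j ∈ s, IsField (A j)) : IsField (∑ j ∈ s, A j) :=
  Finset.sum_induction _ IsField (fun _ _ => IsField.add) isField_zero hA

theorem IsField.deriv {A : Dist} (hA : IsField A) : IsField (deriv A) :=
  (hA.shift 1).smul_fun fun a => (a : ℂ) + 1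

theorem IsField.iterate_deriv {A : Dist} (hA : IsField A) (n : ℕ) : IsField (Bilocal.deriv^[n] A) := by
  induction n with
  | zero => exact hA
  | succ n ih => rw [Function.iterate_succ_apply']; exact ih.deriv

/-- A uniform bound for finitely many vectors. -/
theorem IsField.exists_forall {A : Dist} (hA : IsField A) {J : Type*} {s : Set J} (hs : s.Finite)
    (u : J → Fock) : ∃ N : ℤ, N ≤ 0 ∧ ∀ j ∈ s, ∀ a < N, A a (u j) = 0 := by
  induction s, hs using Set.Finite.induction_on with
  | empty => exact ⟨0, le_rfl, by simp⟩
  | @insert i s _ _ ih =>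
    obtain ⟨N, hN0, hN⟩ := ih
    obtain ⟨M, hM⟩ := hA (u i)
    refine ⟨min N M, by omega, fun j hj a ha => ?_⟩
    rcases hj with rfl | hj
    · exact hM a (by omega)
    · exact hN j hj a (by omega)

/-- The commutator of an operator with a distribution. -/
def bracket (X : Module.End ℂ Fock) (A : Dist) : Dist := fun a => X * A a - A a * X

theorem IsField.bracket {A : Dist} (hA : IsField A) (X : Module.End ℂ Fock) :
    IsField (bracket X A) := (hA.mul_left X).sub (hA.mul_right X)

/-- The summands of the normal product. -/
def nprodTerm (A B : Dist) (a j : ℤ) : Module.End ℂ Fock :=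
  if 0 ≤ j then A j * B (a - j) else B (a - j) * A j

theorem nprod_apply (A B : Dist) (a : ℤ) : nprod A B a = locSum (nprodTerm A B a) := rfl

theorem locFin_nprodTerm {A B : Dist} (hA : IsField A) (hB : IsField B) (a : ℤ) :
    LocFin (nprodTerm A B a) := fun v => by
  obtain ⟨N, hN⟩ := hA v
  obtain ⟨M, hM⟩ := hB v
  refine (Set.finite_Icc (min N 0) (max 0 (a - M))).subset fun j hj => ?_
  by_contra h
  refine hj ?_
  rw [Set.mem_Icc, not_and_or] at h
  unfold nprodTerm
  split_ifs with h0
  · simp [hM (a - j) (by omega)]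
  · simp [hN j (by omega)]

theorem IsField.nprod {A B : Dist} (hA : IsField A) (hB : IsField B) : IsField (nprod A B) :=
  fun v => by
  obtain ⟨N, hN⟩ := hA v
  obtain ⟨M, hM⟩ := hB v
  -- When j < 0 the mode of B acts on A j v. Only finitely many of these vectors are nonzero, so one
  -- bound serves them all.
  obtain ⟨M', hM0, hM'⟩ := hB.exists_forall (Set.finite_Icc N 0) (fun j => A j v)
  refine ⟨min M (M' + N), fun a ha => ?_⟩
  rw [nprod_apply, locSum_apply_eq_sum (locFin_nprodTerm hA hB a) v ∅, Finset.sum_empty]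
  intro j _
  unfold nprodTerm
  split_ifs with h0
  · simp [hM (a - j) (by omega)]
  · rw [Module.End.mul_apply]
    by_cases hj : j < N
    · simp [hN j hj]
    · exact hM' j ⟨by omega, by omega⟩ _ (by omega)

theorem nprod_shift (A B : Dist) (a n : ℤ) : nprod A (fun b => B (b + n)) a = nprod A B (a + n) := by
  simp only [nprod_apply]
  congr 1
  funext j
  simp only [nprodTerm, show a + n - j = a - j + n by ring]

theorem nprod_add_right {A B C : Dist} (hA : IsField A) (hB : IsField B) (hC : IsField C) :
    nprod A (B + C) = nprod A B + nprod A C := by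
  funext a
  rw [Pi.add_apply, nprod_apply, nprod_apply, nprod_apply,
    ← locSum_add (locFin_nprodTerm hA hB a) (locFin_nprodTerm hA hC a)]
  congr 1; funext j
  unfold nprodTerm; split_ifs <;> simp [mul_add, add_mul]

theorem nprod_sub_right {A B C : Dist} (hA : IsField A) (hB : IsField B) (hC : IsField C) :
    nprod A (B - C) = nprod A B - nprod A C := by
  funext a
  rw [Pi.sub_apply, nprod_apply, nprod_apply, nprod_apply,
    ← locSum_sub (locFin_nprodTerm hA hB a) (locFin_nprodTerm hA hC a)]
  congr 1; funext j
  unfold nprodTerm; split_ifs <;> simp [op_mul_sub, op_sub_mul]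

theorem nprod_smul_right {A B : Dist} (hA : IsField A) (hB : IsField B) (c : ℂ) :
    nprod A (c • B) = c • nprod A B := by
  funext a
  rw [Pi.smul_apply, nprod_apply, nprod_apply, ← locSum_smul (locFin_nprodTerm hA hB a)]
  congr 1; funext j
  unfold nprodTerm; split_ifs <;> simp

theorem nprod_smul_left {A B : Dist} (hA : IsField A) (hB : IsField B) (c : ℂ) :
    nprod (c • A) B = c • nprod A B := by
  funext a
  rw [Pi.smul_apply, nprod_apply, nprod_apply, ← locSum_smul (locFin_nprodTerm hA hB a)]
  congr 1; funext j
  unfold nprodTerm; split_ifs <;> simp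

theorem nprod_add_left {A B C : Dist} (hA : IsField A) (hB : IsField B) (hC : IsField C) :
    nprod (A + B) C = nprod A C + nprod B C := by
  funext a
  rw [Pi.add_apply, nprod_apply, nprod_apply, nprod_apply,
    ← locSum_add (locFin_nprodTerm hA hC a) (locFin_nprodTerm hB hC a)]
  congr 1; funext j
  unfold nprodTerm; split_ifs <;> simp [mul_add, add_mul]

theorem nprod_zero_left (B : Dist) : nprod 0 B = 0 := by
  funext a
  rw [nprod_apply, show nprodTerm 0 B a = fun _ => 0 by funext j; simp [nprodTerm], locSum_zero]
  rfl

theorem nprod_zero_right (A : Dist) : nprod A 0 = 0 := by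
  funext a
  rw [nprod_apply, show nprodTerm A 0 a = fun _ => 0 by funext j; simp [nprodTerm], locSum_zero]
  rfl

theorem nprod_sum_left {J : Type*} {A : J → Dist} {B : Dist} (s : Finset J)
    (hA : ∀ j ∈ s, IsField (A j)) (hB : IsField B) :
    nprod (∑ j ∈ s, A j) B = ∑ j ∈ s, nprod (A j) B := by
  classical
  induction s using Finset.induction_on with
  | empty => simp [nprod_zero_left]
  | insert j s hj ih =>
    rw [Finset.sum_insert hj, Finset.sum_insert hj,
      nprod_add_left (hA j (by simp)) (.finsetSum s fun i hi => hA i (by simp [hi])) hB,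
      ih fun i hi => hA i (by simp [hi])]

/-- Commutators act on normal products by the Leibniz rule. -/
theorem bracket_nprod {A B : Dist} (hA : IsField A) (hB : IsField B) (X : Module.End ℂ Fock) :
    bracket X (nprod A B) = nprod (bracket X A) B + nprod A (bracket X B) := by
  funext a
  have h := locFin_nprodTerm hA hB a
  rw [bracket, Pi.add_apply, nprod_apply, nprod_apply, nprod_apply, mul_locSum h, locSum_mul h,
    ← locSum_sub (h.mul_left X) (h.mul_right X),
    ← locSum_add (locFin_nprodTerm (hA.bracket X) hB a) (locFin_nprodTerm hA (hB.bracket X) a)]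
  congr 1; funext j
  unfold nprodTerm bracket
  split_ifs <;> simp only [op_mul_sub, op_sub_mul, mul_assoc] <;> abel

/-- Normal ordering makes left multiplications commute, provided that the creation parts and the
annihilation parts of the two left factors commute. -/
theorem nprod_left_comm {A B C : Dist} (hA : IsField A) (hB : IsField B) (hC : IsField C)
    (hpos : ∀ j k : ℤ, 0 ≤ j → 0 ≤ k → Commute (A j) (B k))
    (hneg : ∀ j k : ℤ, j < 0 → k < 0 → Commute (A j) (B k)) :
    nprod A (nprod B C) = nprod B (nprod A C) := by
  -- Both iterated products become double sums over the same pairs of modes, so that they can be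
  -- compared term by term after exchanging the sums.
  have key : ∀ {A B : Dist}, IsField A → IsField B → ∀ a : ℤ,
      nprod A (nprod B C) a = locSum fun j => locSum fun k =>
        if 0 ≤ j then A j * nprodTerm B C (a - j) k else nprodTerm B C (a - j) k * A j := by
    intro A B hA hB a
    rw [nprod_apply]
    congr 1; funext j
    unfold nprodTerm
    split_ifs with h
    · exact mul_locSum (locFin_nprodTerm hB hC _) _
    · exact locSum_mul (locFin_nprodTerm hB hC _) _
  funext a
  have hfin : LocFin fun p : ℤ × ℤ => if 0 ≤ p.1 then A p.1 * nprodTerm B C (a - p.1) p.2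
      else nprodTerm B C (a - p.1) p.2 * A p.1 := by
    intro v
    obtain ⟨N, hN0, hN⟩ := hA.exists_nonpos v
    obtain ⟨N₁, hN10, hN1⟩ := hB.exists_nonpos v
    obtain ⟨N₂, hN20, hN2⟩ := hB.exists_forall (Set.finite_Icc N 0) (fun j => A j v)
    obtain ⟨M, hM0, hM⟩ := hC.exists_nonpos v
    obtain ⟨M₁, hM10, hM1⟩ := hC.exists_forall (Set.finite_Icc N₁ 0) (fun k => B k v)
    obtain ⟨M₂, hM20, hM2⟩ := hC.exists_forall (Set.finite_Icc N 0) (fun j => A j v)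
    obtain ⟨M₃, hM30, hM3⟩ := hC.exists_forall ((Set.finite_Icc N 0).prod (Set.finite_Icc N₂ 0))
      (fun p => B p.2 (A p.1 v))
    have hM3' : ∀ j k : ℤ, N ≤ j → j ≤ 0 → N₂ ≤ k → k ≤ 0 → ∀ c < M₃, C c (B k (A j v)) = 0 :=
      fun j k h1 h2 h3 h4 c hc => hM3 (j, k) ⟨⟨h1, h2⟩, h3, h4⟩ c hc
    set L := min (min N (min N₁ N₂)) (a + M + M₁ + M₂ + M₃ + N + N₁ + N₂)
    -- All the bounds N, M, … are nonpositive. Hence N + N₁ + N₂ lies below every lower bound in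
    -- play, and R above every upper bound, whichever way the three factors are ordered.
    set R := |a| - M - M₁ - M₂ - M₃ - N - N₁ - N₂
    have ha := neg_abs_le a
    have ha' := le_abs_self a
    refine ((Set.finite_Icc (N + N₁ + N₂) R).prod
      (Set.finite_Icc (N + N₁ + N₂) R)).subset fun p hp => ?_
    obtain ⟨j, k⟩ := p
    by_contra h
    refine hp ?_
    simp only [Set.mem_prod, Set.mem_Icc] at h
    simp only [nprodTerm]
    split_ifs with h0 h1 h1
    · simp [hM (a - j - k) (by omega)]
    · by_cases hk : k < N₁
      · simp [hN1 k hk]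
      · simp [hM1 k ⟨by omega, by omega⟩ (a - j - k) (by omega)]
    · by_cases hj : j < N
      · simp [hN j hj]
      · simp [hM2 j ⟨by omega, by omega⟩ (a - j - k) (by omega)]
    · by_cases hj : j < N
      · simp [hN j hj]
      · by_cases hk : k < N₂
        · simp [hN2 j ⟨by omega, by omega⟩ k hk]
        · simp [hM3' j k (by omega) (by omega) (by omega) (by omega) (a - j - k) (by omega)]
  rw [key hA hB, key hB hA, locSum_comm hfin]
  congr 1; funext k; congr 1; funext j
  simp only [nprodTerm, show a - j - k = a - k - j by ring]
  -- When one mode stands to the left of C and the other to the right, associativity suffices;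
  -- commutativity enters only when both are on the same side.
  split_ifs with h1 h2 h2
  · rw [← mul_assoc, (hpos j k h1 h2).eq, mul_assoc]
  · rw [mul_assoc]
  · rw [mul_assoc]
  · rw [mul_assoc, mul_assoc, (hneg j k (by omega) (by omega)).eq]

/-! ### Schur polynomials and exponential series -/

/-- The monomial `∏_k t_k ^ n_k / n_k!` attached to a multiset of parts. -/
def schurMonomial (M : Multiset ℕ) : MvPolynomial ℕ ℂ :=
  ∏ k ∈ M.toFinset, C (((M.count k).factorial : ℂ)⁻¹) * X k ^ M.count k

theorem schurMonomial_eq_prod (M : Multiset ℕ) {s : Finset ℕ} (h : M.toFinset ⊆ s) :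
    schurMonomial M = ∏ k ∈ s, C (((M.count k).factorial : ℂ)⁻¹) * X k ^ M.count k := by
  refine Finset.prod_subset h fun k _ hk => ?_
  rw [Multiset.mem_toFinset] at hk
  simp [Multiset.count_eq_zero_of_notMem hk]

/-- Adjoining a part k raises its multiplicity n to n + 1, and t·tⁿ/n! = (n+1)·tⁿ⁺¹/(n+1)!. -/
theorem X_mul_schurMonomial (k : ℕ) (M : Multiset ℕ) :
    X k * schurMonomial M = ((k ::ₘ M).count k : MvPolynomial ℕ ℂ) * schurMonomial (k ::ₘ M) := by
  have hs : M.toFinset ⊆ (k ::ₘ M).toFinset := by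
    intro j hj
    simp only [Multiset.mem_toFinset, Multiset.mem_cons] at hj ⊢
    exact Or.inr hj
  have hk : k ∈ (k ::ₘ M).toFinset := by simp
  rw [schurMonomial_eq_prod M hs, schurMonomial, ← Finset.mul_prod_erase _ _ hk,
    ← Finset.mul_prod_erase _ _ hk]
  have h : ∀ j ∈ (k ::ₘ M).toFinset.erase k,
      (C ((((k ::ₘ M).count j).factorial : ℂ)⁻¹) * X j ^ (k ::ₘ M).count j : MvPolynomial ℕ ℂ) =
        C (((M.count j).factorial : ℂ)⁻¹) * X j ^ M.count j := by
    intro j hj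
    rw [Multiset.count_cons_of_ne (Finset.ne_of_mem_erase hj)]
  rw [Finset.prod_congr rfl h, Multiset.count_cons_self]
  have h0 : ((M.count k + 1 : ℕ) : ℂ) ≠ 0 := Nat.cast_ne_zero.2 (Nat.succ_ne_zero _)
  have e : (C (((M.count k).factorial : ℂ)⁻¹) : MvPolynomial ℕ ℂ) =
      ((M.count k + 1 : ℕ) : MvPolynomial ℕ ℂ) * C (((M.count k + 1).factorial : ℂ)⁻¹) := by
    rw [show ((M.count k + 1 : ℕ) : MvPolynomial ℕ ℂ) = C ((M.count k + 1 : ℕ) : ℂ) by simp,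
      ← C_mul, Nat.factorial_succ, Nat.cast_mul, mul_inv, ← mul_assoc, mul_inv_cancel₀ h0, one_mul]
  rw [e, pow_succ]
  ring

theorem schur_zero : schur 0 = 1 := by
  rw [schur, Fintype.sum_unique]
  simp

/-- This is the differential equation of exp(∑ t_k z^k), read off in the coefficient of z^N.
Combinatorially, N + 1 is the sum of the parts of a partition counted with multiplicity, and
removing one chosen part j + 1 leaves a partition of N - j. -/
theorem schur_succ (N : ℕ) : ((N + 1 : ℕ) : MvPolynomial ℕ ℂ) * schur (N + 1) =
    ∑ j ∈ range (N + 1), ((j + 1 : ℕ) : MvPolynomial ℕ ℂ) * X (j + 1) * schur (N - j) := by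
  have h1 : ((N + 1 : ℕ) : MvPolynomial ℕ ℂ) * schur (N + 1) =
      ∑ p : (N + 1).Partition, ∑ k ∈ p.parts.toFinset,
        (k : MvPolynomial ℕ ℂ) * ((p.parts.count k : MvPolynomial ℕ ℂ) * schurMonomial p.parts) := by
    rw [schur, Finset.mul_sum]
    refine Finset.sum_congr rfl fun p _ => ?_
    have h := p.parts_sum
    rw [Finset.sum_multiset_count] at h
    have h' : ((N + 1 : ℕ) : MvPolynomial ℕ ℂ) =
        ∑ k ∈ p.parts.toFinset, (p.parts.count k : MvPolynomial ℕ ℂ) * k := by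
      exact_mod_cast h.symm
    rw [h', Finset.sum_mul]
    refine Finset.sum_congr rfl fun k _ => ?_
    rw [schurMonomial]
    ring
  have h2 : ∀ j ∈ range (N + 1), ((j + 1 : ℕ) : MvPolynomial ℕ ℂ) * X (j + 1) * schur (N - j) =
      ∑ q : (N - j).Partition, ((j + 1 : ℕ) : MvPolynomial ℕ ℂ) *
        (((((j + 1) ::ₘ q.parts).count (j + 1) : ℕ) : MvPolynomial ℕ ℂ) *
          schurMonomial ((j + 1) ::ₘ q.parts)) := by
    intro j _
    rw [schur, Finset.mul_sum]
    refine Finset.sum_congr rfl fun q _ => ?_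
    rw [← X_mul_schurMonomial, schurMonomial]
    ring
  rw [h1, Finset.sum_congr rfl h2, Finset.sum_sigma', Finset.sum_sigma']
  symm
  refine Finset.sum_bij'
    (i := fun x hx => ⟨⟨(x.1 + 1) ::ₘ x.2.parts, ?_, ?_⟩, x.1 + 1⟩)
    (j := fun y hy => ⟨y.2 - 1, ⟨y.1.parts.erase y.2, ?_, ?_⟩⟩) ?_ ?_ ?_ ?_ ?_
  · intro i hi
    rw [Multiset.mem_cons] at hi
    rcases hi with rfl | hi
    · omega
    · exact x.2.parts_pos hi
  · have := x.2.parts_sum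
    simp only [Finset.mem_sigma, Finset.mem_range] at hx
    rw [Multiset.sum_cons, this]; omega
  · intro i hi
    exact y.1.parts_pos (Multiset.mem_of_mem_erase hi)
  · simp only [Finset.mem_sigma, Multiset.mem_toFinset] at hy
    have h := Multiset.sum_erase hy.2
    have h' := y.1.parts_sum
    have := y.1.parts_pos hy.2
    omega
  · intro x _
    simp
  · intro y hy
    simp only [Finset.mem_sigma, Multiset.mem_toFinset] at hy
    have h := Multiset.sum_erase hy.2
    have h' := y.1.parts_sum
    have := y.1.parts_pos hy.2
    simp only [Finset.mem_sigma, Finset.mem_range, Finset.mem_univ, and_true]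
    omega
  · rintro ⟨j, q⟩ _
    simp
  · rintro ⟨p, k⟩ hy
    simp only [Finset.mem_sigma, Multiset.mem_toFinset] at hy
    have h0 := p.parts_pos hy.2
    obtain ⟨k, rfl⟩ := Nat.exists_eq_succ_of_ne_zero h0.ne'
    have : (k + 1) ::ₘ p.parts.erase (k + 1) = p.parts := Multiset.cons_erase hy.2
    simp [this]
  · rintro ⟨j, q⟩ _
    rfl

section ExpSeries

variable {A B : Type*} [CommRing A] [Algebra ℂ A] [CommRing B] [Algebra ℂ B]

/-- The coefficient of `z ^ N` in `exp (∑_{r ≥ 0} ξ_r z ^ (r+1) / (r+1))`. -/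
def expCoeff (ξ : ℕ → A) (N : ℕ) : A :=
  aeval (R := ℂ) (fun k : ℕ => (k : ℂ)⁻¹ • ξ (k - 1)) (schur N)

theorem expCoeff_zero (ξ : ℕ → A) : expCoeff ξ 0 = 1 := by simp [expCoeff, schur_zero]

/-- The coefficient form of f' = (∑ ξ_r z^r) f. Together with f(0) = 1 it characterizes the
exponential, and all later identities for exponentials come from this equation. -/
theorem expCoeff_succ (ξ : ℕ → A) (N : ℕ) :
    ((N + 1 : ℕ) : A) * expCoeff ξ (N + 1) = ∑ j ∈ range (N + 1), ξ j * expCoeff ξ (N - j) := by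
  have h := congrArg (aeval (R := ℂ) (fun k : ℕ => (k : ℂ)⁻¹ • ξ (k - 1))) (schur_succ N)
  rw [map_mul, map_natCast, map_sum] at h
  rw [expCoeff, h]
  refine Finset.sum_congr rfl fun j _ => ?_
  rw [map_mul, map_mul, map_natCast, aeval_X, expCoeff]
  congr 1
  have h0 : ((j + 1 : ℕ) : ℂ) ≠ 0 := Nat.cast_ne_zero.2 (Nat.succ_ne_zero _)
  rw [show ((j + 1 : ℕ) : A) = algebraMap ℂ A ((j + 1 : ℕ) : ℂ) by simp, ← Algebra.smul_def,
    smul_smul, mul_inv_cancel₀ h0, one_smul, Nat.add_sub_cancel]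

theorem map_expCoeff (φ : A →ₐ[ℂ] B) (ξ : ℕ → A) (N : ℕ) :
    φ (expCoeff ξ N) = expCoeff (fun r => φ (ξ r)) N := by
  rw [expCoeff, expCoeff, ← AlgHom.comp_apply, MvPolynomial.comp_aeval]
  simp

/-- The power series `exp (∑_{r ≥ 0} ξ_r z ^ (r+1) / (r+1))`. -/
def expSeries (ξ : ℕ → A) : PowerSeries A := PowerSeries.mk (expCoeff ξ)

/-- Positive integers are units in a ℂ-algebra, so the target ring need not be a domain. -/
theorem natCast_mul_cancel {n : ℕ} (hn : n ≠ 0) {x y : A} (h : (n : A) * x = n * y) : x = y := by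
  have h0 : ((n : ℕ) : ℂ) ≠ 0 := by exact_mod_cast hn
  have e : ∀ x : A, (n : ℂ)⁻¹ • ((n : A) * x) = x := fun x => by
    rw [show (n : A) = algebraMap ℂ A (n : ℂ) by simp, ← Algebra.smul_def, smul_smul,
      inv_mul_cancel₀ h0, one_smul]
  rw [← e x, h, e]

theorem derivative_expSeries (ξ : ℕ → A) :
    PowerSeries.derivative A (expSeries ξ) = PowerSeries.mk ξ * expSeries ξ := by
  ext N
  rw [PowerSeries.coeff_derivative, PowerSeries.coeff_mul,
    Finset.Nat.sum_antidiagonal_eq_sum_range_succ_mk, expSeries, PowerSeries.coeff_mk, mul_comm]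
  simpa using expCoeff_succ ξ N

theorem constantCoeff_expSeries (ξ : ℕ → A) :
    PowerSeries.constantCoeff (expSeries ξ) = 1 := by
  rw [← PowerSeries.coeff_zero_eq_constantCoeff_apply, expSeries, PowerSeries.coeff_mk,
    expCoeff_zero]

/-- Uniqueness for the first order linear equation `f' - h f = u`. -/
theorem eq_of_derivative_sub_mul_eq {f g h : PowerSeries A}
    (hd : PowerSeries.derivative A f - h * f = PowerSeries.derivative A g - h * g)
    (h0 : PowerSeries.constantCoeff f = PowerSeries.constantCoeff g) : f = g := by
  have key : PowerSeries.derivative A (f - g) = h * (f - g) := by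
    rw [map_sub]; linear_combination hd
  have : ∀ N, ∀ n ≤ N, PowerSeries.coeff n (f - g) = 0 := by
    intro N
    induction N with
    | zero =>
      intro n hn
      obtain rfl : n = 0 := by omega
      simp [h0]
    | succ N ih =>
      intro n hn
      rcases Nat.lt_or_ge n (N + 1) with h1 | h1
      · exact ih n (by omega)
      obtain rfl : n = N + 1 := by omega
      have h2 := congrArg (PowerSeries.coeff N) key
      rw [PowerSeries.coeff_derivative, PowerSeries.coeff_mul, Finset.sum_eq_zero] at h2
      · refine natCast_mul_cancel (Nat.succ_ne_zero N) ?_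
        rw [mul_zero, ← h2]; push_cast; ring
      · intro p hp
        rw [ih p.2 (by have := Finset.HasAntidiagonal.mem_antidiagonal.1 hp; omega), mul_zero]
  rw [← sub_eq_zero]
  ext n
  simpa using this n n le_rfl

theorem eq_expSeries {f : PowerSeries A} {ξ : ℕ → A}
    (hd : PowerSeries.derivative A f = PowerSeries.mk ξ * f)
    (h0 : PowerSeries.constantCoeff f = 1) : f = expSeries ξ :=
  eq_of_derivative_sub_mul_eq (h := PowerSeries.mk ξ)
    (by rw [hd, derivative_expSeries, sub_self, sub_self])
    (by rw [h0, constantCoeff_expSeries])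

/-- Both sides solve f' = (∑ (ξ_r + η_r) z^r) f with constant term 1. -/
theorem expSeries_add (ξ η : ℕ → A) : expSeries (ξ + η) = expSeries ξ * expSeries η := by
  refine (eq_expSeries ?_ ?_).symm
  · rw [Derivation.leibniz, derivative_expSeries, derivative_expSeries,
      show PowerSeries.mk (ξ + η) = PowerSeries.mk ξ + PowerSeries.mk η by ext; simp]
    simp only [smul_eq_mul]; ring
  · rw [map_mul, constantCoeff_expSeries, constantCoeff_expSeries, one_mul]

theorem expSeries_zero : expSeries (0 : ℕ → A) = 1 := by
  refine (eq_expSeries ?_ (map_one _)).symm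
  rw [Derivation.map_one_eq_zero, show PowerSeries.mk (0 : ℕ → A) = 0 by ext; simp, zero_mul]

/-- Here exp(m ∑ (yz)^r / r) = (1 - yz)^{-m}, with coefficients the multiset numbers. The case m = 1
holds because 1 - yz is itself an exponential series; Pascal's rule for `Nat.multichoose` gives the
rest by induction. -/
theorem expCoeff_natCast_mul_pow (m : ℕ) (y : A) (N : ℕ) :
    expCoeff (fun r => (m : A) * y ^ (r + 1)) N = (m.multichoose N : A) * y ^ N := by
  have step : expSeries (fun r => y ^ (r + 1)) * (1 - PowerSeries.C y * PowerSeries.X) = 1 := by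
    have h : 1 - PowerSeries.C y * PowerSeries.X = expSeries (fun r => -y ^ (r + 1)) := by
      refine eq_expSeries ?_ (by simp)
      ext n
      rcases n with _ | n
      · simp [mul_sub, ← mul_assoc]
      · rw [mul_sub, mul_one, ← mul_assoc, map_sub (PowerSeries.coeff (n + 1)),
          PowerSeries.coeff_succ_mul_X, mul_comm _ (PowerSeries.C y), PowerSeries.coeff_C_mul]
        simp
        ring
    rw [h, ← expSeries_add, ← expSeries_zero]
    congr 1; funext r; simp
  have main : expSeries (fun r => (m : A) * y ^ (r + 1)) =
      PowerSeries.mk fun N => (m.multichoose N : A) * y ^ N := by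
    induction m with
    | zero =>
      rw [show (fun r => ((0 : ℕ) : A) * y ^ (r + 1)) = 0 by funext r; simp, expSeries_zero]
      ext n
      rcases n with _ | n <;> simp [PowerSeries.coeff_one]
    | succ m ih =>
      rw [show (fun r => ((m + 1 : ℕ) : A) * y ^ (r + 1)) =
        (fun r => (m : A) * y ^ (r + 1)) + fun r => y ^ (r + 1) by funext r; simp; ring,
        expSeries_add, ih]
      have h2 : (PowerSeries.mk fun N => (m.multichoose N : A) * y ^ N) =
          (PowerSeries.mk fun N => ((m + 1).multichoose N : A) * y ^ N) *
            (1 - PowerSeries.C y * PowerSeries.X) := by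
        ext n
        rw [mul_sub, mul_one, ← mul_assoc, map_sub]
        rcases n with _ | n
        · simp
        · rw [PowerSeries.coeff_succ_mul_X, mul_comm _ (PowerSeries.C y), PowerSeries.coeff_C_mul]
          simp only [PowerSeries.coeff_mk, Nat.multichoose_succ_succ]
          push_cast; ring
      rw [h2, mul_assoc, mul_comm (1 - _), step, mul_one]
  have := congrArg (PowerSeries.coeff N) main
  simpa [expSeries] using this

/-- This is D(exp S) = D(S) exp S. The two sides satisfy the same inhomogeneous linear equation f' -
S' f = (D S)' exp S and both have zero constant term. -/
theorem derivation_expCoeff (D : Derivation ℂ A A) (ξ : ℕ → A) (N : ℕ) :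
    D (expCoeff ξ N) = ∑ j ∈ range N, ((j + 1 : ℕ) : ℂ)⁻¹ • D (ξ j) * expCoeff ξ (N - 1 - j) := by
  have main : PowerSeries.mk (fun N => D (expCoeff ξ N)) =
      PowerSeries.mk (fun N => match N with
        | 0 => 0
        | j + 1 => ((j + 1 : ℕ) : ℂ)⁻¹ • D (ξ j)) * expSeries ξ := by
    refine eq_of_derivative_sub_mul_eq (h := PowerSeries.mk ξ) ?_ ?_
    · have h1 : PowerSeries.derivative A (PowerSeries.mk fun N => D (expCoeff ξ N)) =
          PowerSeries.mk ξ * (PowerSeries.mk fun N => D (expCoeff ξ N)) +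
            PowerSeries.mk (fun j => D (ξ j)) * expSeries ξ := by
        ext N
        have h := congrArg D (expCoeff_succ ξ N)
        rw [Derivation.leibniz, map_sum] at h
        simp only [Derivation.leibniz, Derivation.map_natCast, smul_eq_mul, mul_zero, add_zero] at h
        rw [PowerSeries.coeff_derivative, map_add, PowerSeries.coeff_mul, PowerSeries.coeff_mul,
          Finset.Nat.sum_antidiagonal_eq_sum_range_succ_mk,
          Finset.Nat.sum_antidiagonal_eq_sum_range_succ_mk, ← Finset.sum_add_distrib]
        simp only [PowerSeries.coeff_mk, expSeries]
        rw [mul_comm]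
        push_cast at h
        rw [h]
        exact Finset.sum_congr rfl fun j _ => by ring
      have h2 : PowerSeries.derivative A (PowerSeries.mk (fun N => match N with
          | 0 => 0
          | j + 1 => ((j + 1 : ℕ) : ℂ)⁻¹ • D (ξ j))) = PowerSeries.mk (fun j => D (ξ j)) := by
        ext N
        rw [PowerSeries.coeff_derivative, PowerSeries.coeff_mk, PowerSeries.coeff_mk]
        have h0 : ((N + 1 : ℕ) : ℂ) ≠ 0 := Nat.cast_ne_zero.2 (Nat.succ_ne_zero _)
        rw [show ((N : A) + 1) = algebraMap ℂ A ((N + 1 : ℕ) : ℂ) by simp, mul_comm,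
          ← Algebra.smul_def, smul_smul, mul_inv_cancel₀ h0, one_smul]
      rw [h1, Derivation.leibniz, h2, derivative_expSeries]
      simp only [smul_eq_mul]; ring
    · rw [map_mul, ← PowerSeries.coeff_zero_eq_constantCoeff_apply,
        ← PowerSeries.coeff_zero_eq_constantCoeff_apply, PowerSeries.coeff_mk,
        PowerSeries.coeff_mk, expCoeff_zero]
      simp
  have h := congrArg (PowerSeries.coeff N) main
  rw [PowerSeries.coeff_mk, PowerSeries.coeff_mul] at h
  rw [h]
  rcases N with _ | N
  · simp
  · rw [Finset.Nat.antidiagonal_succ]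
    simp [Finset.Nat.sum_antidiagonal_eq_sum_range_succ_mk, expSeries]

end ExpSeries

/-! ### The creation part of the charged fields -/

theorem creation_natCast (ε : ℤ) (N : ℕ) :
    creation ε N = expCoeff (fun r => (ε : ℂ) • (X r : MvPolynomial ℕ ℂ)) N := by
  rw [creation, if_pos (by omega), Int.toNat_natCast, expCoeff]
  congr 2
  funext k
  rw [smul_smul, MvPolynomial.smul_eq_C_mul, div_eq_mul_inv, mul_comm (ε : ℂ)]

theorem creation_of_neg (ε : ℤ) {n : ℤ} (hn : n < 0) : creation ε n = 0 :=
  if_neg (by omega)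

theorem creation_zero (ε : ℤ) : creation ε 0 = 1 := by
  have := creation_natCast ε 0
  rwa [expCoeff_zero] at this

/-! ### The Heisenberg algebra on the state space -/

theorem heis_single (m : ℕ) (n k : ℤ) (q : MvPolynomial ℕ ℂ) :
    heis m n (Finsupp.single k q) = Finsupp.single k (heisSector m k n q) := by
  simp [heis]

theorem heis_neg_single (m p : ℕ) (k : ℤ) (q : MvPolynomial ℕ ℂ) :
    heis m (-((p : ℤ) + 1)) (Finsupp.single k q) = Finsupp.single k (X p * q) := by
  rw [heis_single, heisSector, if_neg (by omega), if_neg (by omega),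
    show (-(-((p : ℤ) + 1)) - 1).toNat = p by omega, LinearMap.mulLeft_apply]

theorem heis_zero_single (m : ℕ) (k : ℤ) (q : MvPolynomial ℕ ℂ) :
    heis m 0 (Finsupp.single k q) = ((m : ℂ) * k) • Finsupp.single k q := by
  rw [heis_single, heisSector, if_neg (by omega), if_pos rfl]
  simp

theorem heis_pos_single (m p : ℕ) (k : ℤ) (q : MvPolynomial ℕ ℂ) :
    heis m ((p : ℤ) + 1) (Finsupp.single k q) =
      ((m : ℂ) * (p + 1)) • Finsupp.single k (pderiv p q) := by
  rw [heis_single, heisSector, if_pos (by omega), show ((p : ℤ) + 1 - 1).toNat = p by omega]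
  simp

/-- The state space is generated from the vectors `|k⟩` by the creation operators. -/
theorem fock_induction (m : ℕ) {P : Fock → Prop} (vac : ∀ k : ℤ, P (Finsupp.single k 1))
    (add : ∀ v w, P v → P w → P (v + w)) (smul : ∀ (c : ℂ) v, P v → P (c • v))
    (heis : ∀ (p : ℕ) v, P v → P (heis m (-((p : ℤ) + 1)) v)) (v : Fock) : P v := by
  have h0 : P 0 := by simpa using smul 0 _ (vac 0)
  induction v using Finsupp.induction_linear with
  | zero => exact h0
  | add v w hv hw => exact add v w hv hw
  | single k q =>
    induction q using MvPolynomial.induction_on with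
    | C c =>
      have := smul c _ (vac k)
      rwa [Finsupp.smul_single, MvPolynomial.smul_eq_C_mul, mul_one] at this
    | add p q hp hq => rw [Finsupp.single_add]; exact add _ _ hp hq
    | mul_X q p hq =>
      rw [mul_comm, ← heis_neg_single m]
      exact heis p _ hq

/-- A family of operators that annihilates the vectors `|k⟩` and whose common kernel is stable under
the creation operators vanishes. -/
theorem eq_zero_of_vac_of_heis (m : ℕ) {ι : Type*} {X : ι → Module.End ℂ Fock}
    (vac : ∀ i (k : ℤ), X i (Finsupp.single k 1) = 0)
    (heis : ∀ i (p : ℕ) v, (∀ j, X j v = 0) → X i (heis m (-((p : ℤ) + 1)) v) = 0) (i : ι) :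
    X i = 0 := by
  refine LinearMap.ext fun v => ?_
  have : ∀ v, ∀ i, X i v = 0 := by
    refine fock_induction m (fun k i => vac i k) (fun v w hv hw i => ?_) (fun c v hv i => ?_)
      (fun p v hv i => heis i p v hv)
    · rw [map_add, hv, hw, add_zero]
    · rw [map_smul, hv, smul_zero]
  exact this v i

/-- Only commutators with creation operators are computed by hand. With the action on |k⟩ they are
the input for every later induction over the state space. -/
theorem heis_heis_neg (m : ℕ) (n : ℤ) (p : ℕ) (v : Fock) :
    heis m n (heis m (-((p : ℤ) + 1)) v) = heis m (-((p : ℤ) + 1)) (heis m n v) +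
      (if n = p + 1 then (m : ℂ) * (p + 1) else 0) • v := by
  induction v using Finsupp.induction_linear with
  | zero => simp
  | add v w hv hw => simp only [map_add, hv, hw, smul_add]; abel
  | single k q =>
    rcases lt_trichotomy n 0 with hn | rfl | hn
    · obtain ⟨r, rfl⟩ : ∃ r : ℕ, n = -((r : ℤ) + 1) := ⟨(-n - 1).toNat, by omega⟩
      rw [if_neg (by omega)]
      simp only [heis_neg_single, zero_smul, add_zero]
      rw [mul_left_comm]
    · rw [if_neg (by omega)]
      simp only [heis_neg_single, heis_zero_single, zero_smul, add_zero, map_smul]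
    · obtain ⟨r, rfl⟩ : ∃ r : ℕ, n = (r : ℤ) + 1 := ⟨(n - 1).toNat, by omega⟩
      simp only [heis_neg_single, heis_pos_single, map_smul, Derivation.leibniz, pderiv_X,
        smul_eq_mul, Finsupp.single_add, smul_add]
      congr 1
      by_cases h : r = p
      · subst h; simp
      · rw [if_neg (by omega), Pi.single_eq_of_ne' h]; simp

theorem heis_vac_of_pos (m : ℕ) {n : ℤ} (hn : 0 < n) (k : ℤ) :
    heis m n (Finsupp.single k 1) = 0 := by
  obtain ⟨r, rfl⟩ : ∃ r : ℕ, n = (r : ℤ) + 1 := ⟨(n - 1).toNat, by omega⟩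
  simp [heis_pos_single]

theorem heis_zero_vac (m : ℕ) (k : ℤ) :
    heis m 0 (Finsupp.single k 1) = ((m : ℂ) * k) • Finsupp.single k 1 := heis_zero_single m k 1

theorem heis_commute_of_nonneg (m : ℕ) {n k : ℤ} (hn : 0 ≤ n) (hk : 0 ≤ k) :
    Commute (heis m n) (heis m k) := by
  have := eq_zero_of_vac_of_heis m (ι := Unit)
    (X := fun _ => heis m n * heis m k - heis m k * heis m n) ?_ ?_ ()
  · exact sub_eq_zero.1 this
  · intro _ l
    rcases hn.lt_or_eq with hn | rfl <;> rcases hk.lt_or_eq with hk | rfl <;>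
    simp [heis_vac_of_pos, heis_zero_vac, -Finsupp.smul_single, *]
  · intro _ p v h
    have h' := h ()
    simp only [LinearMap.sub_apply, Module.End.mul_apply] at h' ⊢
    simp only [heis_heis_neg, map_add, map_smul]
    rw [sub_eq_zero.1 h']
    abel

theorem heis_commute_of_neg (m : ℕ) {n k : ℤ} (hn : n < 0) (hk : k < 0) :
    Commute (heis m n) (heis m k) := by
  obtain ⟨r, rfl⟩ : ∃ r : ℕ, k = -((r : ℤ) + 1) := ⟨(-k - 1).toNat, by omega⟩
  refine LinearMap.ext fun v => ?_
  rw [Module.End.mul_apply, Module.End.mul_apply, heis_heis_neg, if_neg (by omega), zero_smul,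
    add_zero]

theorem isField_current (m : ℕ) : IsField (current m) := by
  refine fock_induction m (fun k => ⟨-1, fun a ha => heis_vac_of_pos m (by omega) k⟩) ?_ ?_ ?_
  · rintro v w ⟨N, hN⟩ ⟨M, hM⟩
    exact ⟨min N M, fun a ha => by rw [map_add, hN a (by omega), hM a (by omega), add_zero]⟩
  · rintro c v ⟨N, hN⟩
    exact ⟨N, fun a ha => by rw [map_smul, hN a ha, smul_zero]⟩
  · rintro p v ⟨N, hN⟩
    refine ⟨min N (-(p : ℤ) - 2), fun a ha => ?_⟩
    have := hN a (by omega)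
    rw [current] at this ⊢
    rw [heis_heis_neg, this, if_neg (by omega)]
    simp

/-! ### The charged fields -/

/-- The exponential recursion extended to all integer exponents; for N ≤ 0 both sides vanish. -/
theorem natCast_smul_creation (ε N : ℤ) :
    (N : ℂ) • creation ε N =
      (ε : ℂ) • ∑ j ∈ range N.toNat, X j * creation ε (N - 1 - j) := by
  rcases lt_trichotomy N 0 with hN | rfl | hN
  · rw [creation_of_neg ε hN, show N.toNat = 0 by omega]; simp
  · simp
  · obtain ⟨r, rfl⟩ : ∃ r : ℕ, N = ((r + 1 : ℕ) : ℤ) := ⟨(N - 1).toNat, by omega⟩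
    have h := expCoeff_succ (fun r => (ε : ℂ) • (X r : MvPolynomial ℕ ℂ)) r
    rw [creation_natCast, Int.toNat_natCast, MvPolynomial.smul_eq_C_mul, Finset.smul_sum]
    rw [show C ((((r + 1 : ℕ) : ℤ) : ℂ)) = ((r + 1 : ℕ) : MvPolynomial ℕ ℂ) by simp, h]
    refine Finset.sum_congr rfl fun j hj => ?_
    rw [Finset.mem_range] at hj
    rw [show ((r + 1 : ℕ) : ℤ) - 1 - j = ((r - j : ℕ) : ℤ) by omega, creation_natCast,
      smul_mul_assoc]

theorem derivation_creation (D : Derivation ℂ (MvPolynomial ℕ ℂ) (MvPolynomial ℕ ℂ)) (ε N : ℤ) :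
    D (creation ε N) = (ε : ℂ) • ∑ j ∈ range N.toNat,
      (((j + 1 : ℕ) : ℂ)⁻¹ • D (X j)) * creation ε (N - 1 - j) := by
  rcases lt_or_ge N 0 with hN | hN
  · rw [creation_of_neg ε hN, show N.toNat = 0 by omega]; simp
  · obtain ⟨r, rfl⟩ : ∃ r : ℕ, N = (r : ℤ) := ⟨N.toNat, by omega⟩
    rw [creation_natCast, derivation_expCoeff, Int.toNat_natCast, Finset.smul_sum]
    refine Finset.sum_congr rfl fun j hj => ?_
    rw [Finset.mem_range] at hj
    rw [show (r : ℤ) - 1 - j = ((r - 1 - j : ℕ) : ℤ) by omega, creation_natCast, D.map_smul,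
      smul_comm, smul_mul_assoc]

/-- Differentiating exp(ε ∑ x_{r-1} z^r / r) in x_p multiplies it by ε z^{p+1}/(p+1), which is a
shift of the exponent of z. -/
theorem pderiv_creation (ε N : ℤ) (p : ℕ) :
    pderiv p (creation ε N) = ((ε : ℂ) * ((p : ℂ) + 1)⁻¹) • creation ε (N - 1 - p) := by
  rw [derivation_creation, mul_smul]
  congr 1
  rcases lt_or_ge (N - 1 - p) 0 with h | h
  · rw [creation_of_neg ε h, smul_zero]
    refine Finset.sum_eq_zero fun j hj => ?_
    rw [Finset.mem_range] at hj
    rw [pderiv_X, Pi.single_eq_of_ne (by omega)]; simp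
  · rw [Finset.sum_eq_single p]
    · simp
    · intro j _ hj
      rw [pderiv_X, Pi.single_eq_of_ne' hj.symm]; simp
    · intro h'
      rw [Finset.mem_range] at h'; omega

/-- The sum over the annihilation part in the definition of the charged fields. -/
def chargedSum (ε c : ℤ) : Polynomial (MvPolynomial ℕ ℂ) →ₗ[ℂ] MvPolynomial ℕ ℂ :=
  Polynomial.lsum fun j : ℕ => LinearMap.mulLeft ℂ (creation ε (c + j))

theorem chargedSum_monomial (ε c : ℤ) (j : ℕ) (q : MvPolynomial ℕ ℂ) :
    chargedSum ε c (Polynomial.monomial j q) = creation ε (c + j) * q := by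
  simp [chargedSum, Polynomial.lsum_apply]

theorem chargedSum_C_mul (ε c : ℤ) (r : MvPolynomial ℕ ℂ) (f : Polynomial (MvPolynomial ℕ ℂ)) :
    chargedSum ε c (Polynomial.C r * f) = r * chargedSum ε c f := by
  induction f using Polynomial.induction_on' with
  | add f g hf hg => rw [mul_add, map_add, map_add, hf, hg, mul_add]
  | monomial j q =>
    rw [Polynomial.C_mul_monomial, chargedSum_monomial, chargedSum_monomial]; ring

theorem chargedSum_X_pow_mul (ε c : ℤ) (n : ℕ) (f : Polynomial (MvPolynomial ℕ ℂ)) :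
    chargedSum ε c (Polynomial.X ^ n * f) = chargedSum ε (c + n) f := by
  induction f using Polynomial.induction_on' with
  | add f g hf hg => rw [mul_add, map_add, map_add, hf, hg]
  | monomial j q =>
    rw [mul_comm, Polynomial.monomial_mul_X_pow, chargedSum_monomial, chargedSum_monomial]
    congr 2; push_cast; ring

theorem charged_single (m : ℕ) (ε a k : ℤ) (q : MvPolynomial ℕ ℂ) :
    charged m ε a (Finsupp.single k q) =
      Finsupp.single (k + ε) (chargedSum ε (a - ε * m * k) (annihilation m ε q)) := by
  simp [charged, chargedSum]

theorem charged_vac (m : ℕ) (ε a k : ℤ) :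
    charged m ε a (Finsupp.single k 1) = Finsupp.single (k + ε) (creation ε (a - ε * m * k)) := by
  rw [charged_single, map_one, ← Polynomial.monomial_zero_one, chargedSum_monomial]
  simp

/-- The annihilation part of the field is an algebra homomorphism sending x_p to x_p - ε m
z^{-(p+1)}. The first summand commutes through, and the second shifts the power of z. -/
theorem charged_heis_neg (m : ℕ) (ε a : ℤ) (p : ℕ) (v : Fock) :
    charged m ε a (heis m (-((p : ℤ) + 1)) v) = heis m (-((p : ℤ) + 1)) (charged m ε a v) -
      ((ε : ℂ) * m) • charged m ε (a + (p + 1)) v := by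
  induction v using Finsupp.induction_linear with
  | zero => simp
  | add v w hv hw => simp only [map_add, hv, hw, smul_add]; abel
  | single k q =>
    rw [heis_neg_single, charged_single, charged_single, charged_single, heis_neg_single,
      Finsupp.smul_single, ← Finsupp.single_sub]
    congr 1
    rw [map_mul, annihilation, aeval_X, sub_mul, map_sub,
      mul_assoc (Polynomial.C _), chargedSum_C_mul, chargedSum_C_mul, chargedSum_X_pow_mul, MvPolynomial.smul_eq_C_mul]
    congr 4
    push_cast; ring

/-- The defect is considered for all a at once: passing a creation operator through it produces the
defects at a and at a + p + 1. -/
theorem heis_charged (m : ℕ) (ε n a : ℤ) :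
    heis m n * charged m ε a - charged m ε a * heis m n = ((ε : ℂ) * m) • charged m ε (a - n) := by
  have := eq_zero_of_vac_of_heis m (X := fun a => heis m n * charged m ε a -
    charged m ε a * heis m n - ((ε : ℂ) * m) • charged m ε (a - n)) ?_ ?_ a
  · exact sub_eq_zero.1 this
  · intro a k
    simp only [LinearMap.sub_apply, Module.End.mul_apply, LinearMap.smul_apply]
    rcases lt_trichotomy n 0 with hn | rfl | hn
    · obtain ⟨r, rfl⟩ : ∃ r : ℕ, n = -((r : ℤ) + 1) := ⟨(-n - 1).toNat, by omega⟩
      rw [charged_heis_neg, sub_neg_eq_add]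
      abel
    · rw [heis_zero_vac, map_smul, charged_vac, heis_zero_single, sub_zero, charged_vac,
        ← sub_smul, ← sub_smul]
      push_cast
      rw [show ((m : ℂ) * (k + ε) - m * k - ε * m) = 0 by ring, zero_smul]
    · rw [heis_vac_of_pos m hn, map_zero, sub_zero, charged_vac, charged_vac]
      obtain ⟨r, rfl⟩ : ∃ r : ℕ, n = (r : ℤ) + 1 := ⟨(n - 1).toNat, by omega⟩
      rw [heis_pos_single, pderiv_creation, ← Finsupp.smul_single, smul_smul,
        show a - ε * m * k - 1 - r = a - (r + 1) - ε * m * k by ring, ← sub_smul]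
      have : (r : ℂ) + 1 ≠ 0 := by exact_mod_cast Nat.succ_ne_zero r
      rw [show (m : ℂ) * (r + 1) * (ε * (r + 1 : ℂ)⁻¹) - ε * m = 0 by field_simp; ring, zero_smul]
  · intro a p v h
    have h1 := h a
    have h2 := h (a + (p + 1))
    simp only [LinearMap.sub_apply, Module.End.mul_apply, LinearMap.smul_apply] at h1 h2 ⊢
    rw [sub_eq_zero, sub_eq_iff_eq_add] at h1 h2
    simp only [heis_heis_neg, charged_heis_neg, map_add, map_sub, map_smul, h1, h2, smul_add,
      smul_sub, show a + ((p : ℤ) + 1) - n = a - n + (p + 1) by ring]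
    abel

/-! ### The stress-energy tensor -/

/-- The distribution `z ^ c` times the unit operator. -/
def delta (c : ℤ) : Dist := fun a => if a = c then 1 else 0

theorem isField_delta (c : ℤ) : IsField (delta c) := fun v =>
  ⟨c, fun a ha => by simp [delta, ha.ne]⟩

theorem nprod_delta_left (c : ℤ) (B : Dist) (a : ℤ) : nprod (delta c) B a = B (a - c) := by
  rw [nprod_apply, locSum_eq_single c]
  · unfold nprodTerm delta; split_ifs <;> simp_all
  · intro j hj
    unfold nprodTerm delta; split_ifs <;> simp_all

theorem nprod_delta_right (c : ℤ) (A : Dist) (a : ℤ) : nprod A (delta c) a = A (a - c) := by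
  rw [nprod_apply, locSum_eq_single (a - c)]
  · unfold nprodTerm delta; split_ifs <;> simp_all
  · intro j hj
    have : a - j ≠ c := by omega
    unfold nprodTerm delta; split_ifs <;> simp_all

theorem bracket_heis_current (m p : ℕ) : bracket (heis m (-((p : ℤ) + 1))) (current m) =
    (-((m : ℂ) * (p + 1))) • delta (-(p : ℤ) - 2) := by
  funext a
  refine LinearMap.ext fun v => ?_
  rw [bracket, LinearMap.sub_apply, Module.End.mul_apply, Module.End.mul_apply, current,
    heis_heis_neg, Pi.smul_apply, LinearMap.smul_apply, delta]
  by_cases h : a = -(p : ℤ) - 2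
  · rw [if_pos (by omega), if_pos h]
    simp
  · rw [if_neg (by omega), if_neg h]
    simp

/-- By the Leibniz rule for normal products: the commutator of H_{-p-1} with H(z) is a multiple of
z^{-p-2}, and the two factors of :H²: contribute equally, which cancels the 1/2 in T. -/
theorem virasoro_heis_neg {m : ℕ} (hm : m ≠ 0) (n : ℤ) (p : ℕ) (v : Fock) :
    virasoro m n (heis m (-((p : ℤ) + 1)) v) = heis m (-((p : ℤ) + 1)) (virasoro m n v) +
      ((p : ℂ) + 1) • heis m (n - (p + 1)) v := by
  have hf := isField_current m
  have h := congrFun (bracket_nprod hf hf (heis m (-((p : ℤ) + 1)))) (-n - 2)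
  rw [bracket_heis_current, nprod_smul_left (isField_delta _) hf,
    nprod_smul_right hf (isField_delta _), Pi.add_apply, Pi.smul_apply, Pi.smul_apply,
    nprod_delta_left, nprod_delta_right, current,
    show -(-n - 2 - (-(p : ℤ) - 2)) - 1 = n - (p + 1) by ring] at h
  have h' := LinearMap.congr_fun h v
  simp only [bracket, LinearMap.sub_apply, Module.End.mul_apply, LinearMap.add_apply,
    LinearMap.smul_apply] at h'
  rw [sub_eq_iff_eq_add] at h'
  simp only [virasoro, stress, Pi.smul_apply, LinearMap.smul_apply, map_smul, h', smul_add,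
    smul_smul]
  have : (m : ℂ) ≠ 0 := Nat.cast_ne_zero.2 hm
  rw [show (1 / (2 * (m : ℂ)) * -((m : ℂ) * (p + 1))) = -(((p : ℂ) + 1) / 2) by field_simp]
  module

theorem virasoro_vac {m : ℕ} (hm : m ≠ 0) (k : ℤ) :
    virasoro m (-1) (Finsupp.single k 1) = (k : ℂ) • Finsupp.single k (X 0) ∧
    virasoro m 0 (Finsupp.single k 1) = ((m : ℂ) * k ^ 2 / 2) • Finsupp.single k 1 ∧
    virasoro m 1 (Finsupp.single k 1) = 0 := by
  have hf := isField_current m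
  have hm' : (m : ℂ) ≠ 0 := Nat.cast_ne_zero.2 hm
  -- Every summand of :H²: other than j = -1 and j = 0 has a mode of positive index on the right,
  -- which kills |k⟩.
  have key : ∀ n : ℤ, -1 ≤ n → virasoro m n (Finsupp.single k 1) = (1 / (2 * (m : ℂ))) •
      (heis m (n + 0) (heis m 0 (Finsupp.single k 1)) +
        heis m (-1) (heis m (n + 1) (Finsupp.single k 1))) := by
    intro n hn
    rw [virasoro, stress, Pi.smul_apply, LinearMap.smul_apply, nprod_apply,
      locSum_apply_eq_sum (locFin_nprodTerm hf hf _) _ {-1, 0}]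
    · rw [Finset.sum_pair (by omega)]
      simp [nprodTerm, current]
      ring_nf
    · intro j hj
      simp only [Finset.mem_insert, Finset.mem_singleton, not_or] at hj
      unfold nprodTerm current
      split_ifs with h
      · rw [Module.End.mul_apply, heis_vac_of_pos m (by omega), map_zero]
      · rw [Module.End.mul_apply, heis_vac_of_pos m (by omega), map_zero]
  have e : heis m (-1) (Finsupp.single k 1) = Finsupp.single k (X 0) := by
    simpa using heis_neg_single m 0 k 1
  refine ⟨?_, ?_, ?_⟩
  · rw [key _ le_rfl]
    simp only [add_zero, neg_add_cancel, heis_zero_vac, map_smul, e, ← add_smul, smul_smul]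
    congr 1; field_simp; ring
  · rw [key _ (by norm_num)]
    simp only [add_zero, zero_add, heis_zero_vac, map_smul, heis_vac_of_pos m one_pos, map_zero,
      smul_smul]
    congr 1; field_simp
  · rw [key _ (by norm_num)]
    simp [heis_zero_vac, heis_vac_of_pos, -Finsupp.smul_single]

/-- The first order differential part of `L_n`, `n ≤ 1`, on the sector of charge number `k`. -/
def virasoroDeriv (m : ℕ) (k n : ℤ) : Derivation ℂ (MvPolynomial ℕ ℂ) (MvPolynomial ℕ ℂ) :=
  mkDerivation ℂ fun j : ℕ => ((j + 1 : ℕ) : ℂ) • heisSector m k (n - (j + 1)) 1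

/-- A second-order term in L_n needs two annihilators of positive index, hence n ≥ 2. For n ≤ 1 the
operator is therefore a derivation plus multiplication by its value on |k⟩. -/
theorem virasoro_single {m : ℕ} (hm : m ≠ 0) {n : ℤ} (hn : n ≤ 1) (k : ℤ)
    {l : MvPolynomial ℕ ℂ} (hl : virasoro m n (Finsupp.single k 1) = Finsupp.single k l)
    (q : MvPolynomial ℕ ℂ) :
    virasoro m n (Finsupp.single k q) = Finsupp.single k (virasoroDeriv m k n q + q * l) := by
  induction q using MvPolynomial.induction_on with
  | C c =>
    have : Finsupp.single k (C c : MvPolynomial ℕ ℂ) = c • Finsupp.single k 1 := by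
      rw [Finsupp.smul_single, MvPolynomial.smul_eq_C_mul, mul_one]
    rw [this, map_smul, hl, Finsupp.smul_single, MvPolynomial.smul_eq_C_mul]
    simp [virasoroDeriv]
  | add p q hp hq =>
    rw [Finsupp.single_add, map_add, hp, hq, ← Finsupp.single_add]
    congr 1; rw [map_add]; ring
  | mul_X q p hq =>
    rw [mul_comm q, ← heis_neg_single m, virasoro_heis_neg hm, hq, heis_neg_single, heis_single,
      Finsupp.smul_single, ← Finsupp.single_add, Derivation.leibniz]
    congr 1
    -- Since n - (p+1) ≤ 0, this mode acts as a multiplication operator.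
    have : heisSector m k (n - (p + 1)) q = heisSector m k (n - (p + 1)) 1 * q := by
      unfold heisSector
      rw [if_neg (by omega)]
      split_ifs <;> simp
    rw [this, virasoroDeriv, mkDerivation_X]
    simp only [smul_eq_mul, Algebra.mul_smul_comm]
    push_cast
    rw [MvPolynomial.smul_eq_C_mul, MvPolynomial.smul_eq_C_mul]
    ring

theorem sum_range_toNat_succ (N : ℤ) (hN : 0 ≤ N) (f : ℕ → MvPolynomial ℕ ℂ) :
    ∑ j ∈ range (N + 1).toNat, f j = f 0 + ∑ j ∈ range N.toNat, f (j + 1) := by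
  rw [show (N + 1).toNat = N.toNat + 1 by omega, Finset.sum_range_succ', add_comm]

/-- The derivation sends x_j/(j+1) to x_{j+1}, so it produces the recursion for exponent N + 1
without its j = 0 term. That missing term is the subtracted one. -/
theorem virasoroDeriv_neg_one_creation (m : ℕ) (k ε N : ℤ) :
    virasoroDeriv m k (-1) (creation ε N) =
      ((N : ℂ) + 1) • creation ε (N + 1) - (ε : ℂ) • (X 0 * creation ε N) := by
  have h : ∀ j : ℕ, (((j + 1 : ℕ) : ℂ)⁻¹ • virasoroDeriv m k (-1) (X j)) = X (j + 1) := by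
    intro j
    have h0 : ((j + 1 : ℕ) : ℂ) ≠ 0 := Nat.cast_ne_zero.2 (Nat.succ_ne_zero _)
    rw [virasoroDeriv, mkDerivation_X, smul_smul, inv_mul_cancel₀ h0, one_smul, heisSector,
      if_neg (by omega), if_neg (by omega),
      show (-(-1 - ((j : ℤ) + 1)) - 1).toNat = j + 1 by omega]
    simp
  rw [derivation_creation]
  simp only [h]
  rcases lt_trichotomy N (-1) with hN | rfl | hN
  · rw [creation_of_neg _ (by omega), creation_of_neg _ (by omega), show N.toNat = 0 by omega]
    simp
  · simp [creation_of_neg]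
  · have h1 := natCast_smul_creation ε (N + 1)
    rw [sum_range_toNat_succ N (by omega)] at h1
    push_cast at h1
    rw [h1, smul_add]
    simp only [sub_zero, add_sub_cancel_right]
    rw [add_sub_cancel_left]
    congr 1
    refine Finset.sum_congr rfl fun j _ => ?_
    rw [show N - ((j : ℤ) + 1) = N - 1 - j by ring]

theorem virasoroDeriv_zero_creation (m : ℕ) (k ε N : ℤ) :
    virasoroDeriv m k 0 (creation ε N) = (N : ℂ) • creation ε N := by
  have h : ∀ j : ℕ, (((j + 1 : ℕ) : ℂ)⁻¹ • virasoroDeriv m k 0 (X j)) = X j := by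
    intro j
    have h0 : ((j + 1 : ℕ) : ℂ) ≠ 0 := Nat.cast_ne_zero.2 (Nat.succ_ne_zero _)
    rw [virasoroDeriv, mkDerivation_X, smul_smul, inv_mul_cancel₀ h0, one_smul, heisSector,
      if_neg (by omega), if_neg (by omega), show (-(0 - ((j : ℤ) + 1)) - 1).toNat = j by omega]
    simp
  rw [derivation_creation, natCast_smul_creation]
  simp only [h]

theorem virasoroDeriv_one_creation (m : ℕ) (k ε N : ℤ) :
    virasoroDeriv m k 1 (creation ε N) =
      ((N : ℂ) - 1 + ε * m * k) • creation ε (N - 1) := by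
  have h1 : ∀ j : ℕ, (((j + 1 + 1 : ℕ) : ℂ)⁻¹ • virasoroDeriv m k 1 (X (j + 1))) = X j := by
    intro j
    have h0 : ((j + 1 + 1 : ℕ) : ℂ) ≠ 0 := Nat.cast_ne_zero.2 (Nat.succ_ne_zero _)
    rw [virasoroDeriv, mkDerivation_X, smul_smul, inv_mul_cancel₀ h0, one_smul, heisSector,
      if_neg (by push_cast; omega), if_neg (by push_cast; omega),
      show (-(1 - (((j + 1 : ℕ) : ℤ) + 1)) - 1).toNat = j by push_cast; omega]
    simp
  have h0 : (((0 + 1 : ℕ) : ℂ)⁻¹ • virasoroDeriv m k 1 (X 0)) = C ((m : ℂ) * k) := by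
    rw [virasoroDeriv, mkDerivation_X, heisSector]
    simp [MvPolynomial.smul_eq_C_mul]
  rw [derivation_creation]
  rcases le_or_gt N 0 with hN | hN
  · rw [creation_of_neg _ (by omega), show N.toNat = 0 by omega]
    simp
  · obtain ⟨N, rfl⟩ : ∃ M : ℤ, N = M + 1 := ⟨N - 1, by ring⟩
    rw [sum_range_toNat_succ N (by omega), h0]
    simp only [h1]
    have h2 := natCast_smul_creation ε N
    have h3 : ∀ j : ℕ, N + 1 - 1 - ((j + 1 : ℕ) : ℤ) = N - 1 - j := fun j => by push_cast; ring
    simp only [h3]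
    rw [smul_add, ← h2]
    simp only [Nat.cast_zero, sub_zero, add_sub_cancel_right]
    push_cast
    rw [← MvPolynomial.smul_eq_C_mul, smul_smul, ← add_smul]
    congr 1; ring

/-- The charged fields are primary of dimension `m / 2`; here for the Möbius generators. -/
theorem virasoro_charged {m : ℕ} (hm : m ≠ 0) {ε : ℤ} (hε : ε * ε = 1) {n : ℤ}
    (hn : n = -1 ∨ n = 0 ∨ n = 1) (a : ℤ) :
    virasoro m n * charged m ε a - charged m ε a * virasoro m n =
      ((a : ℂ) - n + (n + 1) * (m / 2)) • charged m ε (a - n) := by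
  have hεc : (ε : ℂ) * ε = 1 := by exact_mod_cast hε
  have := eq_zero_of_vac_of_heis m (X := fun a => virasoro m n * charged m ε a -
    charged m ε a * virasoro m n - ((a : ℂ) - n + (n + 1) * (m / 2)) • charged m ε (a - n)) ?_ ?_ a
  · exact sub_eq_zero.1 this
  · intro a k
    simp only [LinearMap.sub_apply, Module.End.mul_apply, LinearMap.smul_apply]
    obtain ⟨v1, v2, v3⟩ := virasoro_vac hm k
    obtain ⟨w1, w2, w3⟩ := virasoro_vac hm (k + ε)
    rcases hn with rfl | rfl | rfl
    · rw [v1, map_smul, ← mul_one (X 0), ← heis_neg_single m 0 k 1, charged_heis_neg, charged_vac,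
        charged_vac, heis_neg_single, virasoro_single hm (by norm_num) _
          (l := ((k + ε : ℤ) : ℂ) • X 0) (by rw [w1, Finsupp.smul_single]),
        virasoroDeriv_neg_one_creation, charged_vac]
      simp only [Finsupp.smul_single, ← Finsupp.single_sub]
      rw [← Finsupp.single_zero (k + ε)]
      congr 1
      simp only [Nat.cast_zero, zero_add, sub_neg_eq_add,
        show a + 1 - ε * m * k = a - ε * m * k + 1 by ring]
      push_cast
      simp only [Algebra.mul_smul_comm]
      rw [mul_comm (creation ε (a - ε * m * k)) (X 0)]
      module
    · rw [v2, map_smul, charged_vac, virasoro_single hm (by norm_num) _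
          (l := ((m : ℂ) * ((k + ε : ℤ) : ℂ) ^ 2 / 2) • 1) (by rw [w2, Finsupp.smul_single]),
        virasoroDeriv_zero_creation, charged_vac]
      simp only [Finsupp.smul_single, ← Finsupp.single_sub]
      rw [← Finsupp.single_zero (k + ε)]
      congr 1
      simp only [sub_zero, Algebra.mul_smul_comm, mul_one]
      push_cast
      rw [← add_smul, ← sub_smul, ← sub_smul]
      convert zero_smul ℂ _ using 2
      linear_combination (m / 2 : ℂ) * hεc
    · rw [v3, map_zero, charged_vac, virasoro_single hm (by norm_num) _
          (l := 0) (by rw [w3, Finsupp.single_zero]), virasoroDeriv_one_creation, charged_vac]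
      simp only [Finsupp.smul_single, sub_zero, ← Finsupp.single_sub]
      rw [← Finsupp.single_zero (k + ε)]
      congr 1
      rw [show a - 1 - ε * m * k = a - ε * m * k - 1 by ring, mul_zero, add_zero,
        ← sub_smul]
      push_cast
      convert zero_smul ℂ _ using 2
      linear_combination (m : ℂ) * hεc
  · intro a p v h
    have h1 := h a
    have h2 := h (a + (p + 1))
    simp only [LinearMap.sub_apply, Module.End.mul_apply, LinearMap.smul_apply] at h1 h2 ⊢
    rw [sub_eq_zero, sub_eq_iff_eq_add] at h1 h2
    -- The commutator of L_n with H_{-p-1} is a multiple of H_{n-p-1}, which must in turn be moved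
    -- past the charged field.
    have h3 := LinearMap.congr_fun (heis_charged m ε (n - (p + 1)) a) v
    simp only [LinearMap.sub_apply, Module.End.mul_apply, LinearMap.smul_apply] at h3
    rw [sub_eq_iff_eq_add] at h3
    simp only [virasoro_heis_neg hm, charged_heis_neg, map_add, map_sub, map_smul, h1, h2, h3,
      smul_add, smul_sub, show a - (n - ((p : ℤ) + 1)) = a - n + (p + 1) by ring,
      show a + ((p : ℤ) + 1) - n = a - n + (p + 1) by ring]
    push_cast
    module

/-! ### Regular distributions in two variables -/

theorem Regular.add {D D' : BiDist} (h : Regular D) (h' : Regular D') : Regular (D + D') :=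
  fun v => by
  obtain ⟨N, hN⟩ := h v
  obtain ⟨M, hM⟩ := h' v
  exact ⟨min N M, fun a b hab => by
    simp [hN a b (by omega), hM a b (by omega)]⟩

theorem Regular.sub {D D' : BiDist} (h : Regular D) (h' : Regular D') : Regular (D - D') :=
  fun v => by
  obtain ⟨N, hN⟩ := h v
  obtain ⟨M, hM⟩ := h' v
  exact ⟨min N M, fun a b hab => by
    simp [hN a b (by omega), hM a b (by omega)]⟩

theorem Regular.neg {D : BiDist} (h : Regular D) : Regular (-D) := fun v => by
  obtain ⟨N, hN⟩ := h v
  exact ⟨N, fun a b hab => by simp [hN a b hab]⟩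

theorem Regular.smul_fun {D : BiDist} (h : Regular D) (c : ℤ → ℤ → ℂ) :
    Regular fun a b => c a b • D a b := fun v => by
  obtain ⟨N, hN⟩ := h v
  exact ⟨N, fun a b hab => by simp [hN a b hab]⟩

theorem Regular.shift {D : BiDist} (h : Regular D) (n k : ℤ) :
    Regular fun a b => D (a + n) (b + k) := fun v => by
  obtain ⟨N, hN⟩ := h v
  exact ⟨N - |n| - |k|, fun a b hab => hN _ _ (by
    have := le_abs_self n; have := le_abs_self k
    have := abs_nonneg n; have := abs_nonneg k
    omega)⟩

theorem Regular.mulZ12 {D : BiDist} (h : Regular D) : Regular (mulZ12 D) := by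
  have := (h.shift (-1) 0).sub (h.shift 0 (-1))
  simp only [add_zero] at this
  exact this

theorem Regular.isField_left {D : BiDist} (h : Regular D) (b : ℤ) : IsField fun a => D a b :=
  fun v => by
  obtain ⟨N, hN⟩ := h v
  exact ⟨N, fun a ha => hN a b (Or.inl ha)⟩

/-- The unit operator as a distribution in two variables. -/
def one₂ : BiDist := fun a b => if a = 0 ∧ b = 0 then 1 else 0

theorem regular_one₂ : Regular one₂ := fun v => ⟨0, fun a b h => by
  rw [one₂, if_neg (by omega)]; rfl⟩

theorem mulZ12_invZ12 : mulZ12 invZ12 = one₂ := by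
  funext a b
  unfold mulZ12 invZ12 one₂
  split_ifs <;> first | omega | simp [op_sub_zero, op_sub_self]

theorem mulZ12_sub (D D' : BiDist) : mulZ12 (D - D') = mulZ12 D - mulZ12 D' := by
  funext a b
  simp only [mulZ12, Pi.sub_apply]; abel

/-! ### The product of the two charged fields -/

/-- The product `φ⁺(z₁) φ⁻(z₂)`. -/
def chargedPair (m : ℕ) : BiDist := fun a b => charged m 1 a * charged m (-1) b

/-- The coefficients of `(1 - z₂/z₁)^{-p} exp(∑ x_{r-1} z₁^r / r) exp(- ∑ x_{r-1} z₂^r / r)`. -/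
def crossSum (p : ℕ) (α β : ℤ) : MvPolynomial ℕ ℂ :=
  ∑ j ∈ range (β + 1).toNat,
    (p.multichoose j : ℂ) • (creation 1 (α + j) * creation (-1) (β - j))

/-- Multiplication by 1 - z₂/z₁ lowers the exponent of the contraction factor by one; on
coefficients this is Pascal's rule for multiset numbers. -/
theorem crossSum_succ (p : ℕ) (α β : ℤ) :
    crossSum (p + 1) α β - crossSum (p + 1) (α + 1) (β - 1) = crossSum p α β := by
  rcases lt_or_ge β 0 with h | h
  · simp [crossSum, show (β + 1).toNat = 0 by omega, show β.toNat = 0 by omega]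
  · unfold crossSum
    rw [sub_add_cancel, sum_range_toNat_succ β h, sum_range_toNat_succ β h, add_sub_assoc,
      ← Finset.sum_sub_distrib]
    congr 1
    · simp
    · refine Finset.sum_congr rfl fun j _ => ?_
      rw [Nat.multichoose_succ_succ,
        show α + 1 + (j : ℤ) = α + ((j + 1 : ℕ) : ℤ) by push_cast; ring,
        show β - 1 - (j : ℤ) = β - ((j + 1 : ℕ) : ℤ) by push_cast; ring]
      push_cast
      module

theorem crossSum_zero (α β : ℤ) : crossSum 0 α β = creation 1 α * creation (-1) β := by
  rcases lt_or_ge β 0 with h | h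
  · simp [crossSum, show (β + 1).toNat = 0 by omega, creation_of_neg _ h]
  · unfold crossSum
    rw [sum_range_toNat_succ β h]
    simp [Nat.multichoose_zero_succ]

theorem crossSum_one_zero (n : ℤ) : crossSum 1 0 n = if n = 0 then 1 else 0 := by
  rcases lt_or_ge n 0 with h | h
  · rw [if_neg (by omega)]; simp [crossSum, show (n + 1).toNat = 0 by omega]
  · obtain ⟨r, rfl⟩ : ∃ r : ℕ, n = (r : ℤ) := ⟨n.toNat, by omega⟩
    have h1 : expSeries (fun r => ((1 : ℤ) : ℂ) • (X r : MvPolynomial ℕ ℂ)) *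
        expSeries (fun r => ((-1 : ℤ) : ℂ) • (X r : MvPolynomial ℕ ℂ)) = 1 := by
      rw [← expSeries_add, ← expSeries_zero]
      congr 1; funext r; simp
    have h2 := congrArg (PowerSeries.coeff r) h1
    rw [PowerSeries.coeff_mul, Finset.Nat.sum_antidiagonal_eq_sum_range_succ_mk,
      PowerSeries.coeff_one] at h2
    have e : ((r : ℤ) = 0) = (r = 0) := by simp
    simp only [e]
    rw [← h2, crossSum, show ((r : ℤ) + 1).toNat = r + 1 by omega]
    refine Finset.sum_congr rfl fun j hj => ?_
    rw [Finset.mem_range] at hj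
    rw [Nat.multichoose_one, Nat.cast_one, one_smul, zero_add,
      show (r : ℤ) - j = ((r - j : ℕ) : ℤ) by omega, creation_natCast, creation_natCast, expSeries,
      expSeries, PowerSeries.coeff_mk, PowerSeries.coeff_mk]

/-- By `crossSum_succ` the difference of neighbours on an antidiagonal carries the factor `creation
1 α`, which is zero for α < 0. The value is thus the one at α = 0, where the two exponentials are
inverse to each other. This identifies the low powers of z₁ with those of the expanded z₁₂^{-1}, the
cancellation behind `regular_bilocal`. -/
theorem crossSum_one_of_nonpos {α : ℤ} (h : α ≤ 0) (β : ℤ) :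
    crossSum 1 α β = if α + β = 0 then 1 else 0 := by
  obtain ⟨r, rfl⟩ : ∃ r : ℕ, α = -(r : ℤ) := ⟨(-α).toNat, by omega⟩
  clear h
  induction r generalizing β with
  | zero => simpa using crossSum_one_zero β
  | succ r ih =>
    have h1 := crossSum_succ 0 (-((r + 1 : ℕ) : ℤ)) β
    rw [crossSum_zero, creation_of_neg _ (by omega), zero_mul, sub_eq_zero] at h1
    rw [h1, show -((r + 1 : ℕ) : ℤ) + 1 = -(r : ℤ) by push_cast; ring, ih]
    congr 1
    rw [eq_iff_iff]; push_cast; omega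

/-- The contraction of φ⁺ with φ⁻: the translation of the x_r multiplies the exponential by exp(m ∑
w^r z^r / r) = (1 - wz)^{-m}, with w the polynomial variable. -/
theorem annihilation_creation (m : ℕ) (N : ℕ) :
    annihilation m 1 (creation (-1) N) = ∑ j ∈ range (N + 1),
      Polynomial.monomial j ((m.multichoose j : ℂ) • creation (-1) ((N : ℤ) - j)) := by
  have h : expSeries (fun r => annihilation m 1 (((-1 : ℤ) : ℂ) • X r)) =
      expSeries (fun r => (m : Polynomial (MvPolynomial ℕ ℂ)) * Polynomial.X ^ (r + 1)) *
      expSeries (fun r => (IsScalarTower.toAlgHom ℂ (MvPolynomial ℕ ℂ)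
        (Polynomial (MvPolynomial ℕ ℂ))) (((-1 : ℤ) : ℂ) • X r)) := by
    rw [← expSeries_add]
    congr 1; funext r
    rw [map_smul, annihilation, aeval_X, Pi.add_apply, map_smul]
    simp
    ring
  have h2 := congrArg (PowerSeries.coeff N) h
  rw [PowerSeries.coeff_mul, Finset.Nat.sum_antidiagonal_eq_sum_range_succ_mk] at h2
  simp only [expSeries, PowerSeries.coeff_mk] at h2
  rw [creation_natCast, map_expCoeff, h2]
  refine Finset.sum_congr rfl fun j hj => ?_
  rw [Finset.mem_range] at hj
  rw [expCoeff_natCast_mul_pow, ← map_expCoeff, show (N : ℤ) - j = ((N - j : ℕ) : ℤ) by omega,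
    creation_natCast, MvPolynomial.smul_eq_C_mul, ← Polynomial.C_mul_X_pow_eq_monomial,
    Polynomial.C_mul]
  simp only [IsScalarTower.coe_toAlgHom', Polynomial.algebraMap_eq, map_natCast]
  ring

theorem chargedPair_vac (m : ℕ) (a b k : ℤ) :
    chargedPair m a b (Finsupp.single k 1) =
      Finsupp.single k (crossSum m (a - m * k + m) (b + m * k)) := by
  rw [chargedPair, Module.End.mul_apply, charged_vac, charged_single, neg_add_cancel_right,
    show b - -1 * m * k = b + m * k by ring, show a - 1 * m * (k + -1) = a - m * k + m by ring]
  congr 1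
  rcases lt_or_ge (b + m * k) 0 with h | h
  · rw [creation_of_neg _ h, map_zero, map_zero, crossSum, show (b + m * k + 1).toNat = 0 by omega]
    simp
  · obtain ⟨N, hN⟩ : ∃ N : ℕ, b + m * k = (N : ℤ) := ⟨(b + m * k).toNat, by omega⟩
    rw [hN, annihilation_creation, map_sum, crossSum, show ((N : ℤ) + 1).toNat = N + 1 by omega]
    refine Finset.sum_congr rfl fun j _ => ?_
    rw [chargedSum_monomial, Algebra.mul_smul_comm]

/-- Each factor z₁₂ = z₁(1 - z₂/z₁) removes one power of the contraction and shifts the exponent of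
z₁. -/
theorem iterate_mulZ12_chargedPair_vac (m i : ℕ) (hi : i ≤ m) (a b k : ℤ) :
    mulZ12^[i] (chargedPair m) a b (Finsupp.single k 1) =
      Finsupp.single k (crossSum (m - i) (a - m * k + (m - i : ℕ)) (b + m * k)) := by
  induction i generalizing a b with
  | zero => exact chargedPair_vac m a b k
  | succ i ih =>
    rw [Function.iterate_succ_apply', mulZ12, LinearMap.sub_apply, ih (by omega), ih (by omega),
      ← Finsupp.single_sub]
    obtain ⟨r, rfl⟩ : ∃ r, m = i + 1 + r := ⟨m - (i + 1), by omega⟩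
    rw [show i + 1 + r - (i + 1) = r by omega, show i + 1 + r - i = r + 1 by omega]
    congr 1
    rw [show a - 1 - ((i + 1 + r : ℕ) : ℤ) * k + ((r + 1 : ℕ) : ℤ) =
        a - ((i + 1 + r : ℕ) : ℤ) * k + (r : ℤ) by push_cast; ring,
      show a - ((i + 1 + r : ℕ) : ℤ) * k + ((r + 1 : ℕ) : ℤ) =
        a - ((i + 1 + r : ℕ) : ℤ) * k + (r : ℤ) + 1 by push_cast; ring,
      show b - 1 + ((i + 1 + r : ℕ) : ℤ) * k = b + ((i + 1 + r : ℕ) : ℤ) * k - 1 by ring,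
      crossSum_succ]

/-- The distribution `E(z₁,z₂) = z₁₂^m φ⁺(z₁) φ⁻(z₂) = :exp(∫_{z₂}^{z₁} H):`. -/
def expField (m : ℕ) : BiDist := mulZ12^[m] (chargedPair m)

theorem expField_vac (m : ℕ) (a b k : ℤ) : expField m a b (Finsupp.single k 1) =
    Finsupp.single k (creation 1 (a - m * k) * creation (-1) (b + m * k)) := by
  rw [expField, iterate_mulZ12_chargedPair_vac m m le_rfl, Nat.sub_self, crossSum_zero]
  simp

theorem bilocal_eq (m : ℕ) : bilocal m = mulZ12^[m - 1] (chargedPair m) - invZ12 := rfl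

theorem bilocal_vac {m : ℕ} (hm : m ≠ 0) (a b k : ℤ) : bilocal m a b (Finsupp.single k 1) =
    Finsupp.single k (crossSum 1 (a - m * k + 1) (b + m * k) -
      if 0 ≤ b ∧ a = -b - 1 then 1 else 0) := by
  rw [bilocal_eq, Pi.sub_apply, Pi.sub_apply, LinearMap.sub_apply,
    iterate_mulZ12_chargedPair_vac m _ (by omega), show m - (m - 1) = 1 by omega,
    Finsupp.single_sub, invZ12]
  congr 1
  split_ifs <;> simp

theorem mulZ12_bilocal {m : ℕ} (hm : m ≠ 0) : mulZ12 (bilocal m) = expField m - one₂ := by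
  rw [bilocal_eq, mulZ12_sub, mulZ12_invZ12, ← Function.iterate_succ_apply' mulZ12,
    show (m - 1).succ = m by omega, expField]

/-! ### Covariance under the Heisenberg algebra -/

/-- The distribution transforms like `φ⁺(z₁) φ⁻(z₂)`. -/
def HeisCovariant (m : ℕ) (D : BiDist) : Prop := ∀ n a b : ℤ,
  heis m n * D a b - D a b * heis m n = (m : ℂ) • (D (a - n) b - D a (b - n))

theorem heisCovariant_chargedPair (m : ℕ) : HeisCovariant m (chargedPair m) := fun n a b => by
  have h1 := heis_charged m 1 n a
  have h2 := heis_charged m (-1) n b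
  rw [op_sub_eq_iff] at h1 h2
  unfold chargedPair
  rw [← mul_assoc, h1, add_mul, mul_assoc (charged m 1 a) (heis m n), h2, mul_add, mul_assoc]
  simp only [smul_mul_assoc, mul_smul_comm]
  push_cast
  module

theorem HeisCovariant.mulZ12 {m : ℕ} {D : BiDist} (h : HeisCovariant m D) :
    HeisCovariant m (mulZ12 D) := fun n a b => by
  have h1 := h n (a - 1) b
  have h2 := h n a (b - 1)
  rw [op_sub_eq_iff] at h1 h2
  unfold Bilocal.mulZ12
  rw [op_mul_sub, op_sub_mul, h1, h2, show a - n - 1 = a - 1 - n by ring,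
    show b - n - 1 = b - 1 - n by ring]
  module

theorem HeisCovariant.iterate_mulZ12 {m : ℕ} {D : BiDist} (h : HeisCovariant m D) (i : ℕ) :
    HeisCovariant m (Bilocal.mulZ12^[i] D) := by
  induction i with
  | zero => exact h
  | succ i ih => rw [Function.iterate_succ_apply']; exact ih.mulZ12

theorem heisCovariant_expField (m : ℕ) : HeisCovariant m (expField m) :=
  (heisCovariant_chargedPair m).iterate_mulZ12 m

theorem expField_heis_neg (m : ℕ) (a b : ℤ) (p : ℕ) (v : Fock) :
    expField m a b (heis m (-((p : ℤ) + 1)) v) = heis m (-((p : ℤ) + 1)) (expField m a b v) -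
      (m : ℂ) • (expField m (a + (p + 1)) b v - expField m a (b + (p + 1)) v) := by
  have := LinearMap.congr_fun (heisCovariant_expField m (-((p : ℤ) + 1)) a b) v
  simp only [LinearMap.sub_apply, Module.End.mul_apply, LinearMap.smul_apply, sub_neg_eq_add] at this
  rw [← this]; abel

theorem invZ12_apply_commute (X : Module.End ℂ Fock) (a b : ℤ) :
    X * invZ12 a b = invZ12 a b * X := by
  unfold invZ12; split_ifs <;> simp

/-- The product of charged fields is covariant, whereas z₁₂^{-1} commutes with H. The mismatch is
m(z₁^{-p-1} - z₂^{-p-1})/z₁₂, a Laurent polynomial supported on negative exponents with a + b = -p -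
2; it gives the last term. -/
theorem bilocal_heis_neg (m : ℕ) (a b : ℤ) (p : ℕ) (v : Fock) :
    bilocal m a b (heis m (-((p : ℤ) + 1)) v) = heis m (-((p : ℤ) + 1)) (bilocal m a b v) -
      (m : ℂ) • (bilocal m (a + (p + 1)) b v - bilocal m a (b + (p + 1)) v) +
      (if a < 0 ∧ b < 0 ∧ a + b = -(p : ℤ) - 2 then (m : ℂ) else 0) • v := by
  have h := LinearMap.congr_fun (((heisCovariant_chargedPair m).iterate_mulZ12 (m - 1))
    (-((p : ℤ) + 1)) a b) v
  have h2 := LinearMap.congr_fun (invZ12_apply_commute (heis m (-((p : ℤ) + 1))) a b) v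
  have e : mulZ12^[m - 1] (chargedPair m) = bilocal m + invZ12 := by rw [bilocal_eq]; abel
  rw [e] at h
  simp only [LinearMap.sub_apply, Module.End.mul_apply, LinearMap.smul_apply, sub_neg_eq_add,
    Pi.add_apply, LinearMap.add_apply, map_add] at h h2
  have h3 : invZ12 (a + (p + 1)) b v - invZ12 a (b + (p + 1)) v =
      -((if a < 0 ∧ b < 0 ∧ a + b = -(p : ℤ) - 2 then (1 : ℂ) else 0) • v) := by
    unfold invZ12
    split_ifs <;> first | omega | simp
  have h4 : (if a < 0 ∧ b < 0 ∧ a + b = -(p : ℤ) - 2 then (m : ℂ) else 0) • v =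
      (m : ℂ) • (if a < 0 ∧ b < 0 ∧ a + b = -(p : ℤ) - 2 then (1 : ℂ) else 0) • v := by
    split_ifs <;> simp
  rw [h4, ← neg_eq_iff_eq_neg.2 h3, ← sub_eq_zero]
  rw [h2, ← sub_eq_zero] at h
  rw [← neg_eq_zero, ← h]
  module

/-! ### Regularity -/

theorem regular_bilocal {m : ℕ} (hm : m ≠ 0) : Regular (bilocal m) := by
  refine fock_induction m (fun k => ?_) ?_ ?_ ?_
  · refine ⟨-|(m : ℤ) * k|, fun a b hab => ?_⟩
    have h1 := neg_abs_le ((m : ℤ) * k)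
    have h2 := le_abs_self ((m : ℤ) * k)
    have h3 := abs_nonneg ((m : ℤ) * k)
    -- For very negative a the coefficient of the charged product is that of z₁₂^{-1}, and the
    -- subtraction cancels it. For very negative b both terms vanish.
    rw [bilocal_vac hm]
    rcases hab with ha | hb
    · rw [crossSum_one_of_nonpos (by omega)]
      split_ifs <;> first | omega | simp
    · rw [if_neg (by omega), crossSum, show (b + m * k + 1).toNat = 0 by omega]
      simp
  · rintro v w ⟨N, hN⟩ ⟨M, hM⟩
    exact ⟨min N M, fun a b h => by
      rw [map_add, hN a b (by omega), hM a b (by omega), add_zero]⟩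
  · rintro c v ⟨N, hN⟩
    exact ⟨N, fun a b h => by rw [map_smul, hN a b h, smul_zero]⟩
  · rintro p v ⟨N, hN⟩
    refine ⟨min N 0 - p - 2, fun a b h => ?_⟩
    rw [bilocal_heis_neg, hN a b (by omega), hN (a + (p + 1)) b (by omega),
      hN a (b + (p + 1)) (by omega), if_neg (by omega)]
    simp

theorem regular_expField {m : ℕ} (hm : m ≠ 0) : Regular (expField m) := by
  have := (regular_bilocal hm).mulZ12.add regular_one₂
  rwa [mulZ12_bilocal hm, show expField m - one₂ + one₂ = expField m by abel] at this

/-- `∂₁ E(z₁,z₂) = :H(z₁) E(z₁,z₂):`. -/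
theorem deriv_expField {m : ℕ} (hm : m ≠ 0) (b : ℤ) :
    deriv (fun a => expField m a b) = nprod (current m) (fun a => expField m a b) := by
  have hf := isField_current m
  have hE := regular_expField hm
  -- The defect is indexed by both exponents because passing a creation operator through it shifts
  -- either of them.
  set Z : ℤ × ℤ → Module.End ℂ Fock := fun p => (p.1 : ℂ) • expField m p.1 p.2 -
    nprod (current m) (fun a => expField m a p.2) (p.1 - 1) with hZ
  have key : ∀ p : ℤ × ℤ, Z p = 0 := by
    refine eq_zero_of_vac_of_heis m ?_ ?_
    · rintro ⟨a, b⟩ k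
      simp only [hZ, LinearMap.sub_apply, LinearMap.smul_apply]
      rw [nprod_apply, locSum_apply_eq_sum (locFin_nprodTerm hf (hE.isField_left b) _) _
        -- On |k⟩ the annihilation half of H contributes only through H_0, at j = -1. The creation
        -- half stops where the exponent of `creation` becomes negative.
        (insert (-1) ((range (a - m * k).toNat).map ⟨fun j : ℕ => (j : ℤ), Nat.cast_injective⟩)),
        Finset.sum_insert (by simp), Finset.sum_map]
      · have h1 : nprodTerm (current m) (fun a => expField m a b) (a - 1) (-1)
            (Finsupp.single k 1) = ((m : ℂ) * k) • expField m a b (Finsupp.single k 1) := by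
          rw [nprodTerm, if_neg (by norm_num), Module.End.mul_apply, current,
            show -(-1 : ℤ) - 1 = 0 by norm_num, heis_zero_vac, map_smul, sub_neg_eq_add,
            sub_add_cancel]
        have h2 : ∀ j : ℕ, nprodTerm (current m) (fun a => expField m a b) (a - 1) (j : ℤ)
            (Finsupp.single k 1) = Finsupp.single k
              (X j * creation 1 (a - m * k - 1 - j) * creation (-1) (b + m * k)) := by
          intro j
          rw [nprodTerm, if_pos (by omega), Module.End.mul_apply, current, expField_vac,
            show -(j : ℤ) - 1 = -((j : ℤ) + 1) by ring, heis_neg_single, mul_assoc,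
            show a - 1 - j - m * k = a - m * k - 1 - j by ring]
        simp only [Function.Embedding.coeFn_mk, h1, h2]
        rw [← Finsupp.single_finsetSum, ← Finset.sum_mul]
        have h3 := natCast_smul_creation 1 (a - m * k)
        rw [Int.cast_one, one_smul] at h3
        rw [← h3, expField_vac, Finsupp.smul_single, Finsupp.smul_single, ← Finsupp.single_add,
          ← Finsupp.single_sub, ← Finsupp.single_zero k]
        congr 1
        push_cast
        simp only [smul_mul_assoc]
        module
      · intro j hj
        simp only [Finset.mem_insert, Finset.mem_map, Finset.mem_range, not_or, not_exists,
          not_and, Function.Embedding.coeFn_mk] at hj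
        unfold nprodTerm
        split_ifs with h
        · have := hj.2 j.toNat
          rw [Module.End.mul_apply, expField_vac, creation_of_neg _ (by omega)]
          simp
        · rw [Module.End.mul_apply, current, heis_vac_of_pos m (by omega), map_zero]
    · rintro ⟨a, b⟩ p v h
      have g1 := h (a, b)
      have g2 := h (a + (p + 1), b)
      have g3 := h (a, b + (p + 1))
      simp only [hZ, LinearMap.sub_apply, LinearMap.smul_apply] at g1 g2 g3 ⊢
      have hb : bracket (heis m (-((p : ℤ) + 1))) (fun a => expField m a b) =
          (m : ℂ) • ((fun a => expField m (a + (p + 1)) b) -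
            (fun a => expField m a (b + (p + 1)))) := by
        funext a
        have := heisCovariant_expField m (-((p : ℤ) + 1)) a b
        rw [sub_neg_eq_add, sub_neg_eq_add] at this
        exact this
      have h4 := congrFun (bracket_nprod hf (hE.isField_left b) (heis m (-((p : ℤ) + 1)))) (a - 1)
      have f1 := (hE.isField_left b).shift (p + 1)
      have f2 := hE.isField_left (b + (p + 1))
      rw [hb, bracket_heis_current, nprod_smul_left (isField_delta _) (hE.isField_left b),
        nprod_smul_right hf (f1.sub f2), nprod_sub_right hf f1 f2, Pi.add_apply, Pi.smul_apply,
        Pi.smul_apply, Pi.sub_apply, nprod_delta_left,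
        nprod_shift (current m) (fun a => expField m a b)] at h4
      have h5 := LinearMap.congr_fun h4 v
      simp only [bracket, LinearMap.sub_apply, Module.End.mul_apply, LinearMap.add_apply,
        LinearMap.smul_apply] at h5
      rw [sub_eq_zero] at g1 g2 g3
      rw [sub_eq_iff_eq_add, ← g1] at h5
      have h6 : nprod (current m) (fun a => expField m a b) (a - 1) (heis m (-((p : ℤ) + 1)) v) =
        heis m (-((p : ℤ) + 1)) ((a : ℂ) • expField m a b v) - (-((m : ℂ) * (p + 1)) •
          expField m (a - 1 - (-p - 2)) b v + (m : ℂ) • (nprod (current m) (fun a => expField m a b)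
            (a - 1 + (p + 1)) v - nprod (current m) (fun a => expField m a (b + (p + 1))) (a - 1) v)) := by
        rw [h5]; abel
      rw [h6, expField_heis_neg, show a - 1 - (-(p : ℤ) - 2) = a + (p + 1) by ring,
        show a - 1 + ((p : ℤ) + 1) = a + (p + 1) - 1 by ring, ← g2, ← g3]
      simp only [map_smul]
      push_cast
      module
  funext a
  have := key (a + 1, b)
  simp only [hZ, add_sub_cancel_right, op_sub_eq_zero] at this
  rw [← this, deriv]
  push_cast; rfl

/-! ### Covariance under the Möbius generators -/

/-- The distribution is quasiprimary of dimension `h` in both variables. -/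
def MoebiusCovariant (m : ℕ) (h : ℂ) (D : BiDist) : Prop :=
  ∀ n : ℤ, n = -1 ∨ n = 0 ∨ n = 1 → ∀ a b : ℤ,
    virasoro m n * D a b - D a b * virasoro m n =
      ((a : ℂ) - n + (n + 1) * h) • D (a - n) b + ((b : ℂ) - n + (n + 1) * h) • D a (b - n)

theorem moebiusCovariant_chargedPair {m : ℕ} (hm : m ≠ 0) :
    MoebiusCovariant m (m / 2) (chargedPair m) := fun n hn a b => by
  have h1 := virasoro_charged hm (ε := 1) (by norm_num) hn a
  have h2 := virasoro_charged hm (ε := -1) (by norm_num) hn b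
  rw [op_sub_eq_iff] at h1 h2
  unfold chargedPair
  rw [← mul_assoc, h1, add_mul, mul_assoc (charged m 1 a) (virasoro m n), h2, mul_add, mul_assoc]
  simp only [smul_mul_assoc, mul_smul_comm]
  abel

/-- The function z₁₂ is Möbius covariant with weight -1/2 in each of its two variables. -/
theorem MoebiusCovariant.mulZ12 {m : ℕ} {h : ℂ} {D : BiDist} (hD : MoebiusCovariant m h D) :
    MoebiusCovariant m (h - 1 / 2) (mulZ12 D) := fun n hn a b => by
  have h1 := hD n hn (a - 1) b
  have h2 := hD n hn a (b - 1)
  rw [op_sub_eq_iff] at h1 h2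
  unfold Bilocal.mulZ12
  rw [op_mul_sub, op_sub_mul, h1, h2, show a - n - 1 = a - 1 - n by ring,
    show b - n - 1 = b - 1 - n by ring]
  rcases hn with rfl | rfl | rfl <;> try simp only [sub_neg_eq_add, sub_add_cancel, sub_zero]
  all_goals push_cast; module

theorem MoebiusCovariant.iterate_mulZ12 {m : ℕ} {h : ℂ} {D : BiDist}
    (hD : MoebiusCovariant m h D) (i : ℕ) :
    MoebiusCovariant m (h - i / 2) (Bilocal.mulZ12^[i] D) := by
  induction i with
  | zero => simpa using hD
  | succ i ih =>
    rw [Function.iterate_succ_apply']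
    have := ih.mulZ12
    rwa [show h - i / 2 - 1 / 2 = h - ((i + 1 : ℕ) : ℂ) / 2 by push_cast; ring] at this

theorem moebiusCovariant_bilocal {m : ℕ} (hm : m ≠ 0) :
    MoebiusCovariant m (1 / 2) (bilocal m) := fun n hn a b => by
  have h := (moebiusCovariant_chargedPair hm).iterate_mulZ12 (m - 1) n hn a b
  have e : mulZ12^[m - 1] (chargedPair m) = bilocal m + invZ12 := by rw [bilocal_eq]; abel
  have hc : (m : ℂ) / 2 - ((m - 1 : ℕ) : ℂ) / 2 = 1 / 2 := by
    rw [Nat.cast_sub (by omega)]; push_cast; ring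
  rw [e, hc] at h
  -- The expansion of z₁₂^{-1} is itself covariant of dimension 1/2. At the edges of its support, b
  -- = 0 with n = 1 and b = -1 with n = -1, the only surviving coefficient is zero.
  have hI : ((a : ℂ) - n + (n + 1) * (1 / 2)) • invZ12 (a - n) b +
      ((b : ℂ) - n + (n + 1) * (1 / 2)) • invZ12 a (b - n) = 0 := by
    unfold invZ12
    by_cases hab : a - n = -b - 1
    · have ha : a = n - b - 1 := by omega
      subst ha
      by_cases h0 : 0 ≤ b <;> by_cases h1 : 0 ≤ b - n
      · rw [if_pos ⟨h0, by ring⟩, if_pos ⟨h1, by ring⟩, ← add_smul]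
        push_cast
        convert zero_smul ℂ _ using 2
        ring
      · have hb : b = 0 := by omega
        have hn : n = 1 := by omega
        subst hb; subst hn
        norm_num
      · have hb : b = -1 := by omega
        have hn : n = -1 := by omega
        subst hb; subst hn
        norm_num
      · rw [if_neg (by omega), if_neg (by omega)]; simp
    · rw [if_neg (by omega), if_neg (by omega)]; simp
  have hJ := invZ12_apply_commute (virasoro m n) a b
  simp only [Pi.add_apply] at h
  rw [mul_add, add_mul, hJ, smul_add, smul_add, add_add_add_comm, hI, add_zero] at h
  rw [← h]
  abel

/-! ### Binomial coefficients -/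

/-- The binomial coefficient `a choose k` for an integer `a`, as a complex number. -/
def bc (a : ℤ) (k : ℕ) : ℂ := ((Ring.choose a k : ℤ) : ℂ)

theorem bc_zero_right (a : ℤ) : bc a 0 = 1 := by simp [bc]

theorem bc_natCast (n k : ℕ) : bc n k = n.choose k := by
  rw [bc, Ring.choose_natCast, Int.cast_natCast]

theorem bc_zero_left (k : ℕ) : bc 0 k = if k = 0 then 1 else 0 := by
  rw [bc, Ring.choose_zero_ite]; split_ifs <;> simp

theorem bc_succ_succ (a : ℤ) (k : ℕ) : bc (a + 1) (k + 1) = bc a k + bc a (k + 1) := by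
  rw [bc, Ring.choose_succ_succ, Int.cast_add]; rfl

theorem succ_mul_bc (a : ℤ) (k : ℕ) : ((k : ℂ) + 1) * bc a (k + 1) = a * bc (a - 1) k := by
  have := Ring.choose_smul_choose a (show 1 ≤ k + 1 by omega)
  rw [Nat.choose_one_right, Ring.choose_one_right, nsmul_eq_mul] at this
  have h := congrArg (Int.cast : ℤ → ℂ) this
  push_cast at h
  exact h

theorem succ_mul_bc' (a : ℤ) (k : ℕ) : ((k : ℂ) + 1) * bc a (k + 1) = (a - k) * bc a k := by
  have := Ring.choose_smul_choose a (show k ≤ k + 1 by omega)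
  rw [show k + 1 - k = 1 by omega, Ring.choose_one_right, nsmul_eq_mul, Nat.choose_succ_self_right]
    at this
  have h := congrArg (Int.cast : ℤ → ℂ) this
  push_cast at h
  rw [bc, h, bc, mul_comm]

theorem bc_add (a b : ℤ) (k : ℕ) : bc (a + b) k = ∑ i ∈ range (k + 1), bc a i * bc b (k - i) := by
  rw [bc, Ring.add_choose_eq k (Commute.all a b), Finset.Nat.sum_antidiagonal_eq_sum_range_succ
    (fun i j => Ring.choose a i * Ring.choose b j)]
  push_cast; rfl

theorem bc_eq_zero {a : ℤ} {k : ℕ} (h0 : 0 ≤ a) (h : a < k) : bc a k = 0 := by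
  obtain ⟨n, rfl⟩ : ∃ n : ℕ, a = n := ⟨a.toNat, by omega⟩
  rw [bc_natCast, Nat.choose_eq_zero_of_lt (by omega), Nat.cast_zero]

/-! ### Taylor expansion -/

theorem Regular.locFin {D : BiDist} (h : Regular D) (n : ℤ) : LocFin fun a => D a (n - a) :=
  fun v => by
  obtain ⟨N, hN⟩ := h v
  refine (Set.finite_Icc N (n - N)).subset fun a ha => ?_
  by_contra h'
  rw [Set.mem_Icc] at h'
  exact ha (hN _ _ (by omega))

theorem taylor_apply (D : BiDist) (k : ℕ) (c : ℤ) :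
    taylor D k c = locSum fun a : ℤ => bc a k • D a (c + k - a) := rfl

theorem Regular.locFin_taylor {D : BiDist} (h : Regular D) (k : ℕ) (c : ℤ) :
    LocFin fun a : ℤ => bc a k • D a (c + k - a) := (h.locFin (c + k)).smul _

theorem Regular.isField_taylor {D : BiDist} (h : Regular D) (k : ℕ) : IsField (taylor D k) :=
  fun v => by
  obtain ⟨N, hN⟩ := h v
  refine ⟨2 * N - k, fun c hc => ?_⟩
  rw [taylor_apply, locSum_apply_eq_sum (h.locFin_taylor k c) v ∅, Finset.sum_empty]
  intro a _
  rw [LinearMap.smul_apply, hN _ _ (by omega), smul_zero]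

theorem taylor_sub {D D' : BiDist} (h : Regular D) (h' : Regular D') (k : ℕ) :
    taylor (D - D') k = taylor D k - taylor D' k := by
  funext c
  rw [Pi.sub_apply, taylor_apply, taylor_apply, taylor_apply,
    ← locSum_sub (h.locFin_taylor k c) (h'.locFin_taylor k c)]
  congr 1; funext a
  rw [← op_smul_sub]; rfl

theorem taylor_neg {D : BiDist} (h : Regular D) (k : ℕ) : taylor (-D) k = -taylor D k := by
  funext c
  rw [Pi.neg_apply, taylor_apply, taylor_apply, ← neg_one_smul ℂ (locSum _),
    ← locSum_smul (h.locFin_taylor k c)]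
  congr 1; funext a
  rw [Pi.neg_apply, Pi.neg_apply]; module

theorem diag_eq_taylor (D : BiDist) : diag D = taylor D 0 := by
  funext c
  rw [taylor_apply, diag]
  congr 1; funext a
  rw [bc_zero_right, one_smul, Nat.cast_zero, add_zero]

theorem taylor_mulZ12_zero {D : BiDist} (h : Regular D) : taylor (mulZ12 D) 0 = 0 := by
  funext c
  have h1 := h.locFin (c - 1)
  have h2 := h1.comp (f := fun a : ℤ => a + -1) (add_left_injective _)
  have e : ∀ a : ℤ, bc a 0 • mulZ12 D a (c + (0 : ℕ) - a) =
      D (a + -1) (c - 1 - (a + -1)) - D a (c - 1 - a) := fun a => by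
    rw [bc_zero_right, one_smul, mulZ12, Nat.cast_zero, add_zero,
      show c - 1 - (a + -1) = c - a by ring, show c - a - 1 = c - 1 - a by ring, ← sub_eq_add_neg]
  rw [taylor_apply, funext e, locSum_sub h2 h1, locSum_shift h1 (-1), op_sub_self]
  rfl

/-- Shifting the first exponent turns multiplication by z₁₂ into a difference of binomial
coefficients, which Pascal's rule collapses. -/
theorem taylor_mulZ12_succ {D : BiDist} (h : Regular D) (k : ℕ) :
    taylor (mulZ12 D) (k + 1) = taylor D k := by
  funext c
  have h0 := h.locFin (c + k)
  have h1 := h0.smul fun a => bc (a + 1) (k + 1)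
  have h2 := h0.smul fun a => bc a (k + 1)
  have h3 := h1.comp (f := fun a : ℤ => a + -1) (add_left_injective _)
  have e : ∀ a : ℤ, bc a (k + 1) • mulZ12 D a (c + (k + 1 : ℕ) - a) =
      bc (a + -1 + 1) (k + 1) • D (a + -1) (c + k - (a + -1)) -
        bc a (k + 1) • D a (c + k - a) := fun a => by
    rw [mulZ12, op_smul_sub, neg_add_cancel_right, ← sub_eq_add_neg,
      show c + ((k + 1 : ℕ) : ℤ) - a - 1 = c + k - a by push_cast; ring,
      show c + ((k + 1 : ℕ) : ℤ) - a = c + k - (a - 1) by push_cast; ring]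
  rw [taylor_apply, funext e, locSum_sub h3 h2, locSum_shift h1 (-1), ← locSum_sub h1 h2,
    taylor_apply]
  congr 1; funext a
  rw [bc_succ_succ]; module

theorem taylor_deriv₁ {D : BiDist} (h : Regular D) (k : ℕ) :
    taylor (deriv₁ D) k = ((k : ℂ) + 1) • taylor D (k + 1) := by
  funext c
  have h1 := (h.locFin (c + k + 1)).smul fun a => ((k : ℂ) + 1) * bc a (k + 1)
  have e : ∀ a : ℤ, bc a k • deriv₁ D a (c + k - a) = (((k : ℂ) + 1) * bc (a + 1) (k + 1)) •
      D (a + 1) (c + k + 1 - (a + 1)) := fun a => by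
    rw [deriv₁, smul_smul, succ_mul_bc, add_sub_cancel_right,
      show c + k + 1 - (a + 1) = c + k - a by ring, mul_comm]
    push_cast; rfl
  rw [taylor_apply, funext e, locSum_shift h1 1, Pi.smul_apply, taylor_apply,
    ← locSum_smul (h.locFin_taylor (k + 1) c)]
  congr 1; funext a
  rw [smul_smul, show c + ((k + 1 : ℕ) : ℤ) - a = c + k + 1 - a by push_cast; ring]

theorem taylor_deriv₂ {D : BiDist} (h : Regular D) (k : ℕ) :
    taylor (deriv₂ D) k = deriv (taylor D k) - ((k : ℂ) + 1) • taylor D (k + 1) := by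
  funext c
  have h1 := h.locFin_taylor k (c + 1)
  have h2 := h.locFin_taylor (k + 1) c
  rw [Pi.sub_apply, Pi.smul_apply, deriv, taylor_apply, taylor_apply, taylor_apply,
    ← locSum_smul h1, ← locSum_smul h2, ← locSum_sub (h1.smul fun _ => _) (h2.smul fun _ => _)]
  congr 1; funext a
  rw [smul_smul, smul_smul, succ_mul_bc', deriv₂, smul_smul,
    show c + ((k + 1 : ℕ) : ℤ) - a = c + k - a + 1 by push_cast; ring,
    show c + 1 + (k : ℤ) - a = c + k - a + 1 by ring]
  push_cast
  module

theorem taylor_one₂ (k : ℕ) : taylor one₂ k = if k = 0 then one else 0 := by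
  funext c
  rw [taylor_apply, locSum_eq_single 0 fun a ha => by rw [one₂, if_neg (by omega), smul_zero],
    bc_zero_left]
  split_ifs with hk
  · rw [hk, one_smul, one₂, one]; simp
  · rw [zero_smul]; rfl

/-- The divided derivative `∂ⁱA / i!`. -/
def divDeriv (i : ℕ) (A : Dist) : Dist := ((i.factorial : ℂ)⁻¹) • deriv^[i] A

theorem iterate_deriv_apply (i : ℕ) (A : Dist) (p : ℤ) :
    deriv^[i] A p = ((i.factorial : ℂ) * bc (p + i) i) • A (p + i) := by
  induction i generalizing p with
  | zero => simp [bc_zero_right]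
  | succ i ih =>
    rw [Function.iterate_succ_apply', deriv, ih, smul_smul, Nat.factorial_succ,
      show p + ((i + 1 : ℕ) : ℤ) = p + 1 + i by push_cast; ring]
    congr 1
    have := succ_mul_bc' (p + 1 + i) i
    push_cast at this ⊢
    rw [show ((p : ℂ) + 1 + i - i) = p + 1 by ring] at this
    linear_combination (-(i.factorial : ℂ)) * this

theorem divDeriv_apply (i : ℕ) (A : Dist) (p : ℤ) :
    divDeriv i A p = bc (p + i) i • A (p + i) := by
  rw [divDeriv, Pi.smul_apply, iterate_deriv_apply, smul_smul, inv_mul_cancel_left₀]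
  exact_mod_cast i.factorial_ne_zero

theorem IsField.divDeriv {A : Dist} (h : IsField A) (i : ℕ) : IsField (divDeriv i A) :=
  (h.iterate_deriv i).smul _

theorem locFin_ordered {A : Dist} {D : BiDist} (hA : IsField A) (hD : Regular D) (n : ℤ) :
    LocFin fun p : ℤ × ℤ => if 0 ≤ p.1 then A p.1 * D p.2 (n - p.1 - p.2) else
      D p.2 (n - p.1 - p.2) * A p.1 := fun v => by
  obtain ⟨N, hN⟩ := hA v
  obtain ⟨M, hM⟩ := hD v
  have h1 : (Set.Icc (0 : ℤ) (n - 2 * M) ×ˢ Set.Icc M (n - M)).Finite :=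
    (Set.finite_Icc _ _).prod (Set.finite_Icc _ _)
  have h2 : (⋃ j ∈ Set.Icc N 0, ({j} : Set ℤ) ×ˢ {a | D a (n - j - a) (A j v) ≠ 0}).Finite :=
    (Set.finite_Icc _ _).biUnion fun j _ =>
      (Set.finite_singleton j).prod (hD.locFin (n - j) (A j v))
  refine (h1.union h2).subset ?_
  rintro ⟨j, a⟩ hja
  simp only [Set.mem_ofPred_eq] at hja
  by_cases hj : 0 ≤ j
  · left
    rw [if_pos hj, Module.End.mul_apply] at hja
    by_contra h'
    rw [Set.mem_prod, Set.mem_Icc, Set.mem_Icc] at h'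
    exact hja (by rw [hM _ _ (by omega), map_zero])
  · right
    rw [if_neg hj, Module.End.mul_apply] at hja
    refine Set.mem_biUnion (x := j) ⟨?_, by omega⟩ ⟨rfl, hja⟩
    by_contra h'
    exact hja (by rw [hN _ (by omega), map_zero])

/-- Taylor expansion of `:A(z₁) D(z₁,z₂):`. -/
theorem taylor_nprod {A : Dist} {D : BiDist} (hA : IsField A) (hD : Regular D) (N : ℕ) :
    taylor (fun a b => nprod A (fun a => D a b) a) N =
      ∑ i ∈ range (N + 1), nprod (divDeriv i A) (taylor D (N - i)) := by
  funext c
  set B : ℤ × ℤ → Module.End ℂ Fock := fun p =>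
    if 0 ≤ p.1 then A p.1 * D p.2 (c + N - p.1 - p.2) else D p.2 (c + N - p.1 - p.2) * A p.1
    with hB
  have hBf : LocFin B := locFin_ordered hA hD (c + N)
  -- Both sides of the expansion are sums of the same ordered products B(j, a), here with weight `bc
  -- (j + a) N` and below with weights `bc j i * bc a (N - i)`. Vandermonde's identity compares
  -- them.
  have hl : taylor (fun a b => nprod A (fun a => D a b) a) N c =
      locSum fun p : ℤ × ℤ => bc (p.1 + p.2) N • B p := by
    have e1 : ∀ a : ℤ, bc a N • nprod A (fun a' => D a' (c + N - a)) a =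
        locSum fun j : ℤ => bc a N • B (j, a - j) := fun a => by
      rw [nprod_apply, ← locSum_smul (locFin_nprodTerm hA (hD.isField_left _) a)]
      congr 1; funext j
      simp only [nprodTerm, hB, show c + N - j - (a - j) = c + N - a by ring]
    have hf := hBf.smul fun p => bc (p.1 + p.2) N
    let e : ℤ × ℤ ≃ ℤ × ℤ :=
      { toFun := fun p => (p.2, p.1 - p.2)
        invFun := fun q => (q.1 + q.2, q.1)
        left_inv := fun p => by simp
        right_inv := fun p => by simp }
    have hf' := hf.comp e.injective
    have e2 := locSum_comp_equiv hf e
    simp only [e, Equiv.coe_fn_mk, add_sub_cancel] at hf' e2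
    rw [taylor_apply, funext e1, locSum_uncurry (A := fun a j => bc a N • B (j, a - j)) hf', ← e2]
  have hr : ∀ i ∈ range (N + 1), nprod (divDeriv i A) (taylor D (N - i)) c =
      locSum fun p : ℤ × ℤ => (bc p.1 i * bc p.2 (N - i)) • B p := fun i hi => by
    rw [Finset.mem_range] at hi
    have hf := hBf.smul fun p => bc p.1 i * bc p.2 (N - i)
    rw [← locSum_uncurry (A := fun j a => (bc j i * bc a (N - i)) • B (j, a)) hf,
      ← locSum_shift (LocFin.locSum_curry (A := fun j a => (bc j i * bc a (N - i)) • B (j, a)) hf) i,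
      nprod_apply]
    congr 1; funext p
    have hT := hD.locFin_taylor (N - i) (c - p)
    have ht : taylor D (N - i) (c - p) =
        locSum fun a : ℤ => bc a (N - i) • D a (c + N - (p + i) - a) := by
      rw [taylor_apply]
      congr 1; funext a
      rw [show c - p + ((N - i : ℕ) : ℤ) - a = c + N - (p + i) - a by
        rw [Nat.cast_sub (by omega)]; ring]
    have hF : LocFin fun a : ℤ => bc a (N - i) • D a (c + N - (p + i) - a) :=
      (hD.locFin (c + N - (p + i))).smul _
    unfold nprodTerm
    rw [ht, divDeriv_apply]
    by_cases hp : 0 ≤ p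
    · rw [if_pos hp, mul_locSum hF]
      congr 1; funext a
      rw [hB]
      simp only [if_pos (show 0 ≤ p + (i : ℤ) by omega)]
      rw [mul_smul_comm, smul_mul_assoc, smul_smul, mul_comm]
    · rw [if_neg hp, locSum_mul hF]
      congr 1; funext a
      -- Differentiation could carry a nonnegative mode into the annihilation half. The binomial
      -- coefficient vanishes exactly in these cases, so the splitting is respected.
      by_cases hpi : 0 ≤ p + (i : ℤ)
      · rw [bc_eq_zero hpi (by omega)]; simp
      · rw [hB]
        simp only [if_neg hpi]
        rw [mul_smul_comm, smul_mul_assoc, smul_smul]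
  rw [hl, Finset.sum_apply, Finset.sum_congr rfl hr, ← locSum_finsetSum _ fun i _ => hBf.smul _]
  congr 1; funext p
  rw [bc_add, Finset.sum_smul]

/-! ### The Taylor coefficients of the bilocal field -/

/-- The coefficient of `z₁₂ᴺ` in `:exp(∫_{z₂}^{z₁} H):`. -/
def expTaylor (m N : ℕ) : Dist := taylor (expField m) N

/-- The coefficient of `z₁₂ᵏ` in the bilocal field. -/
def bilocalTaylor (m k : ℕ) : Dist := taylor (bilocal m) k

theorem isField_expTaylor {m : ℕ} (hm : m ≠ 0) (N : ℕ) : IsField (expTaylor m N) :=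
  (regular_expField hm).isField_taylor N

theorem isField_bilocalTaylor {m : ℕ} (hm : m ≠ 0) (k : ℕ) : IsField (bilocalTaylor m k) :=
  (regular_bilocal hm).isField_taylor k

theorem expField_eq {m : ℕ} (hm : m ≠ 0) : expField m = mulZ12 (bilocal m) + one₂ := by
  rw [mulZ12_bilocal hm]; abel

/-- From z₁₂ V_m = E - 1: multiplication by z₁₂ shifts the Taylor index, and the unit contributes
only at index 0. -/
theorem bilocalTaylor_eq {m : ℕ} (hm : m ≠ 0) (k : ℕ) :
    bilocalTaylor m k = expTaylor m (k + 1) := by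
  have := taylor_sub (regular_expField hm) regular_one₂ (k + 1)
  rw [← mulZ12_bilocal hm, taylor_mulZ12_succ (regular_bilocal hm), taylor_one₂,
    if_neg (by omega)] at this
  rw [bilocalTaylor, this, expTaylor]
  funext a
  exact op_sub_zero _

theorem expTaylor_zero {m : ℕ} (hm : m ≠ 0) : expTaylor m 0 = one := by
  have := taylor_sub (regular_expField hm) regular_one₂ 0
  rw [← mulZ12_bilocal hm, taylor_mulZ12_zero (regular_bilocal hm), taylor_one₂, if_pos rfl] at this
  funext a
  have h := congrFun this a
  rw [Pi.sub_apply] at h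
  exact op_sub_eq_zero.1 h.symm

theorem expTaylor_succ {m : ℕ} (hm : m ≠ 0) (N : ℕ) :
    ((N : ℂ) + 1) • expTaylor m (N + 1) =
      ∑ i ∈ range (N + 1), nprod (divDeriv i (current m)) (expTaylor m (N - i)) := by
  have h := taylor_nprod (isField_current m) (regular_expField hm) N
  have e : (fun a b => nprod (current m) (fun a => expField m a b) a) = deriv₁ (expField m) := by
    funext a b
    rw [← deriv_expField hm b]; rfl
  rw [e, taylor_deriv₁ (regular_expField hm)] at h
  exact h

/-! ### Normally ordered differential polynomials of the current -/

/-- The normally ordered monomial in the derivatives of `A`. -/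
def nmonomial (A : Dist) (s : ℕ →₀ ℕ) : Dist :=
  (((Finsupp.toMultiset s).sort (· ≤ ·)).map fun k => deriv^[k] A).foldr nprod one

theorem npoly_eq_sum (A : Dist) (P : MvPolynomial ℕ ℂ) {S : Finset (ℕ →₀ ℕ)}
    (h : P.support ⊆ S) : npoly A P = ∑ s ∈ S, P.coeff s • nmonomial A s := by
  funext a
  rw [Finset.sum_apply]
  exact Finset.sum_subset h fun s _ hs => by
    rw [MvPolynomial.notMem_support_iff.1 hs, zero_smul]

theorem npoly_add (A : Dist) (P Q : MvPolynomial ℕ ℂ) :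
    npoly A (P + Q) = npoly A P + npoly A Q := by
  classical
  rw [npoly_eq_sum A P subset_union_left, npoly_eq_sum A Q subset_union_right,
    npoly_eq_sum A (P + Q) MvPolynomial.support_add, ← Finset.sum_add_distrib]
  exact Finset.sum_congr rfl fun s _ => by rw [coeff_add, add_smul]

theorem npoly_smul (A : Dist) (c : ℂ) (P : MvPolynomial ℕ ℂ) :
    npoly A (c • P) = c • npoly A P := by
  rw [npoly_eq_sum A P subset_rfl, npoly_eq_sum A (c • P) MvPolynomial.support_smul,
    Finset.smul_sum]
  exact Finset.sum_congr rfl fun s _ => by rw [coeff_smul, smul_assoc]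

theorem npoly_monomial (A : Dist) (s : ℕ →₀ ℕ) (c : ℂ) :
    npoly A (monomial s c) = c • nmonomial A s := by
  rw [npoly_eq_sum A _ MvPolynomial.support_monomial_subset, Finset.sum_singleton, coeff_monomial,
    if_pos rfl]

theorem npoly_zero (A : Dist) : npoly A 0 = 0 := by
  rw [npoly_eq_sum A 0 (S := ∅) (by simp), Finset.sum_empty]

theorem npoly_one (A : Dist) : npoly A 1 = one := by
  have := npoly_monomial A 0 1
  rw [one_smul] at this
  rw [show (1 : MvPolynomial ℕ ℂ) = monomial 0 1 from rfl, this]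
  simp [nmonomial]

theorem npoly_sum {J : Type*} (A : Dist) (s : Finset J) (P : J → MvPolynomial ℕ ℂ) :
    npoly A (∑ j ∈ s, P j) = ∑ j ∈ s, npoly A (P j) := by
  classical
  induction s using Finset.induction_on with
  | empty => simp [npoly_zero]
  | insert j s hj ih => rw [Finset.sum_insert hj, Finset.sum_insert hj, npoly_add, ih]

/-- `A` has commuting nonnegative powers and commuting negative powers. -/
def HalfCommuting (A : Dist) : Prop :=
  (∀ j k : ℤ, 0 ≤ j → 0 ≤ k → Commute (A j) (A k)) ∧
    ∀ j k : ℤ, j < 0 → k < 0 → Commute (A j) (A k)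

theorem halfCommuting_current (m : ℕ) : HalfCommuting (current m) :=
  ⟨fun j k hj hk => heis_commute_of_neg m (by omega) (by omega),
    fun j k hj hk => heis_commute_of_nonneg m (by omega) (by omega)⟩

theorem iterate_deriv_of_neg {A : Dist} {i : ℕ} {j : ℤ} (hj : j < 0) (hji : 0 ≤ j + i) :
    deriv^[i] A j = 0 := by
  rw [iterate_deriv_apply, bc_eq_zero hji (by omega), mul_zero, zero_smul]

theorem nprod_iterate_deriv_comm {A B : Dist} (hA : IsField A) (hc : HalfCommuting A)
    (hB : IsField B) (i k : ℕ) : nprod (deriv^[i] A) (nprod (deriv^[k] A) B) =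
      nprod (deriv^[k] A) (nprod (deriv^[i] A) B) := by
  refine nprod_left_comm (hA.iterate_deriv i) (hA.iterate_deriv k) hB ?_ ?_
  · intro a b ha hb
    rw [iterate_deriv_apply, iterate_deriv_apply]
    exact ((hc.1 _ _ (by omega) (by omega)).smul_left _).smul_right _
  · intro a b ha hb
    by_cases h1 : 0 ≤ a + i
    · rw [iterate_deriv_of_neg ha h1]; exact Commute.zero_left _
    by_cases h2 : 0 ≤ b + k
    · rw [iterate_deriv_of_neg hb h2]; exact Commute.zero_right _
    rw [iterate_deriv_apply, iterate_deriv_apply]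
    exact ((hc.2 _ _ (by omega) (by omega)).smul_left _).smul_right _

theorem isField_foldr_nprod {A : Dist} (hA : IsField A) (l : List ℕ) :
    IsField ((l.map fun k => deriv^[k] A).foldr nprod one) := by
  induction l with
  | nil => exact isField_one
  | cons i l ih => exact (hA.iterate_deriv i).nprod ih

theorem foldr_nprod_perm {A : Dist} (hA : IsField A) (hc : HalfCommuting A) {l l' : List ℕ}
    (h : l.Perm l') : (l.map fun k => deriv^[k] A).foldr nprod one =
      (l'.map fun k => deriv^[k] A).foldr nprod one := by
  induction h with
  | nil => rfl
  | cons i _ ih => simp only [List.map_cons, List.foldr_cons, ih]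
  | swap i j l => exact nprod_iterate_deriv_comm hA hc (isField_foldr_nprod hA l) j i
  | trans _ _ h1 h2 => exact h1.trans h2

theorem nmonomial_add_single {A : Dist} (hA : IsField A) (hc : HalfCommuting A) (i : ℕ)
    (s : ℕ →₀ ℕ) : nmonomial A (Finsupp.single i 1 + s) =
      nprod (deriv^[i] A) (nmonomial A s) := by
  have h : ((Finsupp.toMultiset (Finsupp.single i 1 + s)).sort (· ≤ ·)).Perm
      (i :: (Finsupp.toMultiset s).sort (· ≤ ·)) := by
    rw [← Multiset.coe_eq_coe, Multiset.sort_eq, ← Multiset.cons_coe, Multiset.sort_eq, map_add,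
      Finsupp.toMultiset_single, one_smul, Multiset.singleton_add]
  rw [nmonomial, foldr_nprod_perm hA hc h]
  rfl

theorem isField_nmonomial {A : Dist} (hA : IsField A) (s : ℕ →₀ ℕ) : IsField (nmonomial A s) :=
  isField_foldr_nprod hA _

theorem isField_npoly {A : Dist} (hA : IsField A) (P : MvPolynomial ℕ ℂ) :
    IsField (npoly A P) := by
  rw [npoly_eq_sum A P subset_rfl]
  exact IsField.finsetSum _ fun s _ => (isField_nmonomial hA s).smul _

/-- The definition of `npoly` multiplies the factors in sorted order. Because the two halves of the
current commute separately, the order is immaterial, and a new variable may be placed in front; this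
is what a recursive comparison needs. -/
theorem npoly_X_mul {A : Dist} (hA : IsField A) (hc : HalfCommuting A) (i : ℕ)
    (P : MvPolynomial ℕ ℂ) : npoly A (X i * P) = nprod (deriv^[i] A) (npoly A P) := by
  have hi := hA.iterate_deriv i
  induction P using MvPolynomial.induction_on' with
  | monomial s c =>
    rw [X, monomial_mul, one_mul, npoly_monomial, npoly_monomial, nmonomial_add_single hA hc,
      nprod_smul_right hi (isField_nmonomial hA s)]
  | add P Q hP hQ =>
    rw [mul_add, npoly_add, npoly_add, hP, hQ,
      nprod_add_right hi (isField_npoly hA P) (isField_npoly hA Q)]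

theorem schurDiff_zero : schurDiff 0 = 1 := by rw [schurDiff, schur_zero, map_one]

theorem schurDiff_succ (N : ℕ) : ((N : ℂ) + 1) • schurDiff (N + 1) =
    ∑ i ∈ range (N + 1), ((i.factorial : ℂ)⁻¹) • (X i * schurDiff (N - i)) := by
  have h := congrArg (aeval (R := ℂ) fun k : ℕ => C ((k.factorial : ℂ)⁻¹) * X (k - 1)) (schur_succ N)
  simp only [map_sum, map_mul, map_natCast, aeval_X] at h
  have e : ((N : ℂ) + 1) • schurDiff (N + 1) = ((N : MvPolynomial ℕ ℂ) + 1) * schurDiff (N + 1) := by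
    rw [smul_eq_C_mul]; simp
  rw [e]
  refine Eq.trans ?_ (h.trans ?_)
  · simp [schurDiff]
  · refine Finset.sum_congr rfl fun i _ => ?_
    rw [← schurDiff, Nat.add_sub_cancel, smul_eq_C_mul, Nat.factorial_succ]
    -- The weight j + 1 in Newton's recursion lowers the 1/(j+1)! of the substitution t_{j+1} = ∂^j
    -- H/(j+1)! to 1/j!, the divided derivative.
    have hC : ((i : MvPolynomial ℕ ℂ) + 1) * C ((((i + 1) * i.factorial : ℕ) : ℂ)⁻¹) =
        C ((i.factorial : ℂ)⁻¹) := by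
      rw [show (i : MvPolynomial ℕ ℂ) + 1 = C ((i : ℂ) + 1) by simp, ← C_mul]
      congr 1
      have h1 : (i.factorial : ℂ) ≠ 0 := by exact_mod_cast i.factorial_ne_zero
      have h2 : (i : ℂ) + 1 ≠ 0 := by exact_mod_cast Nat.succ_ne_zero i
      push_cast; field_simp
    rw [← hC]
    push_cast
    ring

/-- Both sequences start with the unit field and obey the recursion (N+1)A_{N+1} = ∑ :(∂^i H/i!)
A_{N-i}:. -/
theorem expTaylor_eq_npoly {m : ℕ} (hm : m ≠ 0) (N : ℕ) :
    expTaylor m N = npoly (current m) (schurDiff N) := by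
  induction N using Nat.strong_induction_on with
  | _ N ih =>
    cases N with
    | zero => rw [expTaylor_zero hm, schurDiff_zero, npoly_one]
    | succ N =>
      have hN : (N : ℂ) + 1 ≠ 0 := by exact_mod_cast Nat.succ_ne_zero N
      have hH := isField_current m
      refine smul_right_injective Dist hN ?_
      change ((N : ℂ) + 1) • _ = ((N : ℂ) + 1) • _
      rw [expTaylor_succ hm, ← npoly_smul, schurDiff_succ, npoly_sum]
      refine Finset.sum_congr rfl fun i hi => ?_
      rw [ih (N - i) (by omega), npoly_smul, npoly_X_mul hH (halfCommuting_current m), divDeriv,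
        nprod_smul_left (hH.iterate_deriv i) (isField_npoly hH _)]

/-! ### Linearity of the derivative -/

theorem iterate_deriv_smul (k : ℕ) (r : ℂ) (A : Dist) :
    deriv^[k] (r • A) = r • deriv^[k] A := by
  funext c
  rw [Pi.smul_apply, iterate_deriv_apply, iterate_deriv_apply, Pi.smul_apply, smul_comm]

theorem iterate_deriv_sum {J : Type*} (k : ℕ) (s : Finset J) (A : J → Dist) :
    deriv^[k] (∑ j ∈ s, A j) = ∑ j ∈ s, deriv^[k] (A j) := by
  funext c
  simp only [Finset.sum_apply, iterate_deriv_apply, Finset.smul_sum]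

/-! ### Quasiprimary projections of the Taylor coefficients -/

/-- The local field `V^l(z,m)`, as a combination of derivatives of Taylor coefficients of the bilocal
field. -/
def quasiField (m l : ℕ) : Dist := ((l.factorial : ℂ) / ((2 * l).factorial : ℂ)) •
  ∑ k ∈ range (l + 1), ((-1) ^ k * (l.choose k : ℂ) * ((2 * l - k).factorial : ℂ)) •
    deriv^[k] (bilocalTaylor m (l - k))

theorem isField_quasiField {m : ℕ} (hm : m ≠ 0) (l : ℕ) : IsField (quasiField m l) :=
  (IsField.finsetSum _ fun k _ => ((isField_bilocalTaylor hm (l - k)).iterate_deriv k).smul _).smul _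

theorem quasiField_eq_schur {m : ℕ} (hm : m ≠ 0) (l : ℕ) : quasiField m l =
    ((l.factorial : ℂ) ^ 2 / ((2 * l).factorial : ℂ)) • ∑ k ∈ range (l + 1),
      ((-1) ^ k * (l.choose k : ℂ) * ((2 * l - k).choose l : ℂ) * ((l - k).factorial : ℂ)) •
        deriv^[k] (npoly (current m) (schurDiff (l - k + 1))) := by
  rw [quasiField, Finset.smul_sum, Finset.smul_sum]
  refine Finset.sum_congr rfl fun k hk => ?_
  rw [Finset.mem_range] at hk
  rw [bilocalTaylor_eq hm, expTaylor_eq_npoly hm, smul_smul, smul_smul]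
  congr 1
  have h := Nat.choose_mul_factorial_mul_factorial (show l ≤ 2 * l - k by omega)
  rw [show 2 * l - k - l = l - k by omega] at h
  rw [← h]
  push_cast
  ring

/-- Pascal's recursion for alternating sums. -/
theorem alternating_sum_succ {M : Type*} [AddCommGroup M] [Module ℂ M] (n : ℕ) (u : ℕ → M) :
    ∑ i ∈ range (n + 2), ((-1) ^ i * ((n + 1).choose i : ℂ)) • u i =
      ∑ i ∈ range (n + 1), ((-1) ^ i * (n.choose i : ℂ)) • u i +
        (-1 : ℂ) • ∑ i ∈ range (n + 1), ((-1) ^ i * (n.choose i : ℂ)) • u (i + 1) := by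
  have h1 : ∑ i ∈ range (n + 1), ((-1) ^ i * (n.choose i : ℂ)) • u i =
      ∑ i ∈ range (n + 2), ((-1) ^ i * (n.choose i : ℂ)) • u i := by
    rw [Finset.sum_range_succ _ (n + 1), Nat.choose_succ_self]; simp
  rw [h1, Finset.sum_range_succ' _ (n + 1), Finset.sum_range_succ' _ (n + 1), add_right_comm,
    Finset.smul_sum, ← Finset.sum_add_distrib]
  simp only [Nat.choose_zero_right]
  congr 1
  refine Finset.sum_congr rfl fun i _ => ?_
  rw [Nat.choose_succ_succ, smul_smul, ← add_smul]
  congr 1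
  push_cast
  ring

theorem Regular.deriv₁ {D : BiDist} (h : Regular D) : Regular (deriv₁ D) := by
  have := (h.shift 1 0).smul_fun fun a _ => (a : ℂ) + 1
  simp only [add_zero] at this
  exact this

theorem Regular.deriv₂ {D : BiDist} (h : Regular D) : Regular (deriv₂ D) := by
  have := (h.shift 0 1).smul_fun fun _ b => (b : ℂ) + 1
  simp only [add_zero] at this
  exact this

theorem Regular.iterate_mulZ12 {D : BiDist} (h : Regular D) (i : ℕ) :
    Regular (Bilocal.mulZ12^[i] D) := by
  induction i with
  | zero => exact h
  | succ i ih => rw [Function.iterate_succ_apply']; exact ih.mulZ12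

theorem Regular.iterate_neg_deriv₂ {D : BiDist} (h : Regular D) (i : ℕ) :
    Regular ((fun D => -Bilocal.deriv₂ D)^[i] D) := by
  induction i with
  | zero => exact h
  | succ i ih => rw [Function.iterate_succ_apply']; exact ih.deriv₂.neg

theorem taylor_iterate_mulZ12 {D : BiDist} (h : Regular D) (l k : ℕ) :
    taylor (mulZ12^[l] D) (k + l) = taylor D k := by
  induction l with
  | zero => rfl
  | succ l ih => rw [Function.iterate_succ_apply', ← add_assoc,
      taylor_mulZ12_succ (h.iterate_mulZ12 l), ih]

theorem taylor_iterate_deriv₁ {D : BiDist} (h : Regular D) (l k : ℕ) :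
    (k.factorial : ℂ) • taylor (deriv₁^[l] D) k = ((k + l).factorial : ℂ) • taylor D (k + l) := by
  induction l generalizing D with
  | zero => rfl
  | succ l ih =>
    rw [Function.iterate_succ_apply, ih h.deriv₁, taylor_deriv₁ h, smul_smul, ← add_assoc,
      Nat.factorial_succ]
    push_cast
    rw [mul_comm]

/-- On Taylor coefficients -∂₂ raises the index with the factor k + 1 and subtracts ∂. These two
operations commute, so powers expand by the binomial theorem; the factorials absorb the weights. -/
theorem taylor_iterate_neg_deriv₂ {D : BiDist} (h : Regular D) (j k : ℕ) :
    (k.factorial : ℂ) • taylor ((fun D => -deriv₂ D)^[j] D) k =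
      ∑ i ∈ range (j + 1), ((-1) ^ i * (j.choose i : ℂ)) •
        (((k + j - i).factorial : ℂ) • deriv^[i] (taylor D (k + j - i))) := by
  induction j generalizing k with
  | zero => simp
  | succ j ih =>
    have hr := h.iterate_neg_deriv₂ j
    rw [alternating_sum_succ j fun i => ((k + (j + 1) - i).factorial : ℂ) •
      deriv^[i] (taylor D (k + (j + 1) - i))]
    have h1 := ih (k + 1)
    rw [show k + 1 + j = k + (j + 1) by ring] at h1
    have h2 := congrArg (deriv^[1]) (ih k)
    rw [iterate_deriv_sum, iterate_deriv_smul] at h2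
    rw [← h1]
    have h3 : ∑ i ∈ range (j + 1), ((-1) ^ i * (j.choose i : ℂ)) •
        (((k + (j + 1) - (i + 1)).factorial : ℂ) •
          deriv^[i + 1] (taylor D (k + (j + 1) - (i + 1)))) =
        (k.factorial : ℂ) • deriv (taylor ((fun D => -deriv₂ D)^[j] D) k) := by
      refine Eq.trans (Finset.sum_congr rfl fun i _ => ?_) h2.symm
      rw [iterate_deriv_smul, iterate_deriv_smul, ← Function.iterate_add_apply, add_comm 1 i,
        show k + (j + 1) - (i + 1) = k + j - i by omega]
    rw [h3, Function.iterate_succ_apply', taylor_neg hr.deriv₂, taylor_deriv₂ hr, Nat.factorial_succ]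
    funext c
    simp only [Pi.smul_apply, Pi.neg_apply, Pi.sub_apply, Pi.add_apply]
    push_cast
    module

/-- The coincidence limit is the zeroth Taylor coefficient; ∂₁^l brings in l! times the coefficient
of index l, (-∂₂)^l spreads it into the alternating sum, and z₁₂^l lowers the indices by l. -/
theorem quasiField_eq_diag {m : ℕ} (hm : m ≠ 0) (l : ℕ) : quasiField m l =
    ((l.factorial : ℂ) / ((2 * l).factorial : ℂ)) •
      diag (deriv₁^[l] ((fun D => -deriv₂ D)^[l] (mulZ12^[l] (bilocal m)))) := by
  have hr := regular_bilocal hm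
  have h1 := taylor_iterate_deriv₁ ((hr.iterate_mulZ12 l).iterate_neg_deriv₂ l) l 0
  rw [Nat.factorial_zero, Nat.cast_one, one_smul, zero_add,
    taylor_iterate_neg_deriv₂ (hr.iterate_mulZ12 l)] at h1
  rw [quasiField, diag_eq_taylor, h1]
  congr 1
  refine Finset.sum_congr rfl fun k hk => ?_
  rw [Finset.mem_range] at hk
  rw [smul_smul, ← two_mul, show 2 * l - k = (l - k) + l by omega, taylor_iterate_mulZ12 hr,
    bilocalTaylor]

/-! ### Expansion of the bilocal field -/

/-- The orthogonality relation between the coefficients of the quasiprimary projection and of the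
expansion. -/
theorem sum_orthogonality {K : Type*} [Field K] [CharZero K] (s : ℕ) {d : ℕ} (hd : d ≠ 0) :
    ∑ i ∈ range (d + 1), (-1 : K) ^ i * (s + 2 * i + 1) * ((s + i).factorial : K) /
      ((s + d + i + 1).factorial : K) * (d.choose i : K) = 0 := by
  -- After multiplication by d the partial sums have a closed form containing n·(d choose n), which
  -- vanishes at n = d + 1.
  have key : ∀ n : ℕ, (d : K) * ∑ i ∈ range n, (-1 : K) ^ i * (s + 2 * i + 1) *
      ((s + i).factorial : K) / ((s + d + i + 1).factorial : K) * (d.choose i : K) =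
      -((-1) ^ n * ((s + n).factorial : K) / ((s + d + n).factorial : K) *
        ((n : K) * d.choose n)) := by
    intro n
    induction n with
    | zero => simp
    | succ n ih =>
      rw [Finset.sum_range_succ, mul_add, ih]
      have h1 := Nat.choose_succ_right_eq d n
      have h2 : ((n + 1 : ℕ) : K) * (d.choose (n + 1) : K) = d.choose n * ((d : K) - n) := by
        rcases le_or_gt n d with h | h
        · have := congrArg (Nat.cast : ℕ → K) h1
          push_cast [Nat.cast_sub h] at this ⊢
          rw [mul_comm, this]
        · rw [Nat.choose_eq_zero_of_lt h, Nat.choose_eq_zero_of_lt (by omega)]; simp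
      rw [h2, ← add_assoc, ← add_assoc, Nat.factorial_succ (s + n), Nat.factorial_succ (s + d + n)]
      have h3 : ((s + d + n).factorial : K) ≠ 0 := by exact_mod_cast Nat.factorial_ne_zero _
      have h4 : ((s + d + n : ℕ) : K) + 1 ≠ 0 := Nat.cast_add_one_ne_zero _
      push_cast at h4 ⊢
      field_simp
      ring
  have h := key (d + 1)
  rw [Nat.choose_succ_self, Nat.cast_zero, mul_zero, mul_zero, neg_zero] at h
  exact (mul_eq_zero.1 h).resolve_left (by exact_mod_cast hd)

theorem integral_pow_mul_pow (p q : ℕ) : ∫ t in (0 : ℝ)..1, (t : ℂ) ^ p * (1 - (t : ℂ)) ^ q =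
    (p.factorial : ℂ) * q.factorial / (p + q + 1).factorial := by
  have h := Complex.betaIntegral_eval_nat_add_one_right (u := (p : ℂ) + 1)
    (by simp; positivity) q
  rw [Complex.betaIntegral] at h
  simp only [add_sub_cancel_right, Complex.cpow_natCast] at h
  rw [h]
  have h1 : ∏ j ∈ range (q + 1), ((p : ℂ) + 1 + j) = ((p + 1).ascFactorial (q + 1) : ℂ) := by
    rw [Nat.ascFactorial_eq_prod_range]; push_cast; rfl
  have h2 := Nat.factorial_mul_ascFactorial p (q + 1)
  have h3 : (p.factorial : ℂ) ≠ 0 := by exact_mod_cast Nat.factorial_ne_zero _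
  have h4 : ((p + 1).ascFactorial (q + 1) : ℂ) ≠ 0 := by
    exact_mod_cast (Nat.ascFactorial_pos _ _).ne'
  rw [h1, add_assoc, ← h2]
  push_cast
  field_simp

theorem integral_weight (l n : ℕ) : ∫ t in (0 : ℝ)..1, weight l t 1 0 * (t : ℂ) ^ n =
    ((2 * l + 1).factorial : ℂ) * (l + n).factorial /
      (l.factorial * (2 * l + n + 1).factorial) := by
  have e : ∀ t : ℝ, weight l t 1 0 * (t : ℂ) ^ n = ((2 * l + 1).factorial : ℂ) /
      (l.factorial : ℂ) ^ 2 * ((t : ℂ) ^ (l + n) * (1 - (t : ℂ)) ^ l) := fun t => by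
    rw [weight, pow_add]; simp only [sub_zero, one_pow, mul_one]; ring
  simp only [e]
  rw [intervalIntegral.integral_const_mul, integral_pow_mul_pow, show l + n + l = 2 * l + n by ring]
  have h3 : (l.factorial : ℂ) ≠ 0 := by exact_mod_cast Nat.factorial_ne_zero _
  field_simp

theorem integral_weight_eq_one (l : ℕ) {z₁ z₂ : ℂ} (h : z₁ ≠ z₂) :
    ∫ t in (0 : ℝ)..1, (z₁ - z₂) * weight l (z₂ + t * (z₁ - z₂)) z₁ z₂ = 1 := by
  have h12 : z₁ - z₂ ≠ 0 := sub_ne_zero.2 h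
  have h3 : (l.factorial : ℂ) ≠ 0 := by exact_mod_cast Nat.factorial_ne_zero _
  have e : ∀ t : ℝ, (z₁ - z₂) * weight l (z₂ + t * (z₁ - z₂)) z₁ z₂ =
      weight l t 1 0 * (t : ℂ) ^ 0 := fun t => by
    rw [weight, weight, show z₁ - (z₂ + t * (z₁ - z₂)) = (1 - t) * (z₁ - z₂) by ring,
      show z₂ + t * (z₁ - z₂) - z₂ = t * (z₁ - z₂) by ring, mul_pow, mul_pow]
    simp only [sub_zero, one_pow, mul_one, pow_zero]
    field_simp
    ring
  simp only [e]
  rw [integral_weight]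
  have h4 : ((2 * l + 1).factorial : ℂ) ≠ 0 := by exact_mod_cast Nat.factorial_ne_zero _
  rw [add_zero, add_zero]
  field_simp

theorem quasiField_eq_sum (m l : ℕ) : quasiField m l = ∑ j ∈ range (l + 1),
    ((l.factorial : ℂ) / ((2 * l).factorial : ℂ) *
      ((-1) ^ (l - j) * (l.choose j : ℂ) * ((l + j).factorial : ℂ))) •
        deriv^[l - j] (bilocalTaylor m j) := by
  rw [quasiField, Finset.smul_sum, ← Finset.sum_range_reflect]
  refine Finset.sum_congr rfl fun j hj => ?_
  rw [Finset.mem_range] at hj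
  rw [smul_smul, show l + 1 - 1 - j = l - j by omega, show 2 * l - (l - j) = l + j by omega,
    show l - (l - j) = j by omega, Nat.choose_symm (by omega)]

/-- Inserting the definition of V^l, the total coefficient of ∂^{k-j}T_j is a sum over l = j + i. It
is `sum_orthogonality` with s = 2j and d = k - j, hence zero for j < k, and it equals 1 for j = k.
-/
theorem bilocalTaylor_expansion (m k : ℕ) : bilocalTaylor m k = ∑ l ∈ range (k + 1),
    (1 / (l.factorial : ℂ)) • weightedIntegral l (quasiField m l) (k - l) := by
  set t : ℕ → ℕ → ℂ := fun j i => (k.factorial : ℂ) / (j.factorial * (k - j).factorial) *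
    ((-1) ^ i * (((2 * j : ℕ) : ℂ) + 2 * i + 1) * ((2 * j + i).factorial : ℂ) /
      ((2 * j + (k - j) + i + 1).factorial : ℂ) * ((k - j).choose i : ℂ)) with ht
  have h1 : ∀ l ∈ range (k + 1), (1 / (l.factorial : ℂ)) •
      weightedIntegral l (quasiField m l) (k - l) = ∑ j ∈ range (l + 1),
        t j (l - j) • deriv^[k - j] (bilocalTaylor m j) := fun l hl => by
    rw [Finset.mem_range] at hl
    rw [weightedIntegral, integral_weight, quasiField_eq_sum, iterate_deriv_sum, Finset.smul_sum,
      Finset.smul_sum]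
    refine Finset.sum_congr rfl fun j hj => ?_
    rw [Finset.mem_range] at hj
    rw [iterate_deriv_smul, smul_smul, smul_smul, ← Function.iterate_add_apply,
      show k - l + (l - j) = k - j by omega]
    congr 1
    obtain ⟨i, rfl⟩ : ∃ i, l = j + i := ⟨l - j, by omega⟩
    obtain ⟨r, rfl⟩ : ∃ r, k = j + i + r := ⟨k - (j + i), by omega⟩
    simp only [ht, show j + i - j = i by omega, show j + i + r - (j + i) = r by omega,
      show j + i + r - j = i + r by omega, show 2 * j + (i + r) + i + 1 = 2 * (j + i) + r + 1 by ring,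
      show j + i + j = 2 * j + i by ring]
    rw [Nat.factorial_succ (2 * (j + i)), Nat.cast_add_choose, Nat.cast_add_choose]
    have f : ∀ n : ℕ, (n.factorial : ℂ) ≠ 0 := fun n => by exact_mod_cast Nat.factorial_ne_zero n
    have := f j; have := f i; have := f r; have := f (j + i); have := f (2 * (j + i))
    have := f (i + r); have := f (2 * (j + i) + r + 1)
    push_cast
    field_simp
  rw [Finset.sum_congr rfl h1, Finset.sum_range_diag_flip (k + 1) fun j i =>
    t j i • deriv^[k - j] (bilocalTaylor m j), Finset.sum_range_succ, Finset.sum_eq_zero, zero_add]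
  · rw [show k + 1 - k = 1 by omega, Finset.sum_range_one]
    simp only [ht, Nat.sub_self, Function.iterate_zero, id_eq]
    have f : ∀ n : ℕ, (n.factorial : ℂ) ≠ 0 := fun n => by exact_mod_cast Nat.factorial_ne_zero n
    have h3 : (2 * (k : ℂ) + 1) ≠ 0 := by exact_mod_cast Nat.succ_ne_zero (2 * k)
    have := f k; have := f (2 * k)
    conv_lhs => rw [← one_smul ℂ (bilocalTaylor m k)]
    congr 1
    simp only [add_zero, Nat.factorial_succ]
    push_cast
    field_simp
    simp
  · intro j hj
    rw [Finset.mem_range] at hj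
    rw [← Finset.sum_smul, ht]
    simp only []
    rw [← Finset.mul_sum, show k + 1 - j = (k - j) + 1 by omega,
      sum_orthogonality (K := ℂ) (2 * j) (show k - j ≠ 0 by omega), mul_zero, zero_smul]

/-! ### Quasiprimarity -/

theorem bracket_smul (X : Module.End ℂ Fock) (r : ℂ) (A : Dist) :
    bracket X (r • A) = r • bracket X A := by
  funext c
  simp only [bracket, Pi.smul_apply, mul_smul_comm, smul_mul_assoc, op_smul_sub]

theorem bracket_add (X : Module.End ℂ Fock) (A B : Dist) :
    bracket X (A + B) = bracket X A + bracket X B := by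
  funext c
  simp only [bracket, Pi.add_apply, mul_add, add_mul]
  abel

theorem bracket_sum {J : Type*} (X : Module.End ℂ Fock) (s : Finset J) (A : J → Dist) :
    bracket X (∑ j ∈ s, A j) = ∑ j ∈ s, bracket X (A j) := by
  classical
  induction s using Finset.induction_on with
  | empty => funext c; simp [bracket, op_sub_self]
  | insert j s hj ih => rw [Finset.sum_insert hj, Finset.sum_insert hj, bracket_add, ih]

theorem bracket_taylor {D : BiDist} (h : Regular D) (X : Module.End ℂ Fock) (k : ℕ) (c : ℤ) :
    bracket X (taylor D k) c = locSum fun a : ℤ =>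
      bc a k • (X * D a (c + k - a) - D a (c + k - a) * X) := by
  have hf := h.locFin_taylor k c
  rw [bracket, taylor_apply, mul_locSum hf, locSum_mul hf,
    ← locSum_sub (hf.mul_left X) (hf.mul_right X)]
  congr 1; funext a
  rw [op_smul_sub, mul_smul_comm, smul_mul_assoc]

theorem bracket_virasoro_neg_one_taylor {m : ℕ} (hm : m ≠ 0) (k : ℕ) :
    bracket (virasoro m (-1)) (bilocalTaylor m k) = deriv (bilocalTaylor m k) := by
  have hr := regular_bilocal hm
  have h1 := taylor_deriv₂ hr k
  rw [← taylor_deriv₁ hr] at h1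
  funext c
  have h2 := congrFun h1 c
  rw [Pi.sub_apply] at h2
  rw [bilocalTaylor, bracket_taylor hr,
    show deriv (taylor (bilocal m) k) c = taylor (deriv₁ (bilocal m)) k c +
      taylor (deriv₂ (bilocal m)) k c by rw [h2]; abel, taylor_apply, taylor_apply,
    ← locSum_add (hr.deriv₁.locFin_taylor k c) (hr.deriv₂.locFin_taylor k c)]
  congr 1; funext a
  rw [moebiusCovariant_bilocal hm (-1) (Or.inl rfl), ← smul_add, deriv₁, deriv₂]
  congr 1
  push_cast
  simp

theorem bracket_virasoro_zero_taylor {m : ℕ} (hm : m ≠ 0) (k : ℕ) (c : ℤ) :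
    bracket (virasoro m 0) (bilocalTaylor m k) c = ((c : ℂ) + k + 1) • bilocalTaylor m k c := by
  have hr := regular_bilocal hm
  rw [bilocalTaylor, bracket_taylor hr, taylor_apply, ← locSum_smul (hr.locFin_taylor k c)]
  congr 1; funext a
  rw [moebiusCovariant_bilocal hm 0 (Or.inr (Or.inl rfl)), sub_zero, sub_zero, ← add_smul, smul_smul,
    smul_smul]
  congr 1
  push_cast
  ring

/-- At k = 0 the truncated index k - 1 is harmless, since its coefficient k vanishes. -/
theorem bracket_virasoro_one_taylor {m : ℕ} (hm : m ≠ 0) (k : ℕ) (c : ℤ) :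
    bracket (virasoro m 1) (bilocalTaylor m k) c =
      ((c : ℂ) + 2 * k + 1) • bilocalTaylor m k (c - 1) +
        (k : ℂ) • bilocalTaylor m (k - 1) c := by
  have hr := regular_bilocal hm
  have hn := hr.locFin (c + k - 1)
  have h1 := hn.smul fun a => ((a : ℂ) + 1) * bc (a + 1) k
  have h2 := hn.smul fun a => ((c : ℂ) + k - a) * bc a k
  have h3 := h1.comp (f := fun a : ℤ => a + -1) (add_left_injective _)
  have e : ∀ a : ℤ, bc a k • (virasoro m 1 * bilocal m a (c + k - a) -
      bilocal m a (c + k - a) * virasoro m 1) =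
      ((((a + -1 : ℤ) : ℂ) + 1) * bc (a + -1 + 1) k) • bilocal m (a + -1) (c + k - 1 - (a + -1)) +
        (((c : ℂ) + k - a) * bc a k) • bilocal m a (c + k - 1 - a) := fun a => by
    rw [moebiusCovariant_bilocal hm 1 (Or.inr (Or.inr rfl)), smul_add, smul_smul, smul_smul,
      neg_add_cancel_right, show c + k - 1 - (a + -1) = c + k - a by ring,
      show c + k - a - 1 = c + k - 1 - a by ring, ← sub_eq_add_neg]
    congr 2 <;> push_cast <;> ring
  rw [bilocalTaylor, bracket_taylor hr, funext e, locSum_add h3 h2, locSum_shift h1 (-1),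
    ← locSum_add h1 h2]
  have h4 := hr.locFin_taylor k (c - 1)
  cases k with
  | zero =>
    rw [show ((0 : ℕ) : ℂ) = 0 from Nat.cast_zero, zero_smul, add_zero, add_zero,
      taylor_apply, ← locSum_smul h4]
    congr 1; funext a
    rw [bc_zero_right, bc_zero_right, one_smul, ← add_smul,
      show c - 1 + ((0 : ℕ) : ℤ) - a = c + ((0 : ℕ) : ℤ) - 1 - a by ring]
    congr 1; ring
  | succ k =>
    have h5 := hr.locFin_taylor k c
    rw [Nat.add_sub_cancel, bilocalTaylor, taylor_apply, taylor_apply, ← locSum_smul h4,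
      ← locSum_smul h5, ← locSum_add (h4.smul fun _ => _) (h5.smul fun _ => _)]
    congr 1; funext a
    rw [show c - 1 + ((k + 1 : ℕ) : ℤ) - a = c + k - a by push_cast; ring,
      show c + ((k + 1 : ℕ) : ℤ) - 1 - a = c + k - a by push_cast; ring, smul_smul, smul_smul,
      ← add_smul, ← add_smul, bc_succ_succ]
    congr 1
    have := succ_mul_bc' a k
    push_cast
    linear_combination -this

theorem factorial_mul_bc_succ (j : ℕ) (c : ℤ) :
    ((j + 1).factorial : ℂ) * bc (c + (j + 1 : ℕ)) (j + 1) =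
      ((c : ℂ) + j + 1) * ((j.factorial : ℂ) * bc (c + j) j) := by
  have := succ_mul_bc (c + (j + 1 : ℕ)) j
  rw [show c + ((j + 1 : ℕ) : ℤ) - 1 = c + j by push_cast; ring] at this
  rw [Nat.factorial_succ]
  push_cast at this ⊢
  linear_combination (j.factorial : ℂ) * this

theorem factorial_mul_bc_succ' (j : ℕ) (c : ℤ) :
    ((j + 1).factorial : ℂ) * bc (c + (j + 1 : ℕ)) (j + 1) =
      ((c : ℂ) + 1) * ((j.factorial : ℂ) * bc (c + 1 + j) j) := by
  have := succ_mul_bc' (c + (j + 1 : ℕ)) j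
  rw [show c + 1 + (j : ℤ) = c + ((j + 1 : ℕ) : ℤ) by push_cast; ring, Nat.factorial_succ]
  push_cast at this ⊢
  linear_combination (j.factorial : ℂ) * this

theorem bracket_iterate_deriv_apply (X : Module.End ℂ Fock) (j : ℕ) (A : Dist) (c : ℤ) :
    bracket X (deriv^[j] A) c = ((j.factorial : ℂ) * bc (c + j) j) • bracket X A (c + j) := by
  simp only [bracket, iterate_deriv_apply, mul_smul_comm, smul_mul_assoc, op_smul_sub]

theorem bracket_virasoro_neg_one_iterate_deriv {m : ℕ} (hm : m ≠ 0) (j k : ℕ) (c : ℤ) :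
    bracket (virasoro m (-1)) (deriv^[j] (bilocalTaylor m k)) c =
      ((c : ℂ) + 1) • deriv^[j] (bilocalTaylor m k) (c + 1) := by
  rw [bracket_iterate_deriv_apply, bracket_virasoro_neg_one_taylor hm, iterate_deriv_apply, deriv,
    smul_smul, smul_smul, show c + 1 + (j : ℤ) = c + j + 1 by ring]
  congr 1
  have h1 := factorial_mul_bc_succ j c
  have h2 := factorial_mul_bc_succ' j c
  rw [h1, show c + 1 + (j : ℤ) = c + j + 1 by ring] at h2
  push_cast
  linear_combination h2

theorem bracket_virasoro_zero_iterate_deriv {m : ℕ} (hm : m ≠ 0) (j k : ℕ) (c : ℤ) :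
    bracket (virasoro m 0) (deriv^[j] (bilocalTaylor m k)) c =
      ((c : ℂ) + j + k + 1) • deriv^[j] (bilocalTaylor m k) c := by
  rw [bracket_iterate_deriv_apply, bracket_virasoro_zero_taylor hm, iterate_deriv_apply,
    smul_smul, smul_smul]
  congr 1
  push_cast
  ring

theorem bracket_virasoro_one_iterate_deriv {m : ℕ} (hm : m ≠ 0) (j k : ℕ) (c : ℤ) :
    bracket (virasoro m 1) (deriv^[j] (bilocalTaylor m k)) c =
      ((c : ℂ) + 2 * (j + k) + 1) • deriv^[j] (bilocalTaylor m k) (c - 1) +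
        ((j : ℂ) * (2 * k + j + 1)) • deriv^[j - 1] (bilocalTaylor m k) c +
          (k : ℂ) • deriv^[j] (bilocalTaylor m (k - 1)) c := by
  rw [bracket_iterate_deriv_apply, bracket_virasoro_one_taylor hm, iterate_deriv_apply,
    iterate_deriv_apply, iterate_deriv_apply]
  cases j with
  | zero =>
    simp only [bc_zero_right, Nat.cast_zero, add_zero, zero_mul,
      zero_smul, Nat.factorial_zero, Nat.cast_one, one_mul, one_smul, zero_add]
  | succ j =>
    rw [Nat.add_sub_cancel, show c + ((j + 1 : ℕ) : ℤ) - 1 = c + j by push_cast; ring,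
      show c - 1 + ((j + 1 : ℕ) : ℤ) = c + j by push_cast; ring]
    have h1 := factorial_mul_bc_succ j c
    have h2 := factorial_mul_bc_succ' j (c - 1)
    rw [sub_add_cancel, show c - 1 + ((j + 1 : ℕ) : ℤ) = c + j by push_cast; ring] at h2
    rw [h1, h2, smul_add, smul_smul, smul_smul, smul_smul, smul_smul, smul_smul, ← add_smul]
    congr 2
    · push_cast; ring
    · ring

theorem quasiprimary_quasiField {m : ℕ} (hm : m ≠ 0) (l : ℕ) :
    Quasiprimary m (l + 1) (quasiField m l) := by
  intro n hn c
  change bracket (virasoro m n) (quasiField m l) c = _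
  rw [quasiField, bracket_smul, bracket_sum, Pi.smul_apply, Pi.smul_apply, smul_comm]
  congr 1
  simp only [bracket_smul, Finset.sum_apply, Pi.smul_apply]
  rw [Finset.smul_sum]
  rcases hn with rfl | rfl | rfl
  · refine Finset.sum_congr rfl fun k _ => ?_
    rw [bracket_virasoro_neg_one_iterate_deriv hm, smul_comm, sub_neg_eq_add]
    congr 1
    push_cast; ring
  · refine Finset.sum_congr rfl fun k hk => ?_
    rw [Finset.mem_range] at hk
    rw [bracket_virasoro_zero_iterate_deriv hm, smul_comm, sub_zero]
    congr 1
    push_cast [Nat.cast_sub (show k ≤ l by omega)]; ring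
  -- Beyond the required multiple of V^l, the commutator with L_1 leaves u k from lowering the
  -- Taylor index and -u (k-1) from lowering the order of the derivative. These cancel in the sum
  -- because (k+1)(l choose k+1) = (l-k)(l choose k), and u l = 0.
  · set u : ℕ → Module.End ℂ Fock := fun k => ((-1) ^ k * ((l.choose k : ℂ) * ((l : ℂ) - k)) *
      ((2 * l - k).factorial : ℂ)) • deriv^[k] (bilocalTaylor m (l - 1 - k)) c with hu
    have h : ∀ k ∈ range (l + 1), ((-1) ^ k * (l.choose k : ℂ) * ((2 * l - k).factorial : ℂ)) •
        bracket (virasoro m 1) (deriv^[k] (bilocalTaylor m (l - k))) c =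
        (((c - 1 : ℤ) : ℂ) + (((1 : ℤ) : ℂ) + 1) * ((l + 1 : ℕ) : ℂ)) •
          (((-1) ^ k * (l.choose k : ℂ) * ((2 * l - k).factorial : ℂ)) •
            deriv^[k] (bilocalTaylor m (l - k)) (c - 1)) +
          (u k + if k = 0 then 0 else (-1 : ℂ) • u (k - 1)) := fun k hk => by
      rw [Finset.mem_range] at hk
      have e2 : ((l - k : ℕ) : ℂ) = (l : ℂ) - k := Nat.cast_sub (by omega)
      rw [bracket_virasoro_one_iterate_deriv hm, smul_add, smul_add, add_assoc]
      congr 1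
      · rw [smul_comm]
        congr 1
        push_cast; rw [e2]; ring
      · rw [add_comm]
        congr 1
        · rw [hu, smul_smul, e2, show l - k - 1 = l - 1 - k by omega]
          congr 1; ring
        · cases k with
          | zero => simp
          | succ k =>
            rw [if_neg (by omega), hu, Nat.add_sub_cancel]
            simp only []
            rw [show l - (k + 1) = l - 1 - k by omega, smul_smul, smul_smul,
              show 2 * l - k = (2 * l - (k + 1)) + 1 by omega, Nat.factorial_succ]
            congr 1
            have h1 : (l.choose (k + 1) : ℂ) * ((k : ℂ) + 1) = l.choose k * ((l : ℂ) - k) := by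
              have := congrArg (Nat.cast : ℕ → ℂ) (Nat.choose_succ_right_eq l k)
              rw [Nat.cast_mul, Nat.cast_mul, Nat.cast_sub (by omega)] at this
              exact_mod_cast this
            rw [← h1]
            push_cast [Nat.cast_sub (show k + 1 ≤ 2 * l by omega),
              show ((l - 1 - k : ℕ) : ℂ) = (l : ℂ) - (k + 1) by
                rw [show l - 1 - k = l - (k + 1) by omega, Nat.cast_sub (by omega)]; push_cast; ring]
            ring
    rw [Finset.sum_congr rfl h, Finset.sum_add_distrib]
    convert add_zero _
    rw [Finset.sum_add_distrib, Finset.sum_range_succ u, Finset.sum_range_succ']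
    simp only [if_pos, if_neg (Nat.succ_ne_zero _), Nat.add_sub_cancel, add_zero]
    rw [← Finset.smul_sum, show u l = 0 by rw [hu]; simp, add_zero]
    module

/-- The local field `V^l(z,m)` as a vertex operator. -/
def quasiVertexOperator (m l : ℕ) (hm : m ≠ 0) : VertexOperator ℂ Fock :=
  VertexOperator.of_coeff (quasiField m l) fun v => by
    obtain ⟨N, hN⟩ := isField_quasiField hm l v
    refine ⟨N, fun a ha => ?_⟩
    by_contra h
    exact ha (hN a (by omega))

theorem coeff_quasiVertexOperator (m l : ℕ) (hm : m ≠ 0) :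
    (quasiVertexOperator m l hm).coeff = quasiField m l := rfl

/-! ### Distributions annihilated by a power of `z₁₂` -/

/-- The distribution is annihilated by some power of `z₁₂`. -/
def LocalDist (D : BiDist) : Prop := ∃ N : ℕ, mulZ12^[N] D = 0

theorem mulZ12_add (D D' : BiDist) : mulZ12 (D + D') = mulZ12 D + mulZ12 D' := by
  funext a b
  simp only [mulZ12, Pi.add_apply]
  abel

theorem mulZ12_smul (r : ℂ) (D : BiDist) : mulZ12 (r • D) = r • mulZ12 D := by
  funext a b
  simp only [mulZ12, Pi.smul_apply, op_smul_sub]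

theorem mulZ12_zero : mulZ12 0 = 0 := by
  funext a b
  exact op_sub_self 0

theorem iterate_mulZ12_add (N : ℕ) (D D' : BiDist) :
    mulZ12^[N] (D + D') = mulZ12^[N] D + mulZ12^[N] D' := by
  induction N generalizing D D' with
  | zero => rfl
  | succ N ih =>
    rw [Function.iterate_succ_apply, Function.iterate_succ_apply, Function.iterate_succ_apply,
      mulZ12_add, ih]

theorem iterate_mulZ12_smul (N : ℕ) (r : ℂ) (D : BiDist) :
    mulZ12^[N] (r • D) = r • mulZ12^[N] D := by
  induction N generalizing D with
  | zero => rfl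
  | succ N ih =>
    rw [Function.iterate_succ_apply, Function.iterate_succ_apply, mulZ12_smul, ih]

theorem iterate_mulZ12_zero (N : ℕ) : mulZ12^[N] 0 = 0 := Function.iterate_fixed mulZ12_zero N

theorem localDist_zero : LocalDist 0 := ⟨0, rfl⟩

theorem LocalDist.add {D D' : BiDist} (h : LocalDist D) (h' : LocalDist D') :
    LocalDist (D + D') := by
  obtain ⟨N, hN⟩ := h
  obtain ⟨M, hM⟩ := h'
  refine ⟨N + M, ?_⟩
  rw [iterate_mulZ12_add, add_comm N M, Function.iterate_add_apply, hN, iterate_mulZ12_zero,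
    add_comm M N, Function.iterate_add_apply, hM, iterate_mulZ12_zero, add_zero]

theorem LocalDist.smul {D : BiDist} (h : LocalDist D) (r : ℂ) : LocalDist (r • D) := by
  obtain ⟨N, hN⟩ := h
  exact ⟨N, by rw [iterate_mulZ12_smul, hN, smul_zero]⟩

theorem LocalDist.sum {J : Type*} {D : J → BiDist} (s : Finset J)
    (h : ∀ j ∈ s, LocalDist (D j)) : LocalDist (∑ j ∈ s, D j) :=
  Finset.sum_induction _ LocalDist (fun _ _ => LocalDist.add) localDist_zero h

theorem LocalDist.of_mulZ12 {D : BiDist} (h : LocalDist (mulZ12 D)) : LocalDist D := by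
  obtain ⟨N, hN⟩ := h
  exact ⟨N + 1, hN⟩

theorem LocalDist.shift {D : BiDist} (h : LocalDist D) (n k : ℤ) :
    LocalDist fun a b => D (a + n) (b + k) := by
  obtain ⟨N, hN⟩ := h
  have key : ∀ (N : ℕ) (D : BiDist), mulZ12^[N] (fun a b => D (a + n) (b + k)) =
      fun a b => mulZ12^[N] D (a + n) (b + k) := by
    intro N
    induction N with
    | zero => intro D; rfl
    | succ N ih =>
      intro D
      rw [Function.iterate_succ_apply, Function.iterate_succ_apply, ← ih]
      congr 1
      funext a b
      simp only [mulZ12, show a - 1 + n = a + n - 1 by ring, show b - 1 + k = b + k - 1 by ring]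
  exact ⟨N, by rw [key, hN]; rfl⟩

theorem LocalDist.deriv₁ {D : BiDist} (h : LocalDist D) : LocalDist (deriv₁ D) := by
  obtain ⟨N, hN⟩ := h
  induction N generalizing D with
  | zero =>
    rw [Function.iterate_zero, id_eq] at hN
    refine ⟨0, ?_⟩
    rw [hN]
    funext a b
    exact smul_zero _
  | succ N ih =>
    refine LocalDist.of_mulZ12 ?_
    -- Commuting z₁₂ past ∂₁ costs one copy of D, which is killed by the same power; the induction
    -- is on that power.
    have e : mulZ12 (Bilocal.deriv₁ D) = Bilocal.deriv₁ (mulZ12 D) + (-1 : ℂ) • D := by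
      funext a b
      simp only [mulZ12, Bilocal.deriv₁, Pi.add_apply, Pi.smul_apply, sub_add_cancel,
        add_sub_cancel_right]
      push_cast
      module
    rw [e]
    exact (ih hN).add (LocalDist.smul ⟨N + 1, hN⟩ _)

theorem LocalDist.deriv₂ {D : BiDist} (h : LocalDist D) : LocalDist (deriv₂ D) := by
  obtain ⟨N, hN⟩ := h
  induction N generalizing D with
  | zero =>
    rw [Function.iterate_zero, id_eq] at hN
    refine ⟨0, ?_⟩
    rw [hN]
    funext a b
    exact smul_zero _
  | succ N ih =>
    refine LocalDist.of_mulZ12 ?_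
    have e : mulZ12 (Bilocal.deriv₂ D) = Bilocal.deriv₂ (mulZ12 D) + (1 : ℂ) • D := by
      funext a b
      simp only [mulZ12, Bilocal.deriv₂, Pi.add_apply, Pi.smul_apply, sub_add_cancel,
        add_sub_cancel_right]
      push_cast
      module
    rw [e]
    exact (ih hN).add (LocalDist.smul ⟨N + 1, hN⟩ _)

/-! ### Locality -/

/-- The commutator `[B(z₂), A(z₁)]`. -/
def commDist (A B : Dist) : BiDist := fun a b => bracket (B b) A a

theorem mutuallyLocal_of_localDist {A B : Dist} (h : LocalDist (commDist A B)) :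
    MutuallyLocal A B := by
  obtain ⟨N, hN⟩ := h.smul (-1)
  refine ⟨N, ?_⟩
  rw [← hN]
  congr 1
  funext a b
  rw [Pi.smul_apply, Pi.smul_apply, commDist, bracket]
  module

theorem localDist_comm_smul_left {A B : Dist} (h : LocalDist (commDist A B)) (r : ℂ) :
    LocalDist (commDist (r • A) B) := by
  have e : commDist (r • A) B = r • commDist A B := by
    funext a b
    simp only [commDist, bracket_smul, Pi.smul_apply]
  rw [e]
  exact h.smul r

theorem localDist_comm_smul_right {A B : Dist} (h : LocalDist (commDist A B)) (r : ℂ) :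
    LocalDist (commDist A (r • B)) := by
  have e : commDist A (r • B) = r • commDist A B := by
    funext a b
    simp only [commDist, bracket, Pi.smul_apply, smul_mul_assoc, mul_smul_comm, op_smul_sub]
  rw [e]
  exact h.smul r

theorem localDist_comm_sum_left {J : Type*} {A : J → Dist} {B : Dist} (s : Finset J)
    (h : ∀ j ∈ s, LocalDist (commDist (A j) B)) : LocalDist (commDist (∑ j ∈ s, A j) B) := by
  have e : commDist (∑ j ∈ s, A j) B = ∑ j ∈ s, commDist (A j) B := by
    funext a b
    simp only [commDist, bracket_sum, Finset.sum_apply]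
  rw [e]
  exact LocalDist.sum s h

theorem localDist_comm_sum_right {J : Type*} {A : Dist} {B : J → Dist} (s : Finset J)
    (h : ∀ j ∈ s, LocalDist (commDist A (B j))) : LocalDist (commDist A (∑ j ∈ s, B j)) := by
  classical
  have e : commDist A (∑ j ∈ s, B j) = ∑ j ∈ s, commDist A (B j) := by
    clear h
    induction s using Finset.induction_on with
    | empty => funext a b; simp [commDist, bracket, op_sub_self]
    | insert j s hj ih =>
      rw [Finset.sum_insert hj, Finset.sum_insert hj, ← ih]
      funext a b
      simp only [commDist, bracket, Pi.add_apply, add_mul, mul_add]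
      abel
  rw [e]
  exact LocalDist.sum s h

theorem localDist_comm_iterate_deriv_left {A B : Dist} (h : LocalDist (commDist A B)) (k : ℕ) :
    LocalDist (commDist (deriv^[k] A) B) := by
  induction k with
  | zero => exact h
  | succ k ih =>
    rw [Function.iterate_succ_apply']
    convert ih.deriv₁ using 1
    funext a b
    simp only [commDist, bracket, deriv, Bilocal.deriv₁, smul_mul_assoc, mul_smul_comm, op_smul_sub]

theorem localDist_comm_iterate_deriv_right {A B : Dist} (h : LocalDist (commDist A B)) (k : ℕ) :
    LocalDist (commDist A (deriv^[k] B)) := by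
  induction k with
  | zero => exact h
  | succ k ih =>
    rw [Function.iterate_succ_apply']
    convert ih.deriv₂ using 1
    funext a b
    simp only [commDist, bracket, deriv, Bilocal.deriv₂, smul_mul_assoc, mul_smul_comm, op_smul_sub]

/-- Shifts of the exponent a pass through the second slot of the normal product, so powers of z₁₂
act directly on the commutator inside it. -/
theorem localDist_nprod_right {A B : Dist} {G : Dist} (hA : IsField A) (hB : IsField B)
    (h : LocalDist (commDist B G)) :
    LocalDist fun a b => nprod A (bracket (G b) B) a := by
  obtain ⟨N, hN⟩ := h
  have key : ∀ (N : ℕ) (D : BiDist), (∀ b, IsField fun a => D a b) →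
      mulZ12^[N] (fun a b => nprod A (fun a => D a b) a) =
        fun a b => nprod A (fun a => mulZ12^[N] D a b) a := by
    intro N
    induction N with
    | zero => intro D _; rfl
    | succ N ih =>
      intro D hD
      have hD1 : ∀ b, IsField fun a => D (a - 1) b := fun b => (hD b).shift (-1)
      have hD2 : ∀ b, IsField fun a => mulZ12 D a b := fun b => (hD1 b).sub (hD (b - 1))
      rw [Function.iterate_succ_apply, Function.iterate_succ_apply, ← ih _ hD2]
      congr 1
      funext a b
      have h1 := congrFun (nprod_sub_right hA (hD1 b) (hD (b - 1))) a
      rw [Pi.sub_apply, show nprod A (fun a => D (a - 1) b) a = nprod A (fun a => D a b) (a - 1)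
        from nprod_shift A (fun a => D a b) a (-1)] at h1
      rw [mulZ12, ← h1]
      rfl
  refine ⟨N, ?_⟩
  have h1 := key N (commDist B G) fun b => hB.bracket (G b)
  rw [hN] at h1
  refine Eq.trans h1 ?_
  funext a b
  exact congrFun (nprod_zero_right A) a

/-- Multiplication by z₁₂ replaces κ by its backward difference. The two shifted products place the
boundary between creation and annihilation half one step apart; the single mode j = 0 is ordered
differently and leaves a commutator. -/
theorem mulZ12_nprod_shift {B G : Dist} (hB : IsField B) (hG : IsField G) (κ : ℤ → ℂ) (a b : ℤ) :
    mulZ12 (fun a b => nprod (fun j => κ j • G (b + j + 1)) B a) a b =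
      nprod (fun j => (κ (j - 1) - κ j) • G (b + j)) B a + (-κ (-1)) • commDist B G a b := by
  have f1 : IsField fun j => κ j • G (b + j + 1) := by
    have := (hG.shift (b + 1)).smul_fun κ
    simpa only [show ∀ j : ℤ, j + (b + 1) = b + j + 1 by intro j; ring] using this
  have f2 : IsField fun j => κ j • G (b - 1 + j + 1) := by
    have := (hG.shift b).smul_fun κ
    simpa only [show ∀ j : ℤ, b - 1 + j + 1 = j + b by intro j; ring] using this
  have f3 : IsField fun j => (κ (j - 1) - κ j) • G (b + j) := by
    have := (hG.shift b).smul_fun fun j => κ (j - 1) - κ j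
    simpa only [show ∀ j : ℤ, j + b = b + j by intro j; ring] using this
  set c : ℤ → Module.End ℂ Fock := fun j => if j = 0 then (-κ (-1)) • commDist B G a b else 0
    with hc
  have l1 := locFin_nprodTerm f1 hB (a - 1)
  have l2 := locFin_nprodTerm f2 hB a
  have l3 := locFin_nprodTerm f3 hB a
  have hc0 : ∀ j, j ≠ 0 → c j = 0 := fun j hj => by rw [hc]; simp only [if_neg hj]
  have l4 : LocFin c := .of_finite ((Set.finite_singleton 0).subset fun j hj => by
    by_contra h'
    exact hj (hc0 j h'))
  have l5 := l1.comp (f := fun j : ℤ => j + -1) (add_left_injective _)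
  rw [mulZ12, nprod_apply, nprod_apply, nprod_apply, ← locSum_shift l1 (-1), ← locSum_sub l5 l2,
    show (-κ (-1)) • commDist B G a b = c 0 by rw [hc]; simp, ← locSum_eq_single 0 hc0,
    ← locSum_add l3 l4]
  congr 1
  funext j
  unfold nprodTerm
  beta_reduce
  rw [show b + (j + -1) + 1 = b + j by ring, show a - 1 - (j + -1) = a - j by ring,
    show b - 1 + j + 1 = b + j by ring, ← sub_eq_add_neg]
  rcases lt_trichotomy j 0 with h | h | h
  · rw [if_neg (by omega), if_neg (by omega), if_neg (by omega), hc0 j h.ne, add_zero]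
    simp only [mul_smul_comm]
    module
  · subst h
    rw [if_neg (by omega), if_pos le_rfl, if_pos le_rfl, hc]
    simp only [if_pos, commDist, bracket, add_zero, sub_zero, mul_smul_comm, smul_mul_assoc, zero_sub]
    module
  · rw [if_pos (by omega), if_pos (by omega), if_pos (by omega), hc0 j h.ne', add_zero]
    simp only [smul_mul_assoc]
    module

/-- The weight is a polynomial of degree k in the mode index. Each factor z₁₂ lowers the degree and
adds a multiple of the commutator; the weight is gone after k + 1 factors, so only local terms
remain. -/
theorem localDist_nprod_left {B G : Dist} (hB : IsField B) (hG : IsField G)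
    (h : LocalDist (commDist B G)) (k : ℕ) (u : ℤ) :
    LocalDist fun a b => nprod (fun j => bc (j + u) k • G (b + j + 1)) B a := by
  induction k generalizing u with
  | zero =>
    refine LocalDist.of_mulZ12 ?_
    have e : mulZ12 (fun a b => nprod (fun j => bc (j + u) 0 • G (b + j + 1)) B a) =
        (-1 : ℂ) • commDist B G := by
      funext a b
      rw [mulZ12_nprod_shift hB hG fun j => bc (j + u) 0]
      simp only [bc_zero_right, sub_self, zero_smul]
      rw [show (fun _ : ℤ => (0 : Module.End ℂ Fock)) = 0 from rfl, nprod_zero_left, Pi.zero_apply,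
        zero_add]
      rfl
    rw [e]
    exact h.smul _
  | succ k ih =>
    refine LocalDist.of_mulZ12 ?_
    have e : mulZ12 (fun a b => nprod (fun j => bc (j + u) (k + 1) • G (b + j + 1)) B a) =
        (-1 : ℂ) • (fun a b => nprod (fun j => bc (j + (u - 1)) k • G (b + -1 + j + 1)) B (a + 0)) +
          (-bc (-1 + u) (k + 1)) • commDist B G := by
      funext a b
      rw [mulZ12_nprod_shift hB hG fun j => bc (j + u) (k + 1)]
      have f : IsField fun j => bc (j + (u - 1)) k • G (b + -1 + j + 1) := by
        have := (hG.shift b).smul_fun fun j => bc (j + (u - 1)) k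
        simpa only [show ∀ j : ℤ, j + b = b + -1 + j + 1 by intro j; ring] using this
      have h1 := congrFun (nprod_smul_left f hB (-1)) (a + 0)
      rw [Pi.smul_apply] at h1
      rw [Pi.add_apply, Pi.add_apply, Pi.smul_apply, Pi.smul_apply, Pi.smul_apply, Pi.smul_apply,
        ← h1, add_zero]
      congr 3
      funext j
      rw [Pi.smul_apply, smul_smul, show b + -1 + j + 1 = b + j by ring]
      congr 1
      have := bc_succ_succ (j - 1 + u) k
      rw [show j - 1 + u + 1 = j + u by ring] at this
      rw [this, show j + (u - 1) = j - 1 + u by ring]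
      ring
    rw [e]
    exact (((ih (u - 1)).shift 0 (-1)).smul _).add (h.smul _)

/-- Commuting with H_n multiplies E by m(z₁ⁿ - z₂ⁿ). Expanded in z₁₂ this has no constant term, so
only Taylor coefficients of lower index occur, finitely many even for negative n. -/
theorem bracket_heis_expTaylor {m : ℕ} (hm : m ≠ 0) (n : ℤ) (M : ℕ) (c : ℤ) :
    bracket (heis m n) (expTaylor m M) c =
      ∑ s ∈ range M, ((m : ℂ) * bc n (s + 1)) • expTaylor m (M - (s + 1)) (c - n + (s + 1)) := by
  have hr := regular_expField hm
  have hn := hr.locFin (c - n + M)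
  have h0 := hn.smul fun a => (m : ℂ) * bc (a + n) M
  have h1 := h0.comp (f := fun a : ℤ => a + -n) (add_left_injective _)
  have h2 := hn.smul fun a => (m : ℂ) * bc a M
  have e : ∀ a : ℤ, bc a M • (heis m n * expField m a (c + M - a) -
      expField m a (c + M - a) * heis m n) =
      ((m : ℂ) * bc (a + -n + n) M) • expField m (a + -n) (c - n + M - (a + -n)) -
        ((m : ℂ) * bc a M) • expField m a (c - n + M - a) := fun a => by
    rw [heisCovariant_expField, neg_add_cancel_right, ← sub_eq_add_neg,
      show c - n + M - (a - n) = c + M - a by ring, show c + M - a - n = c - n + M - a by ring,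
      smul_smul, op_smul_sub, mul_comm]
  have h3 : ∀ s ∈ range M, ((m : ℂ) * bc n (s + 1)) •
      expTaylor m (M - (s + 1)) (c - n + (s + 1)) = locSum fun a : ℤ =>
        ((m : ℂ) * bc n (s + 1) * bc a (M - (s + 1))) • expField m a (c - n + M - a) := fun s hs => by
    rw [Finset.mem_range] at hs
    rw [expTaylor, taylor_apply, ← locSum_smul (hr.locFin_taylor _ _)]
    congr 1; funext a
    rw [smul_smul, show c - n + ((s : ℤ) + 1) + ((M - (s + 1) : ℕ) : ℤ) - a = c - n + M - a by
      rw [Nat.cast_sub (by omega)]; push_cast; ring]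
  rw [expTaylor, bracket_taylor hr, funext e, locSum_sub h1 h2, locSum_shift h0 (-n),
    ← locSum_sub h0 h2, Finset.sum_congr rfl h3,
    ← locSum_finsetSum _ fun s _ => hn.smul fun a => (m : ℂ) * bc n (s + 1) * bc a (M - (s + 1))]
  congr 1; funext a
  rw [← Finset.sum_smul, add_comm a n, bc_add, Finset.sum_range_succ', bc_zero_right, one_mul,
    Nat.sub_zero, mul_add, Finset.mul_sum]
  simp only [mul_assoc]
  module

theorem bc_neg (x : ℤ) (s : ℕ) : bc (-x - 1) s = (-1) ^ s * bc (x + s) s := by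
  have := Ring.choose_neg (x + 1) s
  rw [show -(x + 1) = -x - 1 by ring, show x + 1 + (s : ℤ) - 1 = x + s by ring] at this
  rw [bc, this, bc]
  rw [Units.smul_def, zsmul_eq_mul, Int.cast_mul, Int.cast_id, Int.coe_negOnePow_natCast]
  push_cast
  rfl

/-- Merges the binomial of ∂^i H/i! with that of `bracket_heis_expTaylor` into one binomial in the
mode index, the form required by `localDist_nprod_left`. -/
theorem bc_mul_bc_neg (x : ℤ) (i s : ℕ) :
    bc x i * bc (-x - 1) s = (-1) ^ s * ((i + s).choose s : ℂ) * bc (x + s) (i + s) := by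
  have h := congrArg (Int.cast : ℤ → ℂ) (Ring.choose_add_smul_choose x i s)
  rw [nsmul_eq_mul] at h
  push_cast at h
  rw [bc_neg, bc, bc, bc, mul_assoc ((-1) ^ s), h]
  ring

/-- Dong's lemma for a product with a derivative of H. The Leibniz rule gives one term with the
commutator on H, a finite combination of normal products of lower coefficients with B, and one with
the commutator on B. Locality of B with all coefficients is assumed because the first term involves
the lower ones. -/
theorem localDist_comm_nprod {m : ℕ} (hm : m ≠ 0) {B : Dist} (hB : IsField B)
    (h : ∀ M, LocalDist (commDist B (expTaylor m M))) (i M : ℕ) :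
    LocalDist (commDist (nprod (divDeriv i (current m)) B) (expTaylor m M)) := by
  have hA := (isField_current m).divDeriv i
  have hF := isField_expTaylor hm
  have hs : ∀ (s : ℕ) (b : ℤ), IsField fun j : ℤ => bc (j + (i + s + 1 : ℕ)) (i + s + 1) •
      expTaylor m (M - (s + 1)) (b + j + 1 + (i + s + 1 : ℕ)) := fun s b => by
    have := ((hF (M - (s + 1))).shift (b + 1 + (i + s + 1 : ℕ))).smul_fun
      fun j => bc (j + (i + s + 1 : ℕ)) (i + s + 1)
    simpa only [show ∀ j : ℤ, j + (b + 1 + (i + s + 1 : ℕ)) = b + j + 1 + (i + s + 1 : ℕ) by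
      intro j; ring] using this
  have e : commDist (nprod (divDeriv i (current m)) B) (expTaylor m M) =
      (∑ s ∈ range M, (-((m : ℂ) * ((-1) ^ (s + 1) * ((i + (s + 1)).choose (s + 1) : ℂ)))) •
        fun a b => nprod (fun j => bc (j + (i + s + 1 : ℕ)) (i + s + 1) •
          expTaylor m (M - (s + 1)) (b + j + 1 + (i + s + 1 : ℕ))) B a) +
      fun a b => nprod (divDeriv i (current m)) (bracket (expTaylor m M b) B) a := by
    funext a b
    rw [commDist, bracket_nprod hA hB, Pi.add_apply, Pi.add_apply, Pi.add_apply]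
    congr 1
    simp only [Finset.sum_apply, Pi.smul_apply]
    have h1 : bracket (expTaylor m M b) (divDeriv i (current m)) =
        ∑ s ∈ range M, (-((m : ℂ) * ((-1) ^ (s + 1) * ((i + (s + 1)).choose (s + 1) : ℂ)))) •
          fun j : ℤ => bc (j + (i + s + 1 : ℕ)) (i + s + 1) •
            expTaylor m (M - (s + 1)) (b + j + 1 + (i + s + 1 : ℕ)) := by
      funext j
      have h2 := bracket_heis_expTaylor hm (-(j + i) - 1) M b
      have h3 : bracket (expTaylor m M b) (divDeriv i (current m)) j = (-bc (j + i) i) •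
          bracket (heis m (-(j + i) - 1)) (expTaylor m M) b := by
        rw [bracket, bracket, divDeriv_apply, current, mul_smul_comm, smul_mul_assoc]
        module
      rw [h3, h2, Finset.smul_sum, Finset.sum_apply]
      refine Finset.sum_congr rfl fun s _ => ?_
      rw [Pi.smul_apply, smul_smul, smul_smul,
        show b - (-(j + i) - 1) + ((s : ℤ) + 1) = b + j + 1 + (i + s + 1 : ℕ) by push_cast; ring]
      congr 1
      have h4 := bc_mul_bc_neg (j + i) i (s + 1)
      rw [show j + i + ((s + 1 : ℕ) : ℤ) = j + (i + s + 1 : ℕ) by push_cast; ring,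
        ← add_assoc] at h4
      rw [← add_assoc]
      linear_combination (-(m : ℂ)) * h4
    rw [h1, nprod_sum_left _ (fun s _ => (hs s b).smul _) hB, Finset.sum_apply]
    refine Finset.sum_congr rfl fun s _ => ?_
    rw [nprod_smul_left (hs s b) hB, Pi.smul_apply]
  rw [e]
  refine (LocalDist.sum _ fun s _ => LocalDist.smul ?_ _).add (localDist_nprod_right hA hB (h M))
  have h5 := localDist_nprod_left hB ((hF (M - (s + 1))).shift (i + s + 1 : ℕ)) (h := by
    have := (h (M - (s + 1))).shift 0 (i + s + 1 : ℕ)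
    simp only [add_zero] at this
    exact this) (i + s + 1) (i + s + 1 : ℕ)
  exact h5

/-- Induction along the recursion for the first factor, with the second index left free; it starts
from the unit field. -/
theorem localDist_comm_expTaylor {m : ℕ} (hm : m ≠ 0) (N M : ℕ) :
    LocalDist (commDist (expTaylor m N) (expTaylor m M)) := by
  induction N using Nat.strong_induction_on generalizing M with
  | _ N ih =>
    cases N with
    | zero =>
      rw [expTaylor_zero hm]
      refine ⟨0, ?_⟩
      funext a b
      rw [Function.iterate_zero, id_eq, commDist, bracket, one]
      split_ifs
      · rw [mul_one, one_mul, op_sub_self]; rfl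
      · rw [mul_zero, zero_mul, op_sub_self]; rfl
    | succ N =>
      have hN : (N : ℂ) + 1 ≠ 0 := by exact_mod_cast Nat.succ_ne_zero N
      have h1 : expTaylor m (N + 1) = ((N : ℂ) + 1)⁻¹ •
          ∑ i ∈ range (N + 1), nprod (divDeriv i (current m)) (expTaylor m (N - i)) := by
        rw [← expTaylor_succ hm, smul_smul, inv_mul_cancel₀ hN, one_smul]
      rw [h1]
      exact localDist_comm_smul_left (localDist_comm_sum_left _ fun i _ =>
        localDist_comm_nprod hm (isField_expTaylor hm _) (fun M => ih (N - i) (by omega) M) i M) _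

theorem mutuallyLocal_quasiField {m : ℕ} (hm : m ≠ 0) (l l' : ℕ) :
    MutuallyLocal (quasiField m l) (quasiField m l') := by
  refine mutuallyLocal_of_localDist ?_
  refine localDist_comm_smul_left (localDist_comm_sum_left _ fun k _ =>
    localDist_comm_smul_left (localDist_comm_iterate_deriv_left ?_ k) _) _
  refine localDist_comm_smul_right (localDist_comm_sum_right _ fun k' _ =>
    localDist_comm_smul_right (localDist_comm_iterate_deriv_right ?_ k') _) _
  rw [bilocalTaylor_eq hm, bilocalTaylor_eq hm]
  exact localDist_comm_expTaylor hm _ _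

/-! ### Vacuum expectation values -/

/-- The dual vacuum vector `⟨0|`. -/
def covacuum : Fock →ₗ[ℂ] ℂ := MvPolynomial.lcoeff ℂ 0 ∘ₗ Finsupp.lapply 0

theorem covacuum_apply (v : Fock) : covacuum v = MvPolynomial.coeff 0 (v 0) := rfl

theorem vev_eq (A : Module.End ℂ Fock) : vev A = covacuum (A vacuum) := rfl

theorem vev_mul (A B : Module.End ℂ Fock) : vev (A * B) = covacuum (A (B vacuum)) := rfl

theorem vev_smul (c : ℂ) (A : Module.End ℂ Fock) : vev (c • A) = c * vev A := by
  rw [vev_eq, LinearMap.smul_apply, map_smul, smul_eq_mul, vev_eq]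

theorem vev_add (A B : Module.End ℂ Fock) : vev (A + B) = vev A + vev B := by
  rw [vev_eq, LinearMap.add_apply, map_add, vev_eq, vev_eq]

theorem vev_sum {J : Type*} (s : Finset J) (A : J → Module.End ℂ Fock) :
    vev (∑ j ∈ s, A j) = ∑ j ∈ s, vev (A j) := by
  rw [vev_eq, LinearMap.sum_apply, map_sum]; rfl

theorem covacuum_single (q : MvPolynomial ℕ ℂ) :
    covacuum (Finsupp.single 0 q) = MvPolynomial.coeff 0 q := by
  rw [covacuum_apply, Finsupp.single_eq_same]

theorem covacuum_single_ne {k : ℤ} (hk : k ≠ 0) (q : MvPolynomial ℕ ℂ) :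
    covacuum (Finsupp.single k q) = 0 := by
  rw [covacuum_apply, Finsupp.single_eq_of_ne hk.symm, coeff_zero]

theorem heis_neg_apply (m p : ℕ) (k : ℤ) (v : Fock) :
    heis m (-((p : ℤ) + 1)) v k = X p * v k := by
  induction v using Finsupp.induction_linear with
  | zero => simp
  | add v w hv hw => rw [map_add, Finsupp.add_apply, hv, hw, Finsupp.add_apply, mul_add]
  | single l q =>
    rw [heis_neg_single]
    by_cases h : l = k
    · subst h; simp
    · rw [Finsupp.single_eq_of_ne (Ne.symm h), Finsupp.single_eq_of_ne (Ne.symm h), mul_zero]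

theorem covacuum_heis_neg (m p : ℕ) (v : Fock) : covacuum (heis m (-((p : ℤ) + 1)) v) = 0 := by
  rw [covacuum_apply, heis_neg_apply, ← constantCoeff_eq, map_mul, constantCoeff_X, zero_mul]

theorem covacuum_heis_zero (m : ℕ) (v : Fock) : covacuum (heis m 0 v) = 0 := by
  induction v using Finsupp.induction_linear with
  | zero => simp
  | add v w hv hw => rw [map_add, map_add, hv, hw, add_zero]
  | single l q =>
    rw [heis_zero_single]
    by_cases h : l = 0
    · subst h; simp
    · rw [map_smul, covacuum_single_ne h, smul_zero]

/-- A creation operator moved through L_n leaves a multiple of H_{n-p-1} with n - p - 1 ≤ 0, and the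
dual vacuum kills H_j for all j ≤ 0. -/
theorem covacuum_virasoro {m : ℕ} (hm : m ≠ 0) {n : ℤ} (hn : n = -1 ∨ n = 0 ∨ n = 1) (v : Fock) :
    covacuum (virasoro m n v) = 0 := by
  refine fock_induction m (P := fun v => covacuum (virasoro m n v) = 0) (fun k => ?_) ?_ ?_ ?_ v
  · obtain ⟨h1, h2, h3⟩ := virasoro_vac hm k
    by_cases hk : k = 0
    · subst hk
      rcases hn with rfl | rfl | rfl
      · rw [h1, Int.cast_zero, zero_smul, map_zero]
      · rw [h2, Int.cast_zero]; simp
      · rw [h3, map_zero]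
    · rcases hn with rfl | rfl | rfl
      · rw [h1, map_smul, covacuum_single_ne hk, smul_zero]
      · rw [h2, map_smul, covacuum_single_ne hk, smul_zero]
      · rw [h3, map_zero]
  · intro v w hv hw; rw [map_add, map_add, hv, hw, add_zero]
  · intro c v hv; rw [map_smul, map_smul, hv, smul_zero]
  · intro p v _
    rw [virasoro_heis_neg hm, map_add, covacuum_heis_neg, zero_add, map_smul]
    by_cases hp : n = p + 1
    · rw [hp, sub_self, covacuum_heis_zero, smul_zero]
    · obtain ⟨r, hr⟩ : ∃ r : ℕ, n - (p + 1) = -((r : ℤ) + 1) := ⟨(p - n).toNat, by omega⟩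
      rw [hr, covacuum_heis_neg, smul_zero]

theorem virasoro_vacuum {m : ℕ} (hm : m ≠ 0) {n : ℤ} (hn : n = -1 ∨ n = 0 ∨ n = 1) :
    virasoro m n vacuum = 0 := by
  obtain ⟨h1, h2, h3⟩ := virasoro_vac hm 0
  rw [vacuum]
  rcases hn with rfl | rfl | rfl
  · rw [h1, Int.cast_zero, zero_smul]
  · rw [h2, Int.cast_zero]; simp
  · exact h3

/-- The Ward identity of the Möbius generators. -/
theorem vev_ward {m : ℕ} (hm : m ≠ 0) {n : ℤ} (hn : n = -1 ∨ n = 0 ∨ n = 1)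
    (A B : Module.End ℂ Fock) :
    vev ((virasoro m n * A - A * virasoro m n) * B) +
      vev (A * (virasoro m n * B - B * virasoro m n)) = 0 := by
  rw [← vev_add, op_sub_mul, op_mul_sub, vev_eq]
  simp only [LinearMap.add_apply, LinearMap.sub_apply, Module.End.mul_apply, virasoro_vacuum hm hn,
    map_zero, map_add, map_sub, covacuum_virasoro hm hn]
  abel

theorem coeff_zero_creation (ε : ℤ) {n : ℤ} (hn : n ≠ 0) :
    MvPolynomial.coeff 0 (creation ε n) = 0 := by
  have h := congrArg constantCoeff (natCast_smul_creation ε n)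
  rw [smul_eq_C_mul, smul_eq_C_mul, map_mul, map_mul, map_sum] at h
  simp only [map_mul, constantCoeff_X, zero_mul, Finset.sum_const_zero, mul_zero,
    constantCoeff_C] at h
  rw [← constantCoeff_eq]
  exact (mul_eq_zero.1 h).resolve_left (by exact_mod_cast hn)

theorem coeff_zero_crossSum_one (a b : ℤ) : MvPolynomial.coeff 0 (crossSum 1 (a + 1) b) =
    if 0 ≤ b ∧ a = -b - 1 then 1 else 0 := by
  rcases lt_or_ge b 0 with hb | hb
  · rw [if_neg (by omega), crossSum, show (b + 1).toNat = 0 by omega]; simp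
  · obtain ⟨N, rfl⟩ : ∃ N : ℕ, b = N := ⟨b.toNat, by omega⟩
    rw [crossSum, show ((N : ℤ) + 1).toNat = N + 1 by omega, coeff_sum, Finset.sum_range_succ,
      Finset.sum_eq_zero, zero_add, sub_self, creation_zero, mul_one, Nat.multichoose_one,
      Nat.cast_one, one_smul]
    · split_ifs with h
      · rw [show a + 1 + (N : ℤ) = 0 by omega, creation_zero, coeff_zero_one]
      · exact coeff_zero_creation 1 (by omega)
    · intro j hj
      rw [Finset.mem_range] at hj
      rw [coeff_smul, ← constantCoeff_eq, map_mul, constantCoeff_eq,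
        coeff_zero_creation (-1) (by omega), mul_zero, smul_zero]

/-- The vacuum expectation value of z₁₂^{m-1}φ⁺φ⁻ is exactly z₁₂^{-1}; the subtraction makes that of
V_m zero. -/
theorem covacuum_bilocal_vac {m : ℕ} (hm : m ≠ 0) (a b k : ℤ) :
    covacuum (bilocal m a b (Finsupp.single k 1)) = 0 := by
  rw [bilocal_vac hm]
  by_cases hk : k = 0
  · subst hk
    rw [covacuum_single, coeff_sub, mul_zero, sub_zero, add_zero, coeff_zero_crossSum_one]
    split_ifs <;> simp
  · exact covacuum_single_ne hk _

/-- The counterpart of `bilocal_vacuum` at infinity: moving creation operators to the left only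
raises exponents, and the extra term of `bilocal_heis_neg` lives on negative ones. -/
theorem covacuum_bilocal {m : ℕ} (hm : m ≠ 0) {a b : ℤ} (h : 0 ≤ a ∨ 0 ≤ b) (v : Fock) :
    covacuum (bilocal m a b v) = 0 := by
  refine fock_induction m (P := fun v => ∀ a b, 0 ≤ a ∨ 0 ≤ b → covacuum (bilocal m a b v) = 0)
    (fun k a b _ => covacuum_bilocal_vac hm a b k) ?_ ?_ ?_ v a b h
  · intro v w hv hw a b h; rw [map_add, map_add, hv a b h, hw a b h, add_zero]
  · intro c v hv a b h; rw [map_smul, map_smul, hv a b h, smul_zero]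
  · intro p v hv a b h
    rw [bilocal_heis_neg, map_add, map_sub, covacuum_heis_neg, map_smul, map_sub,
      hv _ _ (show 0 ≤ a + (p + 1) ∨ 0 ≤ b by omega), hv _ _ (show 0 ≤ a ∨ 0 ≤ b + (p + 1) by omega),
      if_neg (by omega)]
    simp

theorem bilocal_vacuum {m : ℕ} (hm : m ≠ 0) {a b : ℤ} (h : a < 0 ∨ b < 0) :
    bilocal m a b vacuum = 0 := by
  rw [vacuum, bilocal_vac hm, mul_zero, sub_zero, add_zero]
  rcases lt_or_ge b 0 with hb | hb
  · rw [if_neg (by omega), crossSum, show (b + 1).toNat = 0 by omega]; simp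
  · rw [crossSum_one_of_nonpos (by omega), if_congr (show a + 1 + b = 0 ↔ 0 ≤ b ∧ a = -b - 1 by omega)
      rfl rfl, sub_self, Finsupp.single_zero]

theorem bilocal_vacuum_zero {m : ℕ} (hm : m ≠ 0) (N : ℕ) :
    bilocal m N 0 vacuum = Finsupp.single 0 (creation 1 ((N : ℤ) + 1)) := by
  rw [vacuum, bilocal_vac hm, if_neg (by omega), crossSum]
  simp [creation_zero]

theorem bilocalTaylor_apply_vacuum {m : ℕ} (hm : m ≠ 0) (k : ℕ) {c : ℤ} (hc : c < 0) :
    bilocalTaylor m k c vacuum = 0 := by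
  rw [bilocalTaylor, taylor_apply,
    locSum_apply_eq_sum ((regular_bilocal hm).locFin_taylor k c) _ ∅, Finset.sum_empty]
  intro a _
  rw [LinearMap.smul_apply]
  by_cases h : a < 0 ∨ c + k - a < 0
  · rw [bilocal_vacuum hm h, smul_zero]
  · rw [bc_eq_zero (by omega) (by omega), zero_smul]

theorem bilocalTaylor_zero_vacuum {m : ℕ} (hm : m ≠ 0) (k : ℕ) :
    bilocalTaylor m k 0 vacuum = bilocal m k 0 vacuum := by
  rw [bilocalTaylor, taylor_apply,
    locSum_apply_eq_sum ((regular_bilocal hm).locFin_taylor k 0) _ {(k : ℤ)}, Finset.sum_singleton,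
    LinearMap.smul_apply, bc_natCast, Nat.choose_self, Nat.cast_one, one_smul, zero_add, sub_self]
  intro a ha
  rw [Finset.mem_singleton] at ha
  rw [LinearMap.smul_apply]
  by_cases h : a < 0 ∨ 0 + k - a < 0
  · rw [bilocal_vacuum hm h, smul_zero]
  · rw [bc_eq_zero (by omega) (by omega), zero_smul]

theorem iterate_deriv_apply_vacuum {A : Dist} (hA : ∀ c < 0, A c vacuum = 0) (k : ℕ) {c : ℤ}
    (hc : c < 0) : deriv^[k] A c vacuum = 0 := by
  rw [iterate_deriv_apply, LinearMap.smul_apply]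
  by_cases h : c + k < 0
  · rw [hA _ h, smul_zero]
  · rw [bc_eq_zero (by omega) (by omega), mul_zero, zero_smul]

theorem quasiField_apply_vacuum {m : ℕ} (hm : m ≠ 0) (l : ℕ) {c : ℤ} (hc : c < 0) :
    quasiField m l c vacuum = 0 := by
  rw [quasiField, Pi.smul_apply, LinearMap.smul_apply, Finset.sum_apply, LinearMap.sum_apply,
    Finset.sum_eq_zero, smul_zero]
  intro k _
  rw [Pi.smul_apply, LinearMap.smul_apply,
    iterate_deriv_apply_vacuum (fun c hc => bilocalTaylor_apply_vacuum hm _ hc) k hc, smul_zero]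

/-! ### The coefficients of the 2-point functions -/

theorem vev_quasiprimary_ward {m : ℕ} (hm : m ≠ 0) {h h' : ℕ} {A B : Dist}
    (hA : Quasiprimary m h A) (hB : Quasiprimary m h' B) {n : ℤ} (hn : n = -1 ∨ n = 0 ∨ n = 1)
    (a b : ℤ) : ((a : ℂ) - n + (n + 1) * h) * vev (A (a - n) * B b) +
      ((b : ℂ) - n + (n + 1) * h') * vev (A a * B (b - n)) = 0 := by
  have := vev_ward hm hn (A a) (B b)
  rw [hA n hn, hB n hn, smul_mul_assoc, mul_smul_comm, vev_smul, vev_smul] at this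
  push_cast at this
  exact this

/-- The coefficients of the 2-point function of quasiprimary fields. -/
theorem vev_quasiprimary {m : ℕ} (hm : m ≠ 0) {h h' : ℕ} {A B : Dist}
    (hA : Quasiprimary m h A) (hB : Quasiprimary m h' B) (hvac : ∀ c < 0, B c vacuum = 0)
    (hh : h + h' ≠ 0) (a b : ℤ) : vev (A a * B b) =
      if h = h' ∧ 0 ≤ b ∧ a = -(2 * h : ℕ) - b then
        ((2 * h - 1 + b.toNat).choose (2 * h - 1) : ℂ) * vev (A (-(2 * h : ℕ)) * B 0) else 0 := by
  have hneg : ∀ a b : ℤ, b < 0 → vev (A a * B b) = 0 := fun a b hb => by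
    rw [vev_mul, hvac b hb, map_zero, map_zero]
  -- Each generator has its role: L_0 confines the coefficients to a + b = -h - h', L_{-1} gives a
  -- recursion in b, and L_1 at b = 0 forces h = h'.
  have h0 := fun a b => vev_quasiprimary_ward hm hA hB (n := 0) (by norm_num) a b
  have hm1 := fun a b => vev_quasiprimary_ward hm hA hB (n := -1) (by norm_num) a b
  have h1 := fun a b => vev_quasiprimary_ward hm hA hB (n := 1) (by norm_num) a b
  have hsupp : ∀ a b : ℤ, a + b + h + h' ≠ 0 → vev (A a * B b) = 0 := fun a b hab => by
    have := h0 a b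
    rw [sub_zero, sub_zero, ← add_mul] at this
    refine (mul_eq_zero.1 this).resolve_left fun h0 => hab ?_
    push_cast at h0
    have : ((a + b + h + h' : ℤ) : ℂ) = 0 := by push_cast; linear_combination h0
    exact_mod_cast this
  have hf : ∀ N : ℕ, vev (A (-(h + h' : ℕ) - N) * B N) =
      ((h + h' - 1 + N).choose (h + h' - 1) : ℂ) * vev (A (-(h + h' : ℕ)) * B 0) := by
    intro N
    induction N with
    | zero => simp
    | succ N ih =>
      have := hm1 (-(h + h' : ℕ) - N - 1) N
      rw [show -((h + h' : ℕ) : ℤ) - N - 1 - -1 = -((h + h' : ℕ) : ℤ) - N by ring, ih,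
        show (N : ℤ) - -1 = ((N + 1 : ℕ) : ℤ) by push_cast; ring,
        show -((h + h' : ℕ) : ℤ) - N - 1 = -((h + h' : ℕ) : ℤ) - ((N + 1 : ℕ) : ℤ) by
          push_cast; ring] at this
      have e : ((h + h' - 1 + (N + 1)).choose (h + h' - 1) : ℂ) * ((N : ℂ) + 1) =
          ((h + h' - 1 + N).choose (h + h' - 1) : ℂ) * ((h : ℂ) + h' + N) := by
        have e1 := Nat.add_one_mul_choose_eq (h + h' - 1 + N) N
        rw [show h + h' - 1 + (N + 1) = h + h' - 1 + N + 1 by ring,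
          ← Nat.choose_symm (show h + h' - 1 ≤ h + h' - 1 + N + 1 by omega),
          ← Nat.choose_symm (show h + h' - 1 ≤ h + h' - 1 + N by omega),
          show h + h' - 1 + N + 1 - (h + h' - 1) = N + 1 by omega,
          show h + h' - 1 + N - (h + h' - 1) = N by omega]
        have e2 := congrArg (Nat.cast : ℕ → ℂ) e1
        rw [show h + h' - 1 + N + 1 = h + h' + N by omega] at e2 ⊢
        push_cast at e2 ⊢
        linear_combination -e2
      have hN : (N : ℂ) + 1 ≠ 0 := by exact_mod_cast Nat.succ_ne_zero N
      refine mul_left_cancel₀ hN ?_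
      push_cast at this e ⊢
      linear_combination this - vev (A (-((h : ℤ) + h')) * B 0) * e
  by_cases hb : b < 0
  · rw [hneg a b hb, if_neg (by omega)]
  by_cases hab : a + b + h + h' = 0
  · obtain ⟨N, rfl⟩ : ∃ N : ℕ, b = N := ⟨b.toNat, by omega⟩
    have ha : a = -(h + h' : ℕ) - N := by push_cast; omega
    rw [ha, hf]
    by_cases he : h = h'
    · subst he
      rw [if_pos ⟨rfl, by omega, by push_cast; ring⟩, Int.toNat_natCast, ← two_mul]
    · rw [if_neg (by tauto)]
      have := h1 (-(h + h' : ℕ) + 1) 0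
      rw [hneg _ (0 - 1) (by norm_num), mul_zero, add_zero, add_sub_cancel_right] at this
      rw [(mul_eq_zero.1 this).resolve_left, mul_zero]
      intro h2
      push_cast at h2
      have h3 : (h : ℂ) = h' := by linear_combination h2
      exact he (by exact_mod_cast h3)
  · rw [hsupp a b hab, if_neg]
    rintro ⟨rfl, _, h2⟩
    push_cast at h2
    omega

/-! ### The coefficients of the 3-point functions -/

theorem vev_bilocal_ward {m : ℕ} (hm : m ≠ 0) {h : ℕ} {A : Dist} (hA : Quasiprimary m h A) {n : ℤ}
    (hn : n = -1 ∨ n = 0 ∨ n = 1) (a b c : ℤ) :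
    ((a : ℂ) - n + (n + 1) * (1 / 2)) * vev (bilocal m (a - n) b * A c) +
      ((b : ℂ) - n + (n + 1) * (1 / 2)) * vev (bilocal m a (b - n) * A c) +
      ((c : ℂ) - n + (n + 1) * h) * vev (bilocal m a b * A (c - n)) = 0 := by
  have := vev_ward hm hn (bilocal m a b) (A c)
  rw [hA n hn, moebiusCovariant_bilocal hm n hn, add_mul, smul_mul_assoc, smul_mul_assoc,
    mul_smul_comm, vev_add, vev_smul, vev_smul, vev_smul] at this
  push_cast at this
  exact this

/-- The coefficients of the 3-point function of the bilocal field with `V^l`, up to normalization. -/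
def threePoint (l A B : ℕ) : ℂ :=
  ∑ i ∈ range (l + 1), (-1) ^ i * (l.choose i : ℂ) * ((A.choose i : ℂ) * (B.choose (l - i) : ℂ))

theorem cast_mul_choose_pred (A i : ℕ) :
    (A : ℂ) * ((A - 1).choose i : ℂ) = ((A : ℂ) - i) * (A.choose i : ℂ) := by
  cases A with
  | zero => cases i <;> simp
  | succ A =>
    rw [Nat.add_sub_cancel]
    rcases le_or_gt i (A + 1) with h | h
    · have := congrArg (Nat.cast : ℕ → ℂ) (Nat.choose_mul_succ_eq A i)
      push_cast [Nat.cast_sub h] at this ⊢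
      linear_combination this
    · rw [Nat.choose_eq_zero_of_lt h, Nat.choose_eq_zero_of_lt (by omega)]; simp

/-- This is the relation which the Ward identity of L_{-1} imposes on the coefficients. At A = 0 or
B = 0 the truncated predecessor has coefficient zero. -/
theorem threePoint_recursion (l A B : ℕ) : (A : ℂ) * threePoint l (A - 1) B +
    (B : ℂ) * threePoint l A (B - 1) = ((A : ℂ) + B - l) * threePoint l A B := by
  simp only [threePoint, Finset.mul_sum]
  rw [← Finset.sum_add_distrib]
  refine Finset.sum_congr rfl fun i hi => ?_
  rw [Finset.mem_range] at hi
  have h1 := cast_mul_choose_pred A i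
  have h2 := cast_mul_choose_pred B (l - i)
  rw [Nat.cast_sub (by omega)] at h2
  linear_combination (-1) ^ i * (l.choose i : ℂ) * (B.choose (l - i) : ℂ) * h1 +
    (-1) ^ i * (l.choose i : ℂ) * (A.choose i : ℂ) * h2

theorem threePoint_of_add_eq {l A B : ℕ} (h : A + B = l) :
    threePoint l A B = (-1) ^ A * (l.choose A : ℂ) := by
  rw [threePoint, Finset.sum_eq_single A]
  · rw [Nat.choose_self, show l - A = B by omega, Nat.choose_self]; simp
  · intro i hi hiA
    rw [Finset.mem_range] at hi
    rcases lt_or_gt_of_ne hiA with h' | h'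
    · rw [Nat.choose_eq_zero_of_lt (show B < l - i by omega)]; simp
    · rw [Nat.choose_eq_zero_of_lt h']; simp
  · intro h'; rw [Finset.mem_range] at h'; omega

theorem threePoint_zero_left (l B : ℕ) : threePoint l 0 B = B.choose l := by
  rw [threePoint, Finset.sum_range_succ', Finset.sum_eq_zero]
  · simp
  · intro i _; simp

/-- The normalization of the 3-point function. -/
def threePointNorm (m l : ℕ) : ℂ := vev (bilocal m (-1) (-l - 1) * quasiField m l 0)

theorem vev_bilocal_quasiField {m : ℕ} (hm : m ≠ 0) (l : ℕ) (a b c : ℤ) :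
    vev (bilocal m a b * quasiField m l c) =
      if a < 0 ∧ b < 0 ∧ 0 ≤ c ∧ a + b + c = -(l : ℤ) - 2 then
        threePoint l (-a - 1).toNat (-b - 1).toNat * threePointNorm m l else 0 := by
  have hq := quasiprimary_quasiField hm l
  have hz : ∀ a b c : ℤ, ¬(a < 0 ∧ b < 0 ∧ 0 ≤ c) →
      vev (bilocal m a b * quasiField m l c) = 0 := fun a b c h => by
    rw [vev_mul]
    by_cases hc : c < 0
    · rw [quasiField_apply_vacuum hm l hc, map_zero, map_zero]
    · exact covacuum_bilocal hm (by omega) _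
  have hsupp : ∀ a b c : ℤ, a + b + c ≠ -(l : ℤ) - 2 →
      vev (bilocal m a b * quasiField m l c) = 0 := fun a b c h => by
    have := vev_bilocal_ward hm hq (n := 0) (by norm_num) a b c
    rw [sub_zero, sub_zero, sub_zero, ← add_mul, ← add_mul] at this
    refine (mul_eq_zero.1 this).resolve_left fun h' => h ?_
    push_cast at h'
    have : ((a + b + c : ℤ) : ℂ) = ((-(l : ℤ) - 2 : ℤ) : ℂ) := by
      push_cast; linear_combination h'
    exact_mod_cast this
  -- For C = 0 the L_1 identity moves along A + B = l, starting from the normalization at A = 0. The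
  -- L_{-1} identity then raises C by one.
  have key : ∀ C A B : ℕ, A + B = l + C →
      vev (bilocal m (-(A : ℤ) - 1) (-(B : ℤ) - 1) * quasiField m l C) =
        threePoint l A B * threePointNorm m l := by
    intro C
    induction C with
    | zero =>
      intro A
      induction A with
      | zero =>
        intro B hB
        rw [threePoint_of_add_eq (by omega)]
        simp only [Nat.cast_zero, neg_zero, zero_sub, threePointNorm, pow_zero, Nat.choose_zero_right,
          Nat.cast_one, mul_one, one_mul, show B = l by omega]
      | succ A ih =>
        intro B hAB
        have h1 := vev_bilocal_ward hm hq (n := 1) (by norm_num) (-(A : ℤ) - 1) (-(B : ℤ) - 1) 0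
        rw [hz _ _ (0 - 1) (by omega), mul_zero, add_zero,
          show -(A : ℤ) - 1 - 1 = -((A + 1 : ℕ) : ℤ) - 1 by push_cast; ring,
          show -(B : ℤ) - 1 - 1 = -((B + 1 : ℕ) : ℤ) - 1 by push_cast; ring] at h1
        have h2 := ih (B + 1) (by omega)
        rw [Nat.cast_zero] at h2 ⊢
        rw [h2, threePoint_of_add_eq (by omega)] at h1
        rw [threePoint_of_add_eq (by omega)]
        have hA : (A : ℂ) + 1 ≠ 0 := by exact_mod_cast Nat.succ_ne_zero A
        have h3 : (l.choose (A + 1) : ℂ) * ((A : ℂ) + 1) = l.choose A * ((B : ℂ) + 1) := by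
          have := congrArg (Nat.cast : ℕ → ℂ) (Nat.choose_succ_right_eq l A)
          rw [show l - A = B + 1 by omega] at this
          exact_mod_cast this
        refine mul_left_cancel₀ hA ?_
        push_cast at h1 ⊢
        linear_combination -h1 + (-1) ^ A * threePointNorm m l * h3
    | succ C ih =>
      intro A B hAB
      have h1 := vev_bilocal_ward hm hq (n := -1) (by norm_num) (-(A : ℤ) - 1) (-(B : ℤ) - 1) C
      have hA : (A : ℂ) * vev (bilocal m (-(A : ℤ) - 1 - -1) (-(B : ℤ) - 1) * quasiField m l C) =
          A * (threePoint l (A - 1) B * threePointNorm m l) := by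
        cases A with
        | zero => simp
        | succ A =>
          rw [Nat.add_sub_cancel, ← ih A B (by omega),
            show -((A + 1 : ℕ) : ℤ) - 1 - -1 = -(A : ℤ) - 1 by push_cast; ring]
      have hB : (B : ℂ) * vev (bilocal m (-(A : ℤ) - 1) (-(B : ℤ) - 1 - -1) * quasiField m l C) =
          B * (threePoint l A (B - 1) * threePointNorm m l) := by
        cases B with
        | zero => simp
        | succ B =>
          rw [Nat.add_sub_cancel, ← ih A B (by omega),
            show -((B + 1 : ℕ) : ℤ) - 1 - -1 = -(B : ℤ) - 1 by push_cast; ring]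
      rw [show (C : ℤ) - -1 = ((C + 1 : ℕ) : ℤ) by push_cast; ring] at h1
      have h2 := threePoint_recursion l A B
      have hC : (C : ℂ) + 1 ≠ 0 := by exact_mod_cast Nat.succ_ne_zero C
      have hl : (l : ℂ) = A + B - (C + 1) := by
        have := congrArg (Nat.cast : ℕ → ℂ) hAB
        push_cast at this
        linear_combination -this
      refine mul_left_cancel₀ hC ?_
      rw [hl] at h2
      push_cast at h1 ⊢
      linear_combination h1 + hA + hB + threePointNorm m l * h2
  by_cases h : a < 0 ∧ b < 0 ∧ 0 ≤ c
  · by_cases h' : a + b + c = -(l : ℤ) - 2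
    · rw [if_pos ⟨h.1, h.2.1, h.2.2, h'⟩, ← key c.toNat _ _ (by omega)]
      congr 3 <;> omega
    · rw [if_neg (by tauto), hsupp a b c h']
  · rw [if_neg (by tauto), hz a b c h]

/-! ### Binomial sums -/

theorem alternating_sum_choose (n s q : ℕ) :
    ∑ i ∈ range (n + 1), (-1) ^ i * (n.choose i : ℂ) * ((i + s).choose q : ℂ) =
      (-1) ^ n * if n ≤ q then (s.choose (q - n) : ℂ) else 0 := by
  induction n generalizing q with
  | zero => simp
  | succ n ih =>
    have h := alternating_sum_succ n fun i => ((i + s).choose q : ℂ)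
    simp only [smul_eq_mul] at h
    rw [h, ih]
    cases q with
    | zero =>
      have h2 := ih 0
      simp only [Nat.choose_zero_right, Nat.cast_one] at h2 ⊢
      rw [h2, if_neg (by omega : ¬n + 1 ≤ 0)]
      ring
    | succ q =>
      simp only [add_right_comm _ 1 s, Nat.choose_succ_succ, Nat.cast_add, mul_add,
        Finset.sum_add_distrib]
      have h2 := ih (q + 1)
      simp only [Nat.succ_eq_add_one]
      rw [ih q, h2, if_congr (show n + 1 ≤ q + 1 ↔ n ≤ q by omega) rfl rfl,
        show q + 1 - (n + 1) = q - n by omega]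
      ring

/-- The terms with q < k vanish; the rest is a finite difference of order l - k. The absence of
signs on the right is what makes the positivity of C_{lm} visible. -/
theorem alternating_sum_choose_mul_choose {l k : ℕ} (hk : k ≤ l) :
    ∑ q ∈ range (l + 1), (-1) ^ (l - q) * (l.choose q : ℂ) * ((l + q).choose l : ℂ) *
      (q.choose k : ℂ) = (l.choose k : ℂ) * ((l + k).choose k : ℂ) := by
  obtain ⟨n, rfl⟩ : ∃ n, l = k + n := ⟨l - k, by omega⟩
  rw [add_assoc k n 1, Finset.sum_range_add, Finset.sum_eq_zero, zero_add]
  · have h := alternating_sum_choose n (k + n + k) (k + n)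
    rw [if_pos (by omega), Nat.add_sub_cancel] at h
    have h1 : ((-1 : ℂ) ^ n) * (-1) ^ n = 1 := by rw [← mul_pow]; simp
    have h2 : ∀ i ∈ range (n + 1), (-1) ^ (k + n - (k + i)) * ((k + n).choose (k + i) : ℂ) *
        ((k + n + (k + i)).choose (k + n) : ℂ) * ((k + i).choose k : ℂ) =
        ((-1) ^ n * ((k + n).choose k : ℂ)) * ((-1) ^ i * (n.choose i : ℂ) *
          ((i + (k + n + k)).choose (k + n) : ℂ)) := fun i hi => by
      rw [Finset.mem_range] at hi
      have h3 := congrArg (Nat.cast : ℕ → ℂ)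
        (Nat.choose_mul (n := k + n) (show k ≤ k + i by omega))
      rw [show k + n - k = n by omega, show k + i - k = i by omega] at h3
      push_cast at h3
      have h4 : (-1 : ℂ) ^ n = (-1) ^ (n - i) * (-1) ^ i := by
        rw [← pow_add]; congr 1; omega
      have h5 : ((-1 : ℂ) ^ i) * (-1) ^ i = 1 := by rw [← mul_pow]; simp
      rw [show k + n - (k + i) = n - i by omega,
        show k + n + (k + i) = i + (k + n + k) by ring, h4]
      linear_combination (-1) ^ (n - i) * ((i + (k + n + k)).choose (k + n) : ℂ) * h3 -
        (-1) ^ (n - i) * ((k + n).choose k : ℂ) * (n.choose i : ℂ) *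
          ((i + (k + n + k)).choose (k + n) : ℂ) * h5
    rw [Finset.sum_congr rfl h2, ← Finset.mul_sum, h]
    linear_combination ((k + n).choose k : ℂ) * ((k + n + k).choose k : ℂ) * h1
  · intro q hq
    rw [Finset.mem_range] at hq
    rw [Nat.choose_eq_zero_of_lt hq]; simp

theorem choose_add_succ_eq_sum (m q : ℕ) : (m + q).choose (q + 1) =
    ∑ k ∈ range (q + 1), m.choose (k + 1) * q.choose k := by
  rw [Nat.add_choose_eq, Finset.Nat.sum_antidiagonal_eq_sum_range_succ
    (fun i j => m.choose i * q.choose j), Finset.sum_range_succ', Nat.sub_zero,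
    Nat.choose_succ_self, mul_zero, add_zero]
  refine Finset.sum_congr rfl fun k hk => ?_
  rw [Finset.mem_range] at hk
  rw [show q + 1 - (k + 1) = q - k by omega, Nat.choose_symm (by omega)]

/-! ### The triangular system -/

/-- The coefficients of the triangular system. -/
def triangularCoeff (N l : ℕ) : ℂ := (N.factorial : ℂ) ^ 2 * ((2 * l + 1).factorial : ℂ) /
  ((l + 1).factorial * (l.factorial : ℂ) ^ 2 * (N + l + 1).factorial * (N - l).factorial)

theorem triangularCoeff_self_ne_zero (N : ℕ) : triangularCoeff N N ≠ 0 := by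
  have f : ∀ n : ℕ, (n.factorial : ℂ) ≠ 0 := fun n => by exact_mod_cast Nat.factorial_ne_zero n
  unfold triangularCoeff
  exact div_ne_zero (mul_ne_zero (pow_ne_zero _ (f _)) (f _))
    (mul_ne_zero (mul_ne_zero (mul_ne_zero (f _) (pow_ne_zero _ (f _))) (f _)) (f _))

theorem eq_of_triangular {b c c' : ℕ → ℂ}
    (h : ∀ N, b N = ∑ l ∈ range (N + 1), c l * triangularCoeff N l)
    (h' : ∀ N, b N = ∑ l ∈ range (N + 1), c' l * triangularCoeff N l) : c = c' := by
  funext N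
  induction N using Nat.strong_induction_on with
  | _ N ih =>
    have e := (h N).symm.trans (h' N)
    rw [Finset.sum_range_succ, Finset.sum_range_succ, Finset.sum_congr rfl fun l hl => by
      rw [ih l (Finset.mem_range.1 hl)]] at e
    exact mul_right_cancel₀ (triangularCoeff_self_ne_zero N) (add_left_cancel e)

theorem coeff_one_sub_pow_inv {m : ℕ} (hm : m ≠ 0) (N : ℕ) :
    PowerSeries.coeff (N + 1) (((1 - PowerSeries.X : PowerSeries ℝ) ^ m)⁻¹) =
      ((m + N).choose (N + 1) : ℝ) := by
  obtain ⟨d, rfl⟩ : ∃ d, m = d + 1 := ⟨m - 1, by omega⟩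
  have h : ((1 - PowerSeries.X : PowerSeries ℝ) ^ (d + 1))⁻¹ = (PowerSeries.mk 1) ^ (d + 1) := by
    rw [PowerSeries.inv_eq_iff_mul_eq_one (by simp), ← mul_pow,
      PowerSeries.mk_one_mul_one_sub_eq_one, one_pow]
  rw [h, PowerSeries.mk_one_pow_eq_mk_choose_add, PowerSeries.coeff_mk,
    show d + 1 + N = d + (N + 1) by ring, Nat.choose_symm_add]

theorem ascPochhammer_eval_succ (a k : ℕ) :
    (a.factorial : ℝ) * (ascPochhammer ℝ k).eval ((a : ℝ) + 1) = ((a + k).factorial : ℝ) := by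
  have h := ascPochhammer_eval_cast (S := ℝ) k (a + 1)
  rw [ascPochhammer_nat_eq_ascFactorial] at h
  push_cast at h
  rw [← h, ← Nat.factorial_mul_ascFactorial a k]
  push_cast; rfl

theorem hypergeometricCoeff_eq {N l : ℕ} (hl : l ≤ N) : (1 / ((l + 1).factorial : ℝ)) *
    ordinaryHypergeometricCoefficient ((l : ℝ) + 1) ((l : ℝ) + 1) (2 * (l : ℝ) + 2) (N - l) =
    (N.factorial : ℝ) ^ 2 * ((2 * l + 1).factorial : ℝ) /
      ((l + 1).factorial * (l.factorial : ℝ) ^ 2 * (N + l + 1).factorial * (N - l).factorial) := by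
  have f : ∀ n : ℕ, (n.factorial : ℝ) ≠ 0 := fun n => by exact_mod_cast Nat.factorial_ne_zero n
  obtain ⟨n, rfl⟩ : ∃ n, N = l + n := ⟨N - l, by omega⟩
  have h1 := ascPochhammer_eval_succ l n
  have h2 := ascPochhammer_eval_succ (2 * l + 1) n
  rw [show (((2 * l + 1 : ℕ) : ℝ) + 1) = 2 * (l : ℝ) + 2 by push_cast; ring] at h2
  have h3 : (ascPochhammer ℝ n).eval (2 * (l : ℝ) + 2) ≠ 0 := fun h0 => by
    rw [h0, mul_zero] at h2
    exact f _ h2.symm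
  rw [Nat.add_sub_cancel_left, ordinaryHypergeometricCoefficient, ← h1,
    show l + n + l + 1 = 2 * l + 1 + n by ring, ← h2]
  have := f l; have := f (2 * l + 1); have := f (l + 1); have := f n
  field_simp

theorem triangularSystem_iff {m : ℕ} (hm : m ≠ 0) (c : ℕ → ℝ) : TriangularSystem m c ↔
    ∀ N : ℕ, ((m + N).choose (N + 1) : ℂ) =
      ∑ l ∈ range (N + 1), (c l : ℂ) * triangularCoeff N l := by
  refine forall_congr' fun N => ?_
  rw [coeff_one_sub_pow_inv hm, ← Complex.ofReal_inj, Complex.ofReal_natCast, Complex.ofReal_sum]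
  refine Eq.congr rfl (Finset.sum_congr rfl fun l hl => ?_)
  rw [Finset.mem_range] at hl
  rw [div_eq_mul_one_div, mul_assoc, hypergeometricCoeff_eq (show l ≤ N by omega), triangularCoeff]
  push_cast
  rfl

/-- The constants `C_{lm}`. -/
def normConst (m l : ℕ) : ℝ := ((l + 1).factorial : ℝ) * (l.factorial : ℝ) ^ 2 /
  ((2 * l).factorial : ℝ) *
    ∑ k ∈ range (l + 1), (m.choose (k + 1) : ℝ) * (l.choose k : ℝ) * ((l + k).choose k : ℝ)

theorem normConst_pos {m : ℕ} (hm : m ≠ 0) (l : ℕ) : 0 < normConst m l := by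
  unfold normConst
  refine mul_pos (by positivity) (Finset.sum_pos' (fun k _ => by positivity) ⟨0, by simp, ?_⟩)
  simp only [zero_add, Nat.choose_one_right, Nat.choose_zero_right, Nat.cast_one, mul_one]
  exact_mod_cast Nat.pos_of_ne_zero hm

/-- The alternating form is the direct inversion of the triangular system. Vandermonde's identity
applied to (m+q choose q+1) leads back to the manifestly nonnegative sum. -/
theorem normConst_eq (m l : ℕ) : (normConst m l : ℂ) =
    ((l + 1).factorial : ℂ) * (l.factorial : ℂ) ^ 2 / ((2 * l).factorial : ℂ) *
      ∑ q ∈ range (l + 1), (-1) ^ (l - q) * (l.choose q : ℂ) * ((l + q).choose l : ℂ) *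
        ((m + q).choose (q + 1) : ℂ) := by
  rw [normConst]
  push_cast
  congr 1
  have h1 : ∀ q ∈ range (l + 1), (-1) ^ (l - q) * (l.choose q : ℂ) * ((l + q).choose l : ℂ) *
      ((m + q).choose (q + 1) : ℂ) = ∑ k ∈ range (l + 1), (m.choose (k + 1) : ℂ) *
        ((-1) ^ (l - q) * (l.choose q : ℂ) * ((l + q).choose l : ℂ) * (q.choose k : ℂ)) := by
    intro q hq
    rw [Finset.mem_range] at hq
    rw [choose_add_succ_eq_sum, Finset.sum_subset (Finset.range_subset_range.2 (show q + 1 ≤ l + 1 by omega)) fun k _ hk => by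
      rw [Finset.mem_range] at hk
      rw [Nat.choose_eq_zero_of_lt (show q < k by omega), mul_zero]]
    push_cast
    rw [Finset.mul_sum]
    exact Finset.sum_congr rfl fun k _ => by ring
  rw [Finset.sum_congr rfl h1, Finset.sum_comm]
  refine Finset.sum_congr rfl fun k hk => ?_
  rw [Finset.mem_range] at hk
  rw [← Finset.mul_sum, alternating_sum_choose_mul_choose (show k ≤ l by omega), mul_assoc]

/-- Substituting the alternating form, the coefficient of (m+q choose q+1) is a multiple of
`sum_orthogonality` with s = 2q and d = N - q. The same inversion gives `bilocalTaylor_expansion`.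
-/
theorem normConst_triangular (m N : ℕ) : ((m + N).choose (N + 1) : ℂ) =
    ∑ l ∈ range (N + 1), (normConst m l : ℂ) * triangularCoeff N l := by
  have f : ∀ n : ℕ, (n.factorial : ℂ) ≠ 0 := fun n => by exact_mod_cast Nat.factorial_ne_zero n
  set t : ℕ → ℕ → ℂ := fun q i => (N.factorial : ℂ) ^ 2 /
    ((q.factorial : ℂ) ^ 2 * (N - q).factorial) * ((m + q).choose (q + 1) : ℂ) *
      ((-1) ^ i * (((2 * q : ℕ) : ℂ) + 2 * i + 1) * ((2 * q + i).factorial : ℂ) /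
        ((2 * q + (N - q) + i + 1).factorial : ℂ) * ((N - q).choose i : ℂ)) with ht
  have h1 : ∀ l ∈ range (N + 1), (normConst m l : ℂ) * triangularCoeff N l =
      ∑ q ∈ range (l + 1), t q (l - q) := fun l hl => by
    rw [Finset.mem_range] at hl
    rw [normConst_eq, mul_right_comm, Finset.mul_sum]
    refine Finset.sum_congr rfl fun q hq => ?_
    rw [Finset.mem_range] at hq
    obtain ⟨i, rfl⟩ : ∃ i, l = q + i := ⟨l - q, by omega⟩
    obtain ⟨r, rfl⟩ : ∃ r, N = q + i + r := ⟨N - (q + i), by omega⟩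
    have e : ((q + i + q).choose (q + i) : ℂ) =
        ((2 * q + i).factorial : ℂ) / ((q + i).factorial * q.factorial) := by
      rw [Nat.cast_add_choose, show q + i + q = 2 * q + i by ring]
    rw [e]
    simp only [ht, triangularCoeff, show q + i - q = i by omega,
      show q + i + r - (q + i) = r by omega, show q + i + r - q = i + r by omega,
      show q + i + r + (q + i) + 1 = 2 * q + (i + r) + i + 1 by ring]
    rw [Nat.factorial_succ (2 * (q + i)), Nat.cast_add_choose, Nat.cast_add_choose]
    have := f q; have := f i; have := f r; have := f (q + i); have := f (2 * (q + i))
    have := f (i + r); have := f (2 * q + (i + r) + i + 1); have := f (q + i + 1)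
    push_cast
    field_simp
  rw [Finset.sum_congr rfl h1, Finset.sum_range_diag_flip (N + 1) t, Finset.sum_range_succ,
    Finset.sum_eq_zero, zero_add]
  · rw [show N + 1 - N = 1 by omega, Finset.sum_range_one]
    simp only [ht, Nat.sub_self, add_zero, Nat.factorial_succ]
    have h3 : (2 * (N : ℂ) + 1) ≠ 0 := by exact_mod_cast Nat.succ_ne_zero (2 * N)
    have := f N; have := f (2 * N)
    push_cast
    field_simp
    simp
  · intro q hq
    rw [Finset.mem_range] at hq
    rw [ht]
    simp only []
    rw [← Finset.mul_sum, show N + 1 - q = (N - q) + 1 by omega,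
      sum_orthogonality (K := ℂ) (2 * q) (show N - q ≠ 0 by omega), mul_zero]

/-! ### Normalization of the correlation functions -/

/-- The vector `:φ⁺φ⁻:` contracted against the dual vacuum is evaluation at `x_j = m Y^{j+1}`. -/
def contraction (m : ℕ) : MvPolynomial ℕ ℂ →ₐ[ℂ] Polynomial ℂ :=
  aeval fun j => (m : Polynomial ℂ) * Polynomial.X ^ (j + 1)

theorem coeff_zero_contraction (m : ℕ) (q : MvPolynomial ℕ ℂ) :
    (contraction m q).coeff 0 = MvPolynomial.coeff 0 q := by
  induction q using MvPolynomial.induction_on with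
  | C a => simp [contraction]
  | add p q hp hq => rw [map_add, Polynomial.coeff_add, hp, hq, coeff_add]
  | mul_X p j _ =>
    rw [map_mul, Polynomial.mul_coeff_zero, contraction, aeval_X, Polynomial.mul_coeff_zero]
    rw [← constantCoeff_eq, map_mul, constantCoeff_X]
    simp

/-- In the z₁^{-1} row a creation operator cannot raise the first exponent without giving zero. It
acts only by shifting the second exponent by p + 1 with weight m, that is, as multiplication by m
Y^{p+1}; the case p = B is the extra term of `bilocal_heis_neg`. -/
theorem covacuum_bilocal_neg_one {m : ℕ} (hm : m ≠ 0) (B : ℕ) (v : Fock) :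
    covacuum (bilocal m (-1) (-(B : ℤ) - 1) v) = (contraction m (v 0)).coeff (B + 1) := by
  refine fock_induction m (P := fun v => ∀ B : ℕ, covacuum (bilocal m (-1) (-(B : ℤ) - 1) v) =
    (contraction m (v 0)).coeff (B + 1)) (fun k B => ?_) ?_ ?_ ?_ v B
  · rw [covacuum_bilocal_vac hm]
    by_cases hk : k = 0
    · subst hk
      rw [Finsupp.single_eq_same, map_one, Polynomial.coeff_one, if_neg (by omega)]
    · rw [Finsupp.single_eq_of_ne (Ne.symm hk), map_zero, Polynomial.coeff_zero]
  · intro v w hv hw B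
    rw [map_add, map_add, hv, hw, Finsupp.add_apply, map_add, Polynomial.coeff_add]
  · intro c v hv B
    rw [map_smul, map_smul, hv, Finsupp.smul_apply, map_smul, Polynomial.coeff_smul]
  · intro p v hv B
    rw [bilocal_heis_neg, heis_neg_apply, map_mul, contraction, aeval_X, ← contraction, mul_assoc,
      ← Polynomial.C_eq_natCast, Polynomial.coeff_C_mul, Polynomial.coeff_X_pow_mul', map_add,
      map_sub, covacuum_heis_neg, map_smul, map_sub, map_smul,
      covacuum_bilocal hm (a := -1 + ((p : ℤ) + 1)) (Or.inl (by omega))]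
    rcases lt_trichotomy p B with h | h | h
    · have := hv (B - (p + 1))
      rw [show -((B - (p + 1) : ℕ) : ℤ) - 1 = -(B : ℤ) - 1 + (p + 1) by omega,
        show B - (p + 1) + 1 = B + 1 - (p + 1) by omega] at this
      rw [this, if_neg (by omega), if_pos (by omega)]
      simp
    · subst h
      rw [covacuum_bilocal hm (Or.inr (by omega)), if_pos (by omega), if_pos le_rfl, Nat.sub_self,
        coeff_zero_contraction, covacuum_apply]
      simp
    · rw [covacuum_bilocal hm (Or.inr (by omega)), if_neg (by omega), if_neg (by omega)]
      simp

theorem contraction_creation (m N : ℕ) :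
    contraction m (creation 1 N) = (m.multichoose N : Polynomial ℂ) * Polynomial.X ^ N := by
  rw [creation_natCast, map_expCoeff, ← expCoeff_natCast_mul_pow]
  congr 1
  funext r
  rw [Int.cast_one, one_smul, contraction, aeval_X]

theorem vev_bilocal_bilocalTaylor {m : ℕ} (hm : m ≠ 0) (N : ℕ) :
    vev (bilocal m (-1) (-(N : ℤ) - 1) * bilocalTaylor m N 0) = ((m + N).choose (N + 1) : ℂ) := by
  rw [vev_mul, bilocalTaylor_zero_vacuum hm, bilocal_vacuum_zero hm, covacuum_bilocal_neg_one hm,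
    Finsupp.single_eq_same, show (N : ℤ) + 1 = ((N + 1 : ℕ) : ℤ) by push_cast; rfl,
    contraction_creation, ← Polynomial.C_eq_natCast, Polynomial.coeff_C_mul,
    Polynomial.coeff_X_pow, if_pos rfl, mul_one, Nat.multichoose_eq,
    show m + (N + 1) - 1 = m + N by omega]

/-- Obtained by inserting the expansion of T_N into `vev_bilocal_bilocalTaylor`; each V^l then
contributes a known multiple of its normalization. -/
theorem threePointNorm_triangular {m : ℕ} (hm : m ≠ 0) (N : ℕ) :
    ((m + N).choose (N + 1) : ℂ) =
      ∑ l ∈ range (N + 1), ((l : ℂ) + 1) * threePointNorm m l * triangularCoeff N l := by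
  have f : ∀ n : ℕ, (n.factorial : ℂ) ≠ 0 := fun n => by exact_mod_cast Nat.factorial_ne_zero n
  rw [← vev_bilocal_bilocalTaylor hm, bilocalTaylor_expansion, Finset.sum_apply, Finset.mul_sum,
    vev_sum]
  refine Finset.sum_congr rfl fun l hl => ?_
  rw [Finset.mem_range] at hl
  rw [Pi.smul_apply, weightedIntegral, Pi.smul_apply, iterate_deriv_apply, integral_weight,
    mul_smul_comm, mul_smul_comm, mul_smul_comm, vev_smul, vev_smul, vev_smul, zero_add,
    vev_bilocal_quasiField hm, if_pos ⟨by norm_num, by omega, by omega, by omega⟩, bc_natCast,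
    Nat.choose_self, show (- -1 - 1 : ℤ).toNat = 0 by norm_num,
    show (-(-(N : ℤ) - 1) - 1).toNat = N by omega, threePoint_zero_left, triangularCoeff]
  obtain ⟨n, rfl⟩ : ∃ n, N = l + n := ⟨N - l, by omega⟩
  rw [Nat.add_sub_cancel_left, show l + n + l + 1 = 2 * l + n + 1 by ring, Nat.cast_add_choose,
    Nat.factorial_succ l]
  have := f l; have := f n; have := f (l + n); have := f (2 * l + n + 1)
  have hl : (l : ℂ) + 1 ≠ 0 := by exact_mod_cast Nat.succ_ne_zero l
  push_cast
  field_simp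

theorem normConst_eq_threePointNorm {m : ℕ} (hm : m ≠ 0) (l : ℕ) :
    (normConst m l : ℂ) = ((l : ℂ) + 1) * threePointNorm m l :=
  congrFun (eq_of_triangular (normConst_triangular m) (threePointNorm_triangular hm)) l

theorem triangularSystem_iff_eq_normConst {m : ℕ} (hm : m ≠ 0) (c : ℕ → ℝ) :
    TriangularSystem m c ↔ c = normConst m := by
  rw [triangularSystem_iff hm]
  refine ⟨fun h => ?_, fun h N => by rw [h]; exact normConst_triangular m N⟩
  have := eq_of_triangular h (normConst_triangular m)
  funext l
  exact Complex.ofReal_injective (congrFun this l)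

theorem covacuum_locSum {A : ℤ → Module.End ℂ Fock} (hA : LocFin A) (v : Fock) (s : Finset ℤ)
    (hs : ∀ i, i ∉ s → covacuum (A i v) = 0) :
    covacuum (locSum A v) = ∑ i ∈ s, covacuum (A i v) := by
  rw [locSum_apply hA, show covacuum (∑ᶠ i, A i v) = ∑ᶠ i, covacuum (A i v) from
    covacuum.toAddMonoidHom.map_finsum (hA v)]
  exact finsum_eq_sum_of_support_subset _ fun i hi => by
    by_contra h'; exact hi (hs i h')

/-- The pairing is an l-th finite difference of (A+q choose q), a polynomial of degree q in A. It
vanishes for q < l, so in the 2-point normalization only the term of V^l without derivatives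
survives. -/
theorem vev_bilocalTaylor_quasiField {m : ℕ} (hm : m ≠ 0) {l q : ℕ} (hq : q ≤ l) :
    vev (bilocalTaylor m q (-l - 2 - q) * quasiField m l 0) =
      if q = l then threePointNorm m l else 0 := by
  have hr := (regular_bilocal hm).locFin_taylor q (-l - 2 - q)
  rw [vev_mul, bilocalTaylor, taylor_apply, covacuum_locSum hr _
    ((range (l + 1)).map ⟨fun A : ℕ => -(A : ℤ) - 1, fun a b h => by simpa using h⟩),
    Finset.sum_map]
  · have h1 : ∀ A ∈ range (l + 1), covacuum ((bc (-(A : ℤ) - 1) q •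
        bilocal m (-(A : ℤ) - 1) (-l - 2 - q + q - (-(A : ℤ) - 1))) (quasiField m l 0 vacuum)) =
        ((-1) ^ q * threePointNorm m l) *
          ((-1) ^ A * (l.choose A : ℂ) * ((A + q).choose q : ℂ)) := fun A hA => by
      rw [Finset.mem_range] at hA
      rw [LinearMap.smul_apply, map_smul, smul_eq_mul, ← vev_mul, vev_bilocal_quasiField hm,
        if_pos ⟨by omega, by omega, by omega, by omega⟩, bc_neg, ← Nat.cast_add, bc_natCast,
        threePoint_of_add_eq (by omega), show (-(-(A : ℤ) - 1) - 1).toNat = A by omega]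
      ring
    refine (Finset.sum_congr rfl h1).trans ?_
    rw [← Finset.mul_sum, alternating_sum_choose]
    by_cases h : q = l
    · subst h
      have h2 : ((-1 : ℂ) ^ q) * (-1) ^ q = 1 := by rw [← mul_pow]; simp
      rw [if_pos le_rfl, if_pos rfl, Nat.sub_self, Nat.choose_zero_right, Nat.cast_one]
      linear_combination threePointNorm m q * h2
    · rw [if_neg (by omega), if_neg h, mul_zero, mul_zero]
  · intro a ha
    rw [LinearMap.smul_apply, map_smul, covacuum_bilocal hm, smul_zero]
    by_contra h
    refine ha (Finset.mem_map.2 ⟨(-a - 1).toNat, ?_, ?_⟩)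
    · rw [Finset.mem_range]; omega
    · change -(((-a - 1).toNat : ℕ) : ℤ) - 1 = a; omega

theorem vev_quasiField_self {m : ℕ} (hm : m ≠ 0) (l : ℕ) :
    vev (quasiField m l (-(2 * (l + 1) : ℕ)) * quasiField m l 0) =
      (l.factorial : ℂ) * threePointNorm m l := by
  have f : ∀ n : ℕ, (n.factorial : ℂ) ≠ 0 := fun n => by exact_mod_cast Nat.factorial_ne_zero n
  conv_lhs => rw [show quasiField m l (-(2 * (l + 1) : ℕ)) = _ from congrFun (quasiField.eq_1 m l) _]
  rw [Pi.smul_apply, smul_mul_assoc, vev_smul, Finset.sum_apply, Finset.sum_mul, vev_sum,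
    Finset.sum_eq_single 0]
  · have h := vev_bilocalTaylor_quasiField hm (le_refl l)
    rw [if_pos rfl] at h
    rw [Pi.smul_apply, smul_mul_assoc, vev_smul, Function.iterate_zero, id_eq, Nat.sub_zero,
      Nat.sub_zero, show (-(2 * (l + 1) : ℕ) : ℤ) = -l - 2 - l by push_cast; ring, h,
      Nat.choose_zero_right]
    have := f (2 * l)
    field_simp
    simp
  · intro k hk hk0
    rw [Finset.mem_range] at hk
    have h := vev_bilocalTaylor_quasiField hm (show l - k ≤ l by omega)
    rw [if_neg (by omega)] at h
    rw [Pi.smul_apply, iterate_deriv_apply, smul_mul_assoc, smul_mul_assoc, vev_smul, vev_smul,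
      show (-(2 * (l + 1) : ℕ) : ℤ) + k = -l - 2 - (l - k : ℕ) by
        rw [Nat.cast_sub (by omega)]; push_cast; ring, h, mul_zero, mul_zero]
  · intro h; simp at h

theorem vev_quasiField_quasiField {m : ℕ} (hm : m ≠ 0) (l l' : ℕ) (a b : ℤ) :
    ((l : ℂ) + 1) / l.factorial * vev (quasiField m l a * quasiField m l' b) =
      if l = l' ∧ 0 ≤ b ∧ a = -(2 * (l + 1) : ℕ) - b then
        ((b.toNat + (2 * l + 1)).choose (2 * l + 1) : ℂ) * normConst m l else 0 := by
  have h := vev_quasiprimary hm (quasiprimary_quasiField hm l) (quasiprimary_quasiField hm l')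
    (fun c hc => quasiField_apply_vacuum hm l' hc) (by omega) a b
  rw [h]
  by_cases hl : l = l'
  · subst hl
    simp only [true_and]
    rw [vev_quasiField_self hm, normConst_eq_threePointNorm hm,
      show 2 * (l + 1) - 1 + b.toNat = b.toNat + (2 * l + 1) by omega,
      show 2 * (l + 1) - 1 = 2 * l + 1 by omega]
    have f : (l.factorial : ℂ) ≠ 0 := by exact_mod_cast Nat.factorial_ne_zero l
    split_ifs
    · field_simp
    · simp
  · rw [if_neg (by omega), if_neg (by tauto), mul_zero]

/-! ### Summation of the 2- and 3-point functions -/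

theorem hasSum_inv_sub_pow (k : ℕ) {x y : ℂ} (h : ‖y‖ < ‖x‖) :
    HasSum (fun n : ℕ => ((n + k).choose k : ℂ) * x ^ (-((n + k : ℕ) : ℤ) - 1) * y ^ n)
      ((x - y) ^ (k + 1))⁻¹ := by
  have hx : x ≠ 0 := norm_pos_iff.1 ((norm_nonneg y).trans_lt h)
  have hr : ‖y / x‖ < 1 := by rwa [norm_div, div_lt_one ((norm_nonneg y).trans_lt h)]
  have h1 := (hasSum_choose_mul_geometric_of_norm_lt_one k hr).mul_left ((x ^ (k + 1))⁻¹)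
  have hv : (x ^ (k + 1))⁻¹ * (1 / (1 - y / x) ^ (k + 1)) = ((x - y) ^ (k + 1))⁻¹ := by
    rw [one_div, ← mul_inv, ← mul_pow, mul_sub, mul_one, mul_div_cancel₀ _ hx]
  rw [hv] at h1
  refine h1.congr_fun fun n => ?_
  rw [show -((n + k : ℕ) : ℤ) - 1 = -((n + k + 1 : ℕ) : ℤ) by push_cast; ring, zpow_neg,
    zpow_natCast, div_pow, add_assoc, pow_add]
  field_simp

theorem hasSum_vev_quasiField_quasiField {m : ℕ} (hm : m ≠ 0) (l l' : ℕ) {z₁ z₂ : ℂ}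
    (h : ‖z₂‖ < ‖z₁‖) :
    HasSum (fun p : ℤ × ℤ => ((l : ℂ) + 1) / (l.factorial : ℂ) *
        vev (quasiField m l p.1 * quasiField m l' p.2) * z₁ ^ p.1 * z₂ ^ p.2)
      (if l = l' then (normConst m l : ℂ) * (z₁ - z₂) ^ (-2 * (l : ℤ) - 2) else 0) := by
  simp only [vev_quasiField_quasiField hm]
  by_cases hl : l = l'
  · rw [if_pos hl]
    have hg : Function.Injective fun n : ℕ => (-((2 * (l + 1) : ℕ) : ℤ) - n, (n : ℤ)) :=
      fun a b hab => by simpa using congrArg Prod.snd hab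
    rw [← hg.hasSum_iff]
    · have h1 := (hasSum_inv_sub_pow (2 * l + 1) h).mul_left (normConst m l : ℂ)
      rw [show -2 * (l : ℤ) - 2 = -((2 * l + 1 + 1 : ℕ) : ℤ) by push_cast; ring, zpow_neg,
        zpow_natCast]
      refine h1.congr_fun fun n => ?_
      simp only [Function.comp_apply]
      rw [if_pos ⟨hl, by omega, by trivial⟩, Int.toNat_natCast, zpow_natCast,
        show -((n + (2 * l + 1) : ℕ) : ℤ) - 1 = -((2 * (l + 1) : ℕ) : ℤ) - n by push_cast; ring]
      ring
    · rintro ⟨a, b⟩ hab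
      rw [if_neg, zero_mul, zero_mul]
      rintro ⟨-, h0, h1⟩
      refine hab ⟨b.toNat, ?_⟩
      simp only at h0 h1 ⊢
      rw [Prod.mk.injEq]
      exact ⟨by omega, by omega⟩
  · rw [if_neg hl]
    convert hasSum_zero using 2 with p
    rw [if_neg fun h => hl h.1, zero_mul, zero_mul]

theorem hasSum_threePoint_term (i j : ℕ) {z₁ z₂ z₃ : ℂ} (h₁ : ‖z₃‖ < ‖z₁‖) (h₂ : ‖z₃‖ < ‖z₂‖) :
    HasSum (fun p : ℤ × ℤ × ℤ =>
        (if p.1 < 0 ∧ p.2.1 < 0 ∧ 0 ≤ p.2.2 ∧ p.1 + p.2.1 + p.2.2 = -((i + j : ℕ) : ℤ) - 2 then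
          ((-p.1 - 1).toNat.choose i : ℂ) * ((-p.2.1 - 1).toNat.choose j : ℂ) else 0) *
          z₁ ^ p.1 * z₂ ^ p.2.1 * z₃ ^ p.2.2)
      (((z₁ - z₃) ^ (i + 1))⁻¹ * ((z₂ - z₃) ^ (j + 1))⁻¹) := by
  have hg : Function.Injective fun p : ℕ × ℕ =>
      (-((p.1 + i : ℕ) : ℤ) - 1, -((p.2 + j : ℕ) : ℤ) - 1, ((p.1 + p.2 : ℕ) : ℤ)) := by
    rintro ⟨a, b⟩ ⟨a', b'⟩ h
    simp only [Prod.mk.injEq] at h ⊢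
    omega
  rw [← hg.hasSum_iff]
  · have s₁ := hasSum_inv_sub_pow i h₁
    have s₂ := hasSum_inv_sub_pow j h₂
    have hs := summable_mul_of_summable_norm s₁.summable.norm s₂.summable.norm
    have hp := s₁.mul s₂ hs
    refine hp.congr_fun fun p => ?_
    simp only [Function.comp_apply]
    rw [if_pos (by omega), zpow_natCast, pow_add,
      show (-(-((p.1 + i : ℕ) : ℤ) - 1) - 1).toNat = p.1 + i by omega,
      show (-(-((p.2 + j : ℕ) : ℤ) - 1) - 1).toNat = p.2 + j by omega]
    ring
  · rintro ⟨a, b, c⟩ hab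
    simp only
    split_ifs with h
    · rcases lt_or_ge (-a - 1).toNat i with hi | hi
      · rw [Nat.choose_eq_zero_of_lt hi]; simp
      rcases lt_or_ge (-b - 1).toNat j with hj | hj
      · rw [Nat.choose_eq_zero_of_lt hj]; simp
      refine absurd ⟨((-a - 1).toNat - i, (-b - 1).toNat - j), ?_⟩ hab
      simp only [Prod.mk.injEq]
      omega
    · simp

theorem hasSum_vev_bilocal_quasiField {m : ℕ} (hm : m ≠ 0) (l : ℕ) {z₁ z₂ z₃ : ℂ}
    (h₁ : ‖z₃‖ < ‖z₁‖) (h₂ : ‖z₃‖ < ‖z₂‖) :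
    HasSum (fun p : ℤ × ℤ × ℤ =>
        ((l : ℂ) + 1) * vev (bilocal m p.1 p.2.1 * quasiField m l p.2.2) *
          z₁ ^ p.1 * z₂ ^ p.2.1 * z₃ ^ p.2.2)
      ((normConst m l : ℂ) * ((z₁ - z₂) ^ l / ((z₁ - z₃) * (z₂ - z₃)) ^ (l + 1))) := by
  have h := hasSum_sum (s := range (l + 1)) fun i _ =>
    (hasSum_threePoint_term i (l - i) h₁ h₂).mul_left
      ((normConst m l : ℂ) * ((-1) ^ i * (l.choose i : ℂ)))
  have h13 : z₁ - z₃ ≠ 0 := fun e => by rw [sub_eq_zero.1 e] at h₁; exact lt_irrefl _ h₁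
  have h23 : z₂ - z₃ ≠ 0 := fun e => by rw [sub_eq_zero.1 e] at h₂; exact lt_irrefl _ h₂
  have hv : (normConst m l : ℂ) * ((z₁ - z₂) ^ l / ((z₁ - z₃) * (z₂ - z₃)) ^ (l + 1)) =
      ∑ i ∈ range (l + 1), (normConst m l : ℂ) * ((-1) ^ i * (l.choose i : ℂ)) *
        (((z₁ - z₃) ^ (i + 1))⁻¹ * ((z₂ - z₃) ^ (l - i + 1))⁻¹) := by
    -- Writing z₁₂ = z₁₃ - z₂₃ splits the 3-point function into products of two inverse powers,
    -- matching the summands of `threePoint`.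
    rw [show z₁ - z₂ = -(z₂ - z₃) + (z₁ - z₃) by ring, add_pow, Finset.sum_div, Finset.mul_sum]
    refine Finset.sum_congr rfl fun i hi => ?_
    obtain ⟨j, rfl⟩ : ∃ j, l = i + j := ⟨l - i, by rw [Finset.mem_range] at hi; omega⟩
    rw [Nat.add_sub_cancel_left, neg_pow, mul_pow, mul_assoc (normConst m (i + j) : ℂ)]
    congr 1
    field_simp
    ring
  rw [hv]
  refine h.congr_fun fun p => ?_
  rw [vev_bilocal_quasiField hm, mul_ite, mul_zero]
  split_ifs with hp
  · rw [threePoint, mul_comm (∑ i ∈ _, _), ← mul_assoc ((l : ℂ) + 1), ← normConst_eq_threePointNorm hm,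
      Finset.mul_sum, Finset.sum_mul, Finset.sum_mul, Finset.sum_mul]
    refine Finset.sum_congr rfl fun i hi => ?_
    rw [Finset.mem_range] at hi
    rw [if_pos (by rw [show i + (l - i) = l by omega]; exact hp)]
    ring
  · rw [zero_mul, zero_mul, zero_mul, Finset.sum_eq_zero]
    intro i hi
    rw [Finset.mem_range] at hi
    rw [if_neg (by rw [show i + (l - i) = l by omega]; exact hp)]
    simp

/-! ### The coefficients of the 4-point functions -/

theorem covacuum_expField_heis_neg (m : ℕ) (a b : ℤ) (p : ℕ) (v : Fock) :
    covacuum (expField m a b (heis m (-((p : ℤ) + 1)) v)) =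
      (m : ℂ) * (covacuum (expField m a (b + (p + 1)) v) -
        covacuum (expField m (a + (p + 1)) b v)) := by
  rw [expField_heis_neg, map_sub, covacuum_heis_neg, map_smul, map_sub, smul_eq_mul]
  ring

/-- The Euler operator applied to E|0⟩ brings down its exponent, a sum of creation operators, which
can afterwards be moved to the left. -/
theorem smul_expField_vacuum (m : ℕ) (c d : ℤ) :
    ((c : ℂ) + d) • expField m c d vacuum =
      ∑ j ∈ range c.toNat, heis m (-((j : ℤ) + 1)) (expField m (c - 1 - j) d vacuum) -
        ∑ j ∈ range d.toNat, heis m (-((j : ℤ) + 1)) (expField m c (d - 1 - j) vacuum) := by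
  have h₁ := natCast_smul_creation 1 c
  have h₂ := natCast_smul_creation (-1) d
  have e : ((c : ℂ) + d) • (creation 1 c * creation (-1) d) =
      ((c : ℂ) • creation 1 c) * creation (-1) d + creation 1 c * ((d : ℂ) • creation (-1) d) := by
    rw [add_smul, smul_mul_assoc, mul_smul_comm]
  simp only [vacuum, expField_vac, heis_neg_single, mul_zero, sub_zero, add_zero]
  rw [Finsupp.smul_single, e, h₁, h₂, ← Finsupp.single_finsetSum, ← Finsupp.single_finsetSum,
    ← Finsupp.single_sub]
  congr 1
  rw [Int.cast_one, one_smul, Finset.sum_mul, Int.cast_neg, Int.cast_one, neg_smul, one_smul,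
    mul_neg, ← sub_eq_add_neg, Finset.mul_sum]
  congr 1 <;> refine Finset.sum_congr rfl fun j _ => ?_
  · ring
  · ring

/-- The vacuum expectation value of two factors `expField`, in nonnegative exponents. -/
def expPair (m : ℕ) (a b c d : ℤ) : ℂ := vev (expField m (-a) (-b) * expField m c d)

/-- The vacuum expectation value of two bilocal fields, in nonnegative exponents. -/
def bilocalPair (m : ℕ) (a b c d : ℤ) : ℂ := vev (bilocal m (-a - 1) (-b - 1) * bilocal m c d)

/-- The creation operators are commuted through the left factor E; the dual vacuum kills what
reaches the far left, and only shifts of a and b remain. -/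
theorem expPair_recursion (m : ℕ) (a b c d : ℤ) :
    ((c : ℂ) + d) * expPair m a b c d =
      m * (∑ j ∈ range c.toNat, expPair m a (b - 1 - j) (c - 1 - j) d -
        ∑ j ∈ range c.toNat, expPair m (a - 1 - j) b (c - 1 - j) d -
        ∑ j ∈ range d.toNat, expPair m a (b - 1 - j) c (d - 1 - j) +
        ∑ j ∈ range d.toNat, expPair m (a - 1 - j) b c (d - 1 - j)) := by
  have h : ((c : ℂ) + d) * expPair m a b c d =
      covacuum (expField m (-a) (-b) (((c : ℂ) + d) • expField m c d vacuum)) := by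
    rw [map_smul, map_smul, smul_eq_mul]; rfl
  have e : ∀ (x : ℤ) (j : ℕ), -x + ((j : ℤ) + 1) = -(x - 1 - j) := fun x j => by ring
  rw [h, smul_expField_vacuum, map_sub, map_sub, map_sum, map_sum, map_sum, map_sum]
  simp only [covacuum_expField_heis_neg, e]
  rw [← Finset.mul_sum, ← Finset.mul_sum, Finset.sum_sub_distrib, Finset.sum_sub_distrib]
  simp only [expPair, vev_mul]
  ring

theorem bilocalPair_eq_zero {m : ℕ} (hm : m ≠ 0) {a b c d : ℤ}
    (h : a < 0 ∨ b < 0 ∨ c < 0 ∨ d < 0) : bilocalPair m a b c d = 0 := by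
  rw [bilocalPair, vev_mul]
  by_cases h' : a < 0 ∨ b < 0
  · exact covacuum_bilocal hm (by omega) _
  · rw [bilocal_vacuum hm (by omega), map_zero, map_zero]

theorem expPair_eq {m : ℕ} (hm : m ≠ 0) (a b c d : ℤ) :
    expPair m a b c d =
      (bilocalPair m a (b - 1) (c - 1) d - bilocalPair m a (b - 1) c (d - 1) -
        (bilocalPair m (a - 1) b (c - 1) d - bilocalPair m (a - 1) b c (d - 1))) +
        if a = 0 ∧ b = 0 ∧ c = 0 ∧ d = 0 then 1 else 0 := by
  have hE : ∀ a b v, expField m a b v = bilocal m (a - 1) b v - bilocal m a (b - 1) v +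
      (if a = 0 ∧ b = 0 then (1 : ℂ) else 0) • v := by
    intro a b v
    rw [expField_eq hm, Pi.add_apply, Pi.add_apply, LinearMap.add_apply, mulZ12,
      LinearMap.sub_apply, one₂]
    split_ifs <;> simp
  have h0 : ∀ a b, covacuum (bilocal m a b vacuum) = 0 := fun a b => covacuum_bilocal_vac hm a b 0
  have h1 : covacuum vacuum = 1 := by rw [vacuum, covacuum_single, coeff_zero_one]
  have e : ∀ x : ℤ, -(x - 1) - 1 = -x := fun x => by ring
  simp only [expPair, bilocalPair, vev_mul, hE, map_add, map_sub, map_smul, h0, h1, e, smul_eq_mul]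
  split_ifs <;> first | omega | (simp; try ring)

theorem expPair_eq_zero {m : ℕ} (hm : m ≠ 0) {a b c d : ℤ}
    (h : a < 0 ∨ b < 0 ∨ c < 0 ∨ d < 0) : expPair m a b c d = 0 := by
  rw [expPair_eq hm, bilocalPair_eq_zero hm (by omega), bilocalPair_eq_zero hm (by omega),
    bilocalPair_eq_zero hm (by omega), bilocalPair_eq_zero hm (by omega), if_neg (by omega)]
  ring

/-! ### Power series in `z₁⁻¹, z₂⁻¹, z₃, z₄` -/

/-- Formal power series in `z₁⁻¹, z₂⁻¹, z₃, z₄`. -/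
abbrev FourSeries : Type := MvPowerSeries (Fin 4) ℂ

/-- The series with given coefficients. -/
def fourSeries (g : ℤ → ℤ → ℤ → ℤ → ℂ) : FourSeries := fun n => g (n 0) (n 1) (n 2) (n 3)

theorem coeff_fourSeries (g : ℤ → ℤ → ℤ → ℤ → ℂ) (n : Fin 4 →₀ ℕ) :
    MvPowerSeries.coeff n (fourSeries g) = g (n 0) (n 1) (n 2) (n 3) := rfl

theorem coeff_X_mul_four (i : Fin 4) (f : FourSeries) (n : Fin 4 →₀ ℕ) :
    MvPowerSeries.coeff n (MvPowerSeries.X i * f) =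
      if n i = 0 then 0 else MvPowerSeries.coeff (n - Finsupp.single i 1) f := by
  rw [MvPowerSeries.X, MvPowerSeries.coeff_monomial_mul, one_mul]
  simp only [Finsupp.single_le_iff, Nat.one_le_iff_ne_zero]
  split_ifs <;> simp_all

theorem X_zero_mul_fourSeries {g : ℤ → ℤ → ℤ → ℤ → ℂ} (h : ∀ a b c d, a < 0 → g a b c d = 0) :
    MvPowerSeries.X 0 * fourSeries g = fourSeries fun a b c d => g (a - 1) b c d := by
  ext n
  rw [coeff_X_mul_four, coeff_fourSeries]
  split_ifs with hn
  · rw [coeff_fourSeries, hn, h _ _ _ _ (by simp)]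
  · rw [coeff_fourSeries]
    simp [Nat.cast_sub (Nat.one_le_iff_ne_zero.2 hn)]

theorem X_one_mul_fourSeries {g : ℤ → ℤ → ℤ → ℤ → ℂ} (h : ∀ a b c d, b < 0 → g a b c d = 0) :
    MvPowerSeries.X 1 * fourSeries g = fourSeries fun a b c d => g a (b - 1) c d := by
  ext n
  rw [coeff_X_mul_four, coeff_fourSeries]
  split_ifs with hn
  · rw [coeff_fourSeries, hn, h _ _ _ _ (by simp)]
  · rw [coeff_fourSeries]
    simp [Nat.cast_sub (Nat.one_le_iff_ne_zero.2 hn)]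

theorem X_two_mul_fourSeries {g : ℤ → ℤ → ℤ → ℤ → ℂ} (h : ∀ a b c d, c < 0 → g a b c d = 0) :
    MvPowerSeries.X 2 * fourSeries g = fourSeries fun a b c d => g a b (c - 1) d := by
  ext n
  rw [coeff_X_mul_four, coeff_fourSeries]
  split_ifs with hn
  · rw [coeff_fourSeries, hn, h _ _ _ _ (by simp)]
  · rw [coeff_fourSeries]
    simp [Nat.cast_sub (Nat.one_le_iff_ne_zero.2 hn)]

theorem X_three_mul_fourSeries {g : ℤ → ℤ → ℤ → ℤ → ℂ} (h : ∀ a b c d, d < 0 → g a b c d = 0) :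
    MvPowerSeries.X 3 * fourSeries g = fourSeries fun a b c d => g a b c (d - 1) := by
  ext n
  rw [coeff_X_mul_four, coeff_fourSeries]
  split_ifs with hn
  · rw [coeff_fourSeries, hn, h _ _ _ _ (by simp)]
  · rw [coeff_fourSeries]
    simp [Nat.cast_sub (Nat.one_le_iff_ne_zero.2 hn)]

/-- The degree operator `z₃ ∂₃ + z₄ ∂₄`. -/
def eulerOp : FourSeries →ₗ[ℂ] FourSeries where
  toFun f := fun n => ((n 2 : ℂ) + n 3) * MvPowerSeries.coeff n f
  map_add' f g := by funext n; exact mul_add _ _ _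
  map_smul' c f := by funext n; exact mul_left_comm _ _ _

theorem coeff_eulerOp (f : FourSeries) (n : Fin 4 →₀ ℕ) :
    MvPowerSeries.coeff n (eulerOp f) = ((n 2 : ℂ) + n 3) * MvPowerSeries.coeff n f := rfl

theorem eulerOp_mul (f g : FourSeries) : eulerOp (f * g) = eulerOp f * g + f * eulerOp g := by
  ext n
  rw [map_add, coeff_eulerOp, MvPowerSeries.coeff_mul, MvPowerSeries.coeff_mul,
    MvPowerSeries.coeff_mul, ← Finset.sum_add_distrib, Finset.mul_sum]
  refine Finset.sum_congr rfl fun p hp => ?_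
  rw [coeff_eulerOp, coeff_eulerOp, ← Finset.HasAntidiagonal.mem_antidiagonal.1 hp]
  simp only [Finsupp.add_apply, Nat.cast_add]
  ring

theorem eulerOp_one : eulerOp 1 = 0 := by
  have h := eulerOp_mul 1 1
  rw [mul_one, mul_one, one_mul] at h
  exact left_eq_add.1 h

theorem eulerOp_pow_succ (f : FourSeries) (n : ℕ) :
    f * eulerOp (f ^ n) = (n : FourSeries) * eulerOp f * f ^ n := by
  induction n with
  | zero => rw [pow_zero, eulerOp_one]; simp
  | succ n ih =>
    rw [pow_succ, eulerOp_mul, mul_add, ← mul_assoc f, ih]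
    push_cast; ring

/-- Induction on the degree in z₃, z₄: `eulerOp k` has no part of degree zero, so the equation
expresses each coefficient of u through coefficients of smaller degree. -/
theorem eq_zero_of_eulerOp_eq_mul {u k f : FourSeries} (h : eulerOp u = eulerOp k * f * u)
    (h0 : ∀ n : Fin 4 →₀ ℕ, n 2 + n 3 = 0 → MvPowerSeries.coeff n u = 0) : u = 0 := by
  have key : ∀ N : ℕ, ∀ n : Fin 4 →₀ ℕ, n 2 + n 3 < N → MvPowerSeries.coeff n u = 0 := by
    intro N
    induction N with
    | zero => intro n hn; omega
    | succ N ih =>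
      intro n hn
      by_cases hz : n 2 + n 3 = 0
      · exact h0 n hz
      have h1 := congrArg (MvPowerSeries.coeff n) h
      rw [coeff_eulerOp, mul_assoc, mul_comm f, MvPowerSeries.coeff_mul, Finset.sum_eq_zero] at h1
      · exact (mul_eq_zero.1 h1).resolve_left (by exact_mod_cast hz)
      · intro p hp
        have hp' := Finset.HasAntidiagonal.mem_antidiagonal.1 hp
        rw [coeff_eulerOp]
        by_cases hz' : p.1 2 + p.1 3 = 0
        · rw [show (p.1 2 : ℂ) + p.1 3 = 0 by exact_mod_cast hz', zero_mul, zero_mul]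
        · rw [MvPowerSeries.coeff_mul, Finset.sum_eq_zero, mul_zero]
          intro q hq
          have hq' := Finset.HasAntidiagonal.mem_antidiagonal.1 hq
          rw [ih, zero_mul]
          have e2 : p.1 2 + p.2 2 = n 2 := by rw [← hp']; rfl
          have e3 : p.1 3 + p.2 3 = n 3 := by rw [← hp']; rfl
          have e2' : q.1 2 + q.2 2 = p.2 2 := by rw [← hq']; rfl
          have e3' : q.1 3 + q.2 3 = p.2 3 := by rw [← hq']; rfl
          omega
  ext n
  exact key _ n (Nat.lt_succ_self _)

/-! ### The generating series of the 4-point function -/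

theorem fourSeries_ext {g h : ℤ → ℤ → ℤ → ℤ → ℂ}
    (e : ∀ a b c d : ℕ, g a b c d = h a b c d) : fourSeries g = fourSeries h := by
  ext n
  exact e _ _ _ _

theorem one_eq_fourSeries : (1 : FourSeries) =
    fourSeries fun a b c d => if a = 0 ∧ b = 0 ∧ c = 0 ∧ d = 0 then 1 else 0 := by
  classical
  ext n
  rw [MvPowerSeries.coeff_one, coeff_fourSeries]
  refine if_congr ?_ rfl rfl
  rw [Finsupp.ext_iff, Fin.forall_fin_succ, Fin.forall_fin_succ, Fin.forall_fin_succ,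
    Fin.forall_fin_one]
  simp only [Finsupp.zero_apply, Nat.cast_eq_zero]
  rfl

theorem eulerOp_X (i : Fin 4) : eulerOp (MvPowerSeries.X i) =
    (if i = 2 ∨ i = 3 then 1 else 0 : FourSeries) * MvPowerSeries.X i := by
  classical
  ext n
  rw [coeff_eulerOp]
  have h : MvPowerSeries.coeff n ((if i = 2 ∨ i = 3 then 1 else 0 : FourSeries) *
      MvPowerSeries.X i) = if i = 2 ∨ i = 3 then MvPowerSeries.coeff n (MvPowerSeries.X i) else 0 := by
    split_ifs
    · rw [one_mul]
    · rw [zero_mul, map_zero]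
  rw [h, MvPowerSeries.coeff_X]
  by_cases hn : n = Finsupp.single i 1
  · rw [if_pos hn, hn]
    fin_cases i <;> simp
  · rw [if_neg hn]; simp

/-- `(1 - z₃/z₁)(1 - z₄/z₂)`. -/
def directFactor : FourSeries :=
  (1 - MvPowerSeries.X 0 * MvPowerSeries.X 2) * (1 - MvPowerSeries.X 1 * MvPowerSeries.X 3)

/-- `(1 - z₄/z₁)(1 - z₃/z₂)`. -/
def crossFactor : FourSeries :=
  (1 - MvPowerSeries.X 0 * MvPowerSeries.X 3) * (1 - MvPowerSeries.X 1 * MvPowerSeries.X 2)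

theorem directFactor_sub_crossFactor : directFactor - crossFactor =
    (MvPowerSeries.X 1 - MvPowerSeries.X 0) * (MvPowerSeries.X 2 - MvPowerSeries.X 3) := by
  rw [directFactor, crossFactor]; ring

theorem directFactor_sub_crossFactor_ne_zero : directFactor - crossFactor ≠ 0 := by
  rw [directFactor_sub_crossFactor]
  refine mul_ne_zero (sub_ne_zero.2 fun h => ?_) (sub_ne_zero.2 fun h => ?_)
  · exact absurd (MvPowerSeries.X_inj.1 h) (by decide)
  · exact absurd (MvPowerSeries.X_inj.1 h) (by decide)

theorem fourSeries_add (g h : ℤ → ℤ → ℤ → ℤ → ℂ) :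
    fourSeries g + fourSeries h = fourSeries fun a b c d => g a b c d + h a b c d := rfl

theorem sum_range_toNat_eq (h : ℕ → ℂ) (c : ℤ) (h0 : c ≤ 0 → h 0 = 0) :
    ∑ j ∈ range c.toNat, h j = ∑ j ∈ range (c - 1).toNat, h (j + 1) + h 0 := by
  rcases le_or_gt c 0 with hc | hc
  · rw [Int.toNat_of_nonpos hc, Int.toNat_of_nonpos (by omega), h0 hc]; simp
  · rw [show c.toNat = (c - 1).toNat + 1 by omega, Finset.sum_range_succ']

theorem one_sub_mul_sum_zero_two {g : ℤ → ℤ → ℤ → ℤ → ℂ}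
    (hg : ∀ a b c d, a < 0 ∨ b < 0 ∨ c < 0 ∨ d < 0 → g a b c d = 0) :
    (1 - MvPowerSeries.X 0 * MvPowerSeries.X 2) *
        (fourSeries fun a b c d => ∑ j ∈ range c.toNat, g (a - 1 - j) b (c - 1 - j) d) =
      MvPowerSeries.X 0 * MvPowerSeries.X 2 * fourSeries g := by
  have hs : ∀ a b c d, a < 0 ∨ b < 0 ∨ c < 0 ∨ d < 0 →
      ∑ j ∈ range c.toNat, g (a - 1 - j) b (c - 1 - j) d + g a b c d = 0 := by
    intro a b c d h
    rw [hg a b c d h, add_zero]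
    refine Finset.sum_eq_zero fun j hj => hg _ _ _ _ ?_
    rw [Finset.mem_range] at hj
    omega
  -- The sum S is geometric in z₃/z₁: splitting off its first term gives S = X₀X₂(S + g).
  have e : (fourSeries fun a b c d => ∑ j ∈ range c.toNat, g (a - 1 - j) b (c - 1 - j) d) =
      MvPowerSeries.X 0 * (MvPowerSeries.X 2 *
        ((fourSeries fun a b c d => ∑ j ∈ range c.toNat, g (a - 1 - j) b (c - 1 - j) d) + fourSeries g)) := by
    rw [fourSeries_add, X_two_mul_fourSeries fun a b c d h => hs a b c d (by omega),
      X_zero_mul_fourSeries fun a b c d h => hs _ _ _ _ (by omega)]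
    refine fourSeries_ext fun a b c d => ?_
    rw [sum_range_toNat_eq _ _ fun h => hg _ _ _ _ (by omega)]
    simp only [Nat.cast_add, Nat.cast_one, Nat.cast_zero, sub_zero]
    congr 1
    refine Finset.sum_congr rfl fun j _ => ?_
    congr 1 <;> ring
  linear_combination e

theorem one_sub_mul_sum_zero_three {g : ℤ → ℤ → ℤ → ℤ → ℂ}
    (hg : ∀ a b c d, a < 0 ∨ b < 0 ∨ c < 0 ∨ d < 0 → g a b c d = 0) :
    (1 - MvPowerSeries.X 0 * MvPowerSeries.X 3) *
        (fourSeries fun a b c d => ∑ j ∈ range d.toNat, g (a - 1 - j) b c (d - 1 - j)) =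
      MvPowerSeries.X 0 * MvPowerSeries.X 3 * fourSeries g := by
  have hs : ∀ a b c d, a < 0 ∨ b < 0 ∨ c < 0 ∨ d < 0 →
      ∑ j ∈ range d.toNat, g (a - 1 - j) b c (d - 1 - j) + g a b c d = 0 := by
    intro a b c d h
    rw [hg a b c d h, add_zero]
    refine Finset.sum_eq_zero fun j hj => hg _ _ _ _ ?_
    rw [Finset.mem_range] at hj
    omega
  have e : (fourSeries fun a b c d => ∑ j ∈ range d.toNat, g (a - 1 - j) b c (d - 1 - j)) =
      MvPowerSeries.X 0 * (MvPowerSeries.X 3 *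
        ((fourSeries fun a b c d => ∑ j ∈ range d.toNat, g (a - 1 - j) b c (d - 1 - j)) + fourSeries g)) := by
    rw [fourSeries_add, X_three_mul_fourSeries fun a b c d h => hs a b c d (by omega),
      X_zero_mul_fourSeries fun a b c d h => hs _ _ _ _ (by omega)]
    refine fourSeries_ext fun a b c d => ?_
    rw [sum_range_toNat_eq _ _ fun h => hg _ _ _ _ (by omega)]
    simp only [Nat.cast_add, Nat.cast_one, Nat.cast_zero, sub_zero]
    congr 1
    refine Finset.sum_congr rfl fun j _ => ?_
    congr 1 <;> ring
  linear_combination e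

theorem one_sub_mul_sum_one_two {g : ℤ → ℤ → ℤ → ℤ → ℂ}
    (hg : ∀ a b c d, a < 0 ∨ b < 0 ∨ c < 0 ∨ d < 0 → g a b c d = 0) :
    (1 - MvPowerSeries.X 1 * MvPowerSeries.X 2) *
        (fourSeries fun a b c d => ∑ j ∈ range c.toNat, g a (b - 1 - j) (c - 1 - j) d) =
      MvPowerSeries.X 1 * MvPowerSeries.X 2 * fourSeries g := by
  have hs : ∀ a b c d, a < 0 ∨ b < 0 ∨ c < 0 ∨ d < 0 →
      ∑ j ∈ range c.toNat, g a (b - 1 - j) (c - 1 - j) d + g a b c d = 0 := by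
    intro a b c d h
    rw [hg a b c d h, add_zero]
    refine Finset.sum_eq_zero fun j hj => hg _ _ _ _ ?_
    rw [Finset.mem_range] at hj
    omega
  have e : (fourSeries fun a b c d => ∑ j ∈ range c.toNat, g a (b - 1 - j) (c - 1 - j) d) =
      MvPowerSeries.X 1 * (MvPowerSeries.X 2 *
        ((fourSeries fun a b c d => ∑ j ∈ range c.toNat, g a (b - 1 - j) (c - 1 - j) d) + fourSeries g)) := by
    rw [fourSeries_add, X_two_mul_fourSeries fun a b c d h => hs a b c d (by omega),
      X_one_mul_fourSeries fun a b c d h => hs _ _ _ _ (by omega)]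
    refine fourSeries_ext fun a b c d => ?_
    rw [sum_range_toNat_eq _ _ fun h => hg _ _ _ _ (by omega)]
    simp only [Nat.cast_add, Nat.cast_one, Nat.cast_zero, sub_zero]
    congr 1
    refine Finset.sum_congr rfl fun j _ => ?_
    congr 1 <;> ring
  linear_combination e

theorem one_sub_mul_sum_one_three {g : ℤ → ℤ → ℤ → ℤ → ℂ}
    (hg : ∀ a b c d, a < 0 ∨ b < 0 ∨ c < 0 ∨ d < 0 → g a b c d = 0) :
    (1 - MvPowerSeries.X 1 * MvPowerSeries.X 3) *
        (fourSeries fun a b c d => ∑ j ∈ range d.toNat, g a (b - 1 - j) c (d - 1 - j)) =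
      MvPowerSeries.X 1 * MvPowerSeries.X 3 * fourSeries g := by
  have hs : ∀ a b c d, a < 0 ∨ b < 0 ∨ c < 0 ∨ d < 0 →
      ∑ j ∈ range d.toNat, g a (b - 1 - j) c (d - 1 - j) + g a b c d = 0 := by
    intro a b c d h
    rw [hg a b c d h, add_zero]
    refine Finset.sum_eq_zero fun j hj => hg _ _ _ _ ?_
    rw [Finset.mem_range] at hj
    omega
  have e : (fourSeries fun a b c d => ∑ j ∈ range d.toNat, g a (b - 1 - j) c (d - 1 - j)) =
      MvPowerSeries.X 1 * (MvPowerSeries.X 3 *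
        ((fourSeries fun a b c d => ∑ j ∈ range d.toNat, g a (b - 1 - j) c (d - 1 - j)) + fourSeries g)) := by
    rw [fourSeries_add, X_three_mul_fourSeries fun a b c d h => hs a b c d (by omega),
      X_one_mul_fourSeries fun a b c d h => hs _ _ _ _ (by omega)]
    refine fourSeries_ext fun a b c d => ?_
    rw [sum_range_toNat_eq _ _ fun h => hg _ _ _ _ (by omega)]
    simp only [Nat.cast_add, Nat.cast_one, Nat.cast_zero, sub_zero]
    congr 1
    refine Finset.sum_congr rfl fun j _ => ?_
    congr 1 <;> ring
  linear_combination e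

theorem expPair_eq_bilocalPair {m : ℕ} (hm : m ≠ 0) : fourSeries (expPair m) =
    (directFactor - crossFactor) * fourSeries (bilocalPair m) + 1 := by
  rw [directFactor_sub_crossFactor]
  have h3 := X_three_mul_fourSeries (g := bilocalPair m)
    fun a b c d h => bilocalPair_eq_zero hm (by omega)
  have h2 := X_two_mul_fourSeries (g := bilocalPair m)
    fun a b c d h => bilocalPair_eq_zero hm (by omega)
  have h13 := X_one_mul_fourSeries (g := fun a b c d => bilocalPair m a b c (d - 1))
    fun a b c d h => bilocalPair_eq_zero hm (by omega)
  have h03 := X_zero_mul_fourSeries (g := fun a b c d => bilocalPair m a b c (d - 1))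
    fun a b c d h => bilocalPair_eq_zero hm (by omega)
  have h12 := X_one_mul_fourSeries (g := fun a b c d => bilocalPair m a b (c - 1) d)
    fun a b c d h => bilocalPair_eq_zero hm (by omega)
  have h02 := X_zero_mul_fourSeries (g := fun a b c d => bilocalPair m a b (c - 1) d)
    fun a b c d h => bilocalPair_eq_zero hm (by omega)
  rw [← h3] at h13 h03
  rw [← h2] at h12 h02
  have e : (MvPowerSeries.X 1 - MvPowerSeries.X 0) * (MvPowerSeries.X 2 - MvPowerSeries.X 3) *
      fourSeries (bilocalPair m) + 1 =
      MvPowerSeries.X 1 * (MvPowerSeries.X 2 * fourSeries (bilocalPair m)) -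
      MvPowerSeries.X 1 * (MvPowerSeries.X 3 * fourSeries (bilocalPair m)) -
      (MvPowerSeries.X 0 * (MvPowerSeries.X 2 * fourSeries (bilocalPair m)) -
      MvPowerSeries.X 0 * (MvPowerSeries.X 3 * fourSeries (bilocalPair m))) + 1 := by ring
  rw [e, h12, h13, h02, h03, one_eq_fourSeries]
  ext n
  simp only [map_add, map_sub, coeff_fourSeries]
  exact expPair_eq hm _ _ _ _

/-- The logarithmic derivative of (`directFactor`/`crossFactor`)^m with denominators cleared. The
four geometric sums of the recursion contribute the four factors 1 - z_j/z_i. -/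
theorem eulerOp_expPair {m : ℕ} (hm : m ≠ 0) :
    directFactor * crossFactor * eulerOp (fourSeries (expPair m)) =
      m * (crossFactor * eulerOp directFactor - directFactor * eulerOp crossFactor) *
        fourSeries (expPair m) := by
  have h02 := one_sub_mul_sum_zero_two (g := expPair m) fun a b c d h => expPair_eq_zero hm h
  have h03 := one_sub_mul_sum_zero_three (g := expPair m) fun a b c d h => expPair_eq_zero hm h
  have h12 := one_sub_mul_sum_one_two (g := expPair m) fun a b c d h => expPair_eq_zero hm h
  have h13 := one_sub_mul_sum_one_three (g := expPair m) fun a b c d h => expPair_eq_zero hm h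
  have e : eulerOp (fourSeries (expPair m)) = m * (
      (fourSeries fun a b c d => ∑ j ∈ range c.toNat, expPair m a (b - 1 - j) (c - 1 - j) d) -
      (fourSeries fun a b c d => ∑ j ∈ range c.toNat, expPair m (a - 1 - j) b (c - 1 - j) d) -
      (fourSeries fun a b c d => ∑ j ∈ range d.toNat, expPair m a (b - 1 - j) c (d - 1 - j)) +
      (fourSeries fun a b c d => ∑ j ∈ range d.toNat, expPair m (a - 1 - j) b c (d - 1 - j))) := by
    rw [← nsmul_eq_mul]
    ext n
    rw [coeff_eulerOp, map_nsmul, nsmul_eq_mul]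
    simp only [map_add, map_sub, coeff_fourSeries]
    exact_mod_cast expPair_recursion m (n 0) (n 1) (n 2) (n 3)
  have d1 : eulerOp directFactor =
      -(MvPowerSeries.X 0 * MvPowerSeries.X 2 * (1 - MvPowerSeries.X 1 * MvPowerSeries.X 3)) -
        (MvPowerSeries.X 1 * MvPowerSeries.X 3 * (1 - MvPowerSeries.X 0 * MvPowerSeries.X 2)) := by
    simp only [directFactor, eulerOp_mul, map_sub, eulerOp_one, eulerOp_X]
    simp
    ring
  have d2 : eulerOp crossFactor =
      -(MvPowerSeries.X 0 * MvPowerSeries.X 3 * (1 - MvPowerSeries.X 1 * MvPowerSeries.X 2)) -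
        (MvPowerSeries.X 1 * MvPowerSeries.X 2 * (1 - MvPowerSeries.X 0 * MvPowerSeries.X 3)) := by
    simp only [crossFactor, eulerOp_mul, map_sub, eulerOp_one, eulerOp_X]
    simp
    ring
  rw [e, d1, d2, directFactor, crossFactor]
  generalize (fourSeries fun a b c d =>
    ∑ j ∈ range c.toNat, expPair m a (b - 1 - j) (c - 1 - j) d) = S12 at *
  generalize (fourSeries fun a b c d =>
    ∑ j ∈ range c.toNat, expPair m (a - 1 - j) b (c - 1 - j) d) = S02 at *
  generalize (fourSeries fun a b c d =>
    ∑ j ∈ range d.toNat, expPair m a (b - 1 - j) c (d - 1 - j)) = S13 at *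
  generalize (fourSeries fun a b c d =>
    ∑ j ∈ range d.toNat, expPair m (a - 1 - j) b c (d - 1 - j)) = S03 at *
  generalize (MvPowerSeries.X 0 : FourSeries) = x0 at *
  generalize (MvPowerSeries.X 1 : FourSeries) = x1 at *
  generalize (MvPowerSeries.X 2 : FourSeries) = x2 at *
  generalize (MvPowerSeries.X 3 : FourSeries) = x3 at *
  linear_combination (m : FourSeries) * ((1 - x0 * x2) * (1 - x1 * x3) * (1 - x0 * x3) * h12 -
    (1 - x1 * x3) * (1 - x0 * x3) * (1 - x1 * x2) * h02 -
    (1 - x0 * x2) * (1 - x0 * x3) * (1 - x1 * x2) * h13 +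
    (1 - x0 * x2) * (1 - x1 * x3) * (1 - x1 * x2) * h03)

theorem isUnit_one_sub_mul (i j k l : Fin 4) : IsUnit
    ((1 - MvPowerSeries.X i * MvPowerSeries.X j) *
      (1 - MvPowerSeries.X k * MvPowerSeries.X l) : FourSeries) := by
  rw [MvPowerSeries.isUnit_iff_constantCoeff]
  simp

theorem expPair_mul_pow {m : ℕ} (hm : m ≠ 0) :
    fourSeries (expPair m) * crossFactor ^ m = directFactor ^ m := by
  rw [← sub_eq_zero]
  obtain ⟨f, hf⟩ := (isUnit_one_sub_mul 0 2 1 3).exists_right_inv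
  have hf' : directFactor * f = 1 := hf
  have hc : crossFactor ≠ 0 := (isUnit_one_sub_mul 0 3 1 2).ne_zero
  have hd : directFactor ≠ 0 := (isUnit_one_sub_mul 0 2 1 3).ne_zero
  -- The difference satisfies the logarithmic equation of `directFactor`^m, with f supplying the
  -- inverse of `directFactor`.
  refine eq_zero_of_eulerOp_eq_mul (k := directFactor) (f := (m : FourSeries) * f) ?_ ?_
  · have h1 := eulerOp_pow_succ directFactor m
    have h2 := eulerOp_pow_succ crossFactor m
    have h3 := eulerOp_expPair hm
    refine mul_left_cancel₀ (mul_ne_zero hd hc) ?_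
    rw [map_sub, eulerOp_mul]
    linear_combination crossFactor ^ m * h3 + directFactor * fourSeries (expPair m) * h2 -
      crossFactor * h1 - (m : FourSeries) * crossFactor * eulerOp directFactor *
        (fourSeries (expPair m) * crossFactor ^ m - directFactor ^ m) * hf'
  · obtain ⟨p, hp⟩ := sub_dvd_pow_sub_pow directFactor 1 m
    obtain ⟨q, hq⟩ := sub_dvd_pow_sub_pow crossFactor 1 m
    rw [one_pow] at hp hq
    have h1 := expPair_eq_bilocalPair hm
    rw [directFactor_sub_crossFactor] at h1
    -- At z₃ = z₄ = 0 both factors are 1 and E E reduces to 1. The identity exhibits the difference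
    -- as a combination of X₂ and X₃, so all its coefficients of degree zero in z₃, z₄ vanish.
    have key : fourSeries (expPair m) * crossFactor ^ m - directFactor ^ m =
        MvPowerSeries.X 2 * ((MvPowerSeries.X 1 - MvPowerSeries.X 0) *
          fourSeries (bilocalPair m) * crossFactor ^ m +
          (MvPowerSeries.X 0 * MvPowerSeries.X 1 * MvPowerSeries.X 3 - MvPowerSeries.X 1) * q -
          (MvPowerSeries.X 0 * MvPowerSeries.X 1 * MvPowerSeries.X 3 - MvPowerSeries.X 0) * p) +
        MvPowerSeries.X 3 * (-(MvPowerSeries.X 1 - MvPowerSeries.X 0) *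
          fourSeries (bilocalPair m) * crossFactor ^ m -
          MvPowerSeries.X 0 * q + MvPowerSeries.X 1 * p) := by
      have hp' : directFactor ^ m - 1 = (-(MvPowerSeries.X 0 * MvPowerSeries.X 2) -
        MvPowerSeries.X 1 * MvPowerSeries.X 3 + MvPowerSeries.X 0 * MvPowerSeries.X 2 *
          (MvPowerSeries.X 1 * MvPowerSeries.X 3)) * p := by
        rw [hp, directFactor]; ring
      have hq' : crossFactor ^ m - 1 = (-(MvPowerSeries.X 0 * MvPowerSeries.X 3) -
        MvPowerSeries.X 1 * MvPowerSeries.X 2 + MvPowerSeries.X 0 * MvPowerSeries.X 3 *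
          (MvPowerSeries.X 1 * MvPowerSeries.X 2)) * q := by
        rw [hq, crossFactor]; ring
      linear_combination crossFactor ^ m * h1 + hq' - hp'
    intro n hn
    rw [key, map_add, coeff_X_mul_four, coeff_X_mul_four, if_pos (by omega), if_pos (by omega),
      add_zero]

/-- The ring of power series is a domain, so the factor `directFactor - crossFactor`, a multiple of
z₁₂z₃₄, can be cancelled; the quotient of the difference of m-th powers is a finite geometric sum.
-/
theorem bilocalPair_mul_pow {m : ℕ} (hm : m ≠ 0) :
    fourSeries (bilocalPair m) * crossFactor ^ m =
      ∑ i ∈ range m, directFactor ^ i * crossFactor ^ (m - 1 - i) := by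
  refine mul_right_cancel₀ directFactor_sub_crossFactor_ne_zero ?_
  rw [geom_sum₂_mul]
  linear_combination expPair_mul_pow hm - crossFactor ^ m * expPair_eq_bilocalPair hm

/-! ### Evaluation of power series -/

/-- The series `f`, evaluated at `x`, sums to `s`. -/
def EvalsTo (x : Fin 4 → ℂ) (f : FourSeries) (s : ℂ) : Prop :=
  HasSum (fun n : Fin 4 →₀ ℕ => MvPowerSeries.coeff n f * ∏ i, x i ^ n i) s

variable {x : Fin 4 → ℂ} {f g : FourSeries} {s t : ℂ}

theorem EvalsTo.sub (hf : EvalsTo x f s) (hg : EvalsTo x g t) : EvalsTo x (f - g) (s - t) := by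
  refine (HasSum.sub hf hg).congr_fun fun n => ?_
  rw [map_sub, sub_mul]

theorem hasSum_sum_antidiagonal {J : Type*} [AddCommMonoid J] [Finset.HasAntidiagonal J]
    {F G : J → ℂ} {s t : ℂ} (hF : HasSum F s) (hG : HasSum G t) :
    HasSum (fun n => ∑ p ∈ Finset.HasAntidiagonal.antidiagonal n, F p.1 * G p.2) (s * t) := by
  have hs : Summable fun p : J × J => F p.1 * G p.2 :=
    summable_mul_of_summable_norm hF.summable.norm hG.summable.norm
  have h1 := (summable_sum_mul_antidiagonal_of_summable_mul hs).hasSum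
  rwa [← Summable.tsum_mul_tsum_eq_tsum_sum_antidiagonal hF.summable hG.summable hs,
    hF.tsum_eq, hG.tsum_eq] at h1

theorem EvalsTo.mul (hf : EvalsTo x f s) (hg : EvalsTo x g t) : EvalsTo x (f * g) (s * t) := by
  classical
  have h1 := hasSum_sum_antidiagonal hf hg
  refine h1.congr_fun fun n => ?_
  rw [MvPowerSeries.coeff_mul, Finset.sum_mul]
  refine Finset.sum_congr rfl fun p hp => ?_
  have e : ∏ i, x i ^ n i = (∏ i, x i ^ p.1 i) * ∏ i, x i ^ p.2 i := by
    rw [← Finset.HasAntidiagonal.mem_antidiagonal.1 hp, ← Finset.prod_mul_distrib]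
    exact Finset.prod_congr rfl fun i _ => pow_add _ _ _
  rw [e]
  ring

theorem evalsTo_one : EvalsTo x 1 1 := by
  classical
  have h := hasSum_single (f := fun n : Fin 4 →₀ ℕ =>
    MvPowerSeries.coeff n (1 : FourSeries) * ∏ i, x i ^ n i) 0 fun n hn => by
      rw [MvPowerSeries.coeff_one, if_neg hn, zero_mul]
  have e : MvPowerSeries.coeff (0 : Fin 4 →₀ ℕ) (1 : FourSeries) *
      ∏ i, x i ^ (0 : Fin 4 →₀ ℕ) i = 1 := by simp
  rwa [e] at h

theorem evalsTo_X (i : Fin 4) : EvalsTo x (MvPowerSeries.X i) (x i) := by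
  classical
  have h := hasSum_single (f := fun n : Fin 4 →₀ ℕ =>
    MvPowerSeries.coeff n (MvPowerSeries.X i : FourSeries) * ∏ j, x j ^ n j)
      (Finsupp.single i 1) fun n hn => by rw [MvPowerSeries.coeff_X, if_neg hn, zero_mul]
  have e : ∏ j, x j ^ (Finsupp.single i 1 : Fin 4 →₀ ℕ) j = x i := by
    rw [Finset.prod_eq_single i] <;> simp +contextual
  rw [MvPowerSeries.coeff_index_single_self_X, one_mul, e] at h
  exact h

theorem EvalsTo.pow (hf : EvalsTo x f s) (n : ℕ) : EvalsTo x (f ^ n) (s ^ n) := by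
  induction n with
  | zero => simpa using evalsTo_one
  | succ n ih => simpa only [pow_succ] using ih.mul hf

theorem EvalsTo.sum {J : Type*} {F : J → FourSeries} {S : J → ℂ} {I : Finset J}
    (h : ∀ j ∈ I, EvalsTo x (F j) (S j)) : EvalsTo x (∑ j ∈ I, F j) (∑ j ∈ I, S j) := by
  refine (hasSum_sum h).congr_fun fun n => ?_
  rw [map_sum, Finset.sum_mul]

/-- The geometric series in `z₄/z₁`. -/
def geomZeroThree : FourSeries :=
  fourSeries fun a b c d => if a = d ∧ 0 ≤ d ∧ b = 0 ∧ c = 0 then 1 else 0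

/-- The geometric series in `z₃/z₂`. -/
def geomOneTwo : FourSeries :=
  fourSeries fun a b c d => if b = c ∧ 0 ≤ c ∧ a = 0 ∧ d = 0 then 1 else 0

theorem geomZeroThree_mul :
    geomZeroThree * (1 - MvPowerSeries.X 0 * MvPowerSeries.X 3) = 1 := by
  have e : MvPowerSeries.X 0 * (MvPowerSeries.X 3 * geomZeroThree) + 1 = geomZeroThree := by
    rw [geomZeroThree, X_three_mul_fourSeries fun a b c d h => if_neg (by omega),
      X_zero_mul_fourSeries fun a b c d h => if_neg (by omega), one_eq_fourSeries, fourSeries_add]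
    refine fourSeries_ext fun a b c d => ?_
    split_ifs <;> first | omega | simp
  linear_combination -e

theorem geomOneTwo_mul : geomOneTwo * (1 - MvPowerSeries.X 1 * MvPowerSeries.X 2) = 1 := by
  have e : MvPowerSeries.X 1 * (MvPowerSeries.X 2 * geomOneTwo) + 1 = geomOneTwo := by
    rw [geomOneTwo, X_two_mul_fourSeries fun a b c d h => if_neg (by omega),
      X_one_mul_fourSeries fun a b c d h => if_neg (by omega), one_eq_fourSeries, fourSeries_add]
    refine fourSeries_ext fun a b c d => ?_
    split_ifs <;> first | omega | simp
  linear_combination -e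

/-- The exponent vector with given entries. -/
def fourExponent (a b c d : ℕ) : Fin 4 →₀ ℕ := Finsupp.equivFunOnFinite.symm ![a, b, c, d]

theorem eq_fourExponent (n : Fin 4 →₀ ℕ) : n = fourExponent (n 0) (n 1) (n 2) (n 3) := by
  ext i
  fin_cases i <;> rfl

theorem prod_pow_fourExponent (a b c d : ℕ) :
    ∏ i, x i ^ fourExponent a b c d i = x 0 ^ a * x 1 ^ b * x 2 ^ c * x 3 ^ d := by
  rw [Fin.prod_univ_four]; rfl

theorem coeff_fourExponent (u : ℤ → ℤ → ℤ → ℤ → ℂ) (a b c d : ℕ) :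
    MvPowerSeries.coeff (fourExponent a b c d) (fourSeries u) = u a b c d := rfl

theorem evalsTo_geomZeroThree (h : ‖x 0 * x 3‖ < 1) :
    EvalsTo x geomZeroThree (1 - x 0 * x 3)⁻¹ := by
  have hg : Function.Injective fun k : ℕ => fourExponent k 0 0 k :=
    fun a b hab => DFunLike.congr_fun hab 0
  rw [EvalsTo, ← hg.hasSum_iff]
  · refine (hasSum_geometric_of_norm_lt_one h).congr_fun fun k => ?_
    rw [Function.comp_apply, geomZeroThree, coeff_fourExponent, prod_pow_fourExponent,
      if_pos (by omega)]
    ring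
  · intro n hn
    rw [geomZeroThree, coeff_fourSeries, if_neg, zero_mul]
    rintro ⟨h1, -, h2, h3⟩
    refine hn ⟨n 0, ?_⟩
    conv_rhs => rw [eq_fourExponent n]
    rw [show n 1 = 0 by omega, show n 2 = 0 by omega, show n 3 = n 0 by omega]

theorem evalsTo_geomOneTwo (h : ‖x 1 * x 2‖ < 1) :
    EvalsTo x geomOneTwo (1 - x 1 * x 2)⁻¹ := by
  have hg : Function.Injective fun k : ℕ => fourExponent 0 k k 0 :=
    fun a b hab => DFunLike.congr_fun hab 1
  rw [EvalsTo, ← hg.hasSum_iff]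
  · refine (hasSum_geometric_of_norm_lt_one h).congr_fun fun k => ?_
    rw [Function.comp_apply, geomOneTwo, coeff_fourExponent, prod_pow_fourExponent,
      if_pos (by omega)]
    ring
  · intro n hn
    rw [geomOneTwo, coeff_fourSeries, if_neg, zero_mul]
    rintro ⟨h1, -, h2, h3⟩
    refine hn ⟨n 1, ?_⟩
    conv_rhs => rw [eq_fourExponent n]
    rw [show n 0 = 0 by omega, show n 3 = 0 by omega, show n 2 = n 1 by omega]

/-- Only the inverse of `crossFactor` is an infinite series, hence the two conditions on z₄/z₁ and
z₃/z₂. Everything else is polynomial, and products of absolutely convergent sums are taken. -/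
theorem evalsTo_bilocalPair {m : ℕ} (hm : m ≠ 0) (h₁ : ‖x 0 * x 3‖ < 1) (h₂ : ‖x 1 * x 2‖ < 1) :
    EvalsTo x (fourSeries (bilocalPair m))
      ((∑ i ∈ range m, ((1 - x 0 * x 2) * (1 - x 1 * x 3)) ^ i *
        ((1 - x 0 * x 3) * (1 - x 1 * x 2)) ^ (m - 1 - i)) *
        ((1 - x 0 * x 3)⁻¹ * (1 - x 1 * x 2)⁻¹) ^ m) := by
  have e : fourSeries (bilocalPair m) =
      (∑ i ∈ range m, directFactor ^ i * crossFactor ^ (m - 1 - i)) *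
        (geomZeroThree * geomOneTwo) ^ m := by
    have hc : crossFactor * (geomZeroThree * geomOneTwo) = 1 := by
      rw [crossFactor]
      linear_combination geomOneTwo * (1 - MvPowerSeries.X 1 * MvPowerSeries.X 2) *
        geomZeroThree_mul + geomOneTwo_mul
    rw [← bilocalPair_mul_pow hm, mul_assoc, ← mul_pow, hc, one_pow, mul_one]
  have hX : ∀ i j, EvalsTo x (1 - MvPowerSeries.X i * MvPowerSeries.X j) (1 - x i * x j) :=
    fun i j => evalsTo_one.sub ((evalsTo_X i).mul (evalsTo_X j))
  rw [e]
  exact (EvalsTo.sum fun i _ => (((hX 0 2).mul (hX 1 3)).pow i).mul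
    (((hX 0 3).mul (hX 1 2)).pow (m - 1 - i))).mul
    (((evalsTo_geomZeroThree h₁).mul (evalsTo_geomOneTwo h₂)).pow m)

theorem hasSum_vev_bilocal_bilocal {m : ℕ} (hm : m ≠ 0) {z₁ z₂ z₃ z₄ : ℂ} (h12 : z₁ ≠ z₂)
    (h34 : z₃ ≠ z₄) (h31 : ‖z₃‖ < ‖z₁‖) (h32 : ‖z₃‖ < ‖z₂‖) (h41 : ‖z₄‖ < ‖z₁‖)
    (h42 : ‖z₄‖ < ‖z₂‖) :
    HasSum (fun p : ℤ × ℤ × ℤ × ℤ =>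
        vev (bilocal m p.1 p.2.1 * bilocal m p.2.2.1 p.2.2.2) *
          z₁ ^ p.1 * z₂ ^ p.2.1 * z₃ ^ p.2.2.1 * z₄ ^ p.2.2.2)
      (((z₁ - z₂) * (z₃ - z₄))⁻¹ *
        ((1 - (z₁ - z₂) * (z₃ - z₄) / ((z₁ - z₃) * (z₂ - z₄))) ^ (-(m : ℤ)) - 1)) := by
  have n1 : z₁ ≠ 0 := norm_pos_iff.1 ((norm_nonneg z₃).trans_lt h31)
  have n2 : z₂ ≠ 0 := norm_pos_iff.1 ((norm_nonneg z₃).trans_lt h32)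
  have n13 : z₁ - z₃ ≠ 0 := fun e => by rw [sub_eq_zero.1 e] at h31; exact lt_irrefl _ h31
  have n24 : z₂ - z₄ ≠ 0 := fun e => by rw [sub_eq_zero.1 e] at h42; exact lt_irrefl _ h42
  have n14 : z₁ - z₄ ≠ 0 := fun e => by rw [sub_eq_zero.1 e] at h41; exact lt_irrefl _ h41
  have n23 : z₂ - z₃ ≠ 0 := fun e => by rw [sub_eq_zero.1 e] at h32; exact lt_irrefl _ h32
  have n12 : z₁ - z₂ ≠ 0 := sub_ne_zero.2 h12
  have n34 : z₃ - z₄ ≠ 0 := sub_ne_zero.2 h34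
  have b1 : ‖z₁⁻¹ * z₄‖ < 1 := by
    rw [norm_mul, norm_inv, inv_mul_lt_one₀ (norm_pos_iff.2 n1)]; exact h41
  have b2 : ‖z₂⁻¹ * z₃‖ < 1 := by
    rw [norm_mul, norm_inv, inv_mul_lt_one₀ (norm_pos_iff.2 n2)]; exact h32
  -- The prefactor z₁^{-1}z₂^{-1} restores the shift by one in the exponents of `bilocalPair`.
  have main := (evalsTo_bilocalPair (x := ![z₁⁻¹, z₂⁻¹, z₃, z₄]) hm b1 b2).mul_left (z₁⁻¹ * z₂⁻¹)
  have hg : Function.Injective fun n : Fin 4 →₀ ℕ =>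
      (-(n 0 : ℤ) - 1, -(n 1 : ℤ) - 1, (n 2 : ℤ), (n 3 : ℤ)) := by
    intro n n' h
    simp only [Prod.mk.injEq] at h
    rw [eq_fourExponent n, eq_fourExponent n', show n 0 = n' 0 by omega,
      show n 1 = n' 1 by omega, show n 2 = n' 2 by omega, show n 3 = n' 3 by omega]
  rw [← hg.hasSum_iff]
  · have hv : ((z₁ - z₂) * (z₃ - z₄))⁻¹ *
        ((1 - (z₁ - z₂) * (z₃ - z₄) / ((z₁ - z₃) * (z₂ - z₄))) ^ (-(m : ℤ)) - 1) =
        z₁⁻¹ * z₂⁻¹ * ((∑ i ∈ range m, ((1 - z₁⁻¹ * z₃) * (1 - z₂⁻¹ * z₄)) ^ i *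
          ((1 - z₁⁻¹ * z₄) * (1 - z₂⁻¹ * z₃)) ^ (m - 1 - i)) *
          ((1 - z₁⁻¹ * z₄)⁻¹ * (1 - z₂⁻¹ * z₃)⁻¹) ^ m) := by
      have hX : (1 - z₁⁻¹ * z₃) * (1 - z₂⁻¹ * z₄) = (z₁ - z₃) * (z₂ - z₄) / (z₁ * z₂) := by
        field_simp
      have hY : (1 - z₁⁻¹ * z₄) * (1 - z₂⁻¹ * z₃) = (z₁ - z₄) * (z₂ - z₃) / (z₁ * z₂) := by
        field_simp
      have hη : 1 - (z₁ - z₂) * (z₃ - z₄) / ((z₁ - z₃) * (z₂ - z₄)) =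
          (z₁ - z₄) * (z₂ - z₃) / ((z₁ - z₃) * (z₂ - z₄)) := by
        field_simp; ring
      have hs := geom_sum₂_mul ((z₁ - z₃) * (z₂ - z₄) / (z₁ * z₂))
        ((z₁ - z₄) * (z₂ - z₃) / (z₁ * z₂)) m
      have hd : (z₁ - z₃) * (z₂ - z₄) / (z₁ * z₂) - (z₁ - z₄) * (z₂ - z₃) / (z₁ * z₂) =
          (z₁ - z₂) * (z₃ - z₄) / (z₁ * z₂) := by
        field_simp; ring
      rw [hd, ← eq_div_iff (div_ne_zero (mul_ne_zero n12 n34) (mul_ne_zero n1 n2))] at hs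
      rw [← mul_inv (1 - z₁⁻¹ * z₄), hX, hY, hs, hη, zpow_neg, zpow_natCast, inv_pow, div_pow,
        div_pow, div_pow]
      field_simp
    rw [hv]
    refine main.congr_fun fun n => ?_
    simp only [Function.comp_apply, coeff_fourSeries, bilocalPair, Fin.prod_univ_four]
    simp only [Matrix.cons_val]
    rw [zpow_sub_one₀ n1, zpow_sub_one₀ n2, zpow_neg, zpow_neg, zpow_natCast, zpow_natCast,
      zpow_natCast, zpow_natCast, inv_pow, inv_pow]
    ring
  · rintro ⟨a, b, c, d⟩ hab
    have h := bilocalPair_eq_zero hm (a := -a - 1) (b := -b - 1) (c := c) (d := d)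
    rw [bilocalPair, show -(-a - 1) - 1 = a by ring, show -(-b - 1) - 1 = b by ring] at h
    simp only
    rw [h, zero_mul, zero_mul, zero_mul, zero_mul]
    by_contra hn
    refine hab ⟨fourExponent (-a - 1).toNat (-b - 1).toNat c.toNat d.toNat, ?_⟩
    change (-((-a - 1).toNat : ℤ) - 1, -((-b - 1).toNat : ℤ) - 1, (c.toNat : ℤ), (d.toNat : ℤ)) = _
    simp only [Prod.mk.injEq]
    omega

end Bilocal

end

/-! ### Assembly of the theorem -/

theorem theorem2p1 (m : ℕ) (hm : 1 ≤ m) :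
    Bilocal.Regular (Bilocal.bilocal m) ∧
    -- the weight functions are normalized
    (∀ (l : ℕ) (z₁ z₂ : ℂ), z₁ ≠ z₂ →
      ∫ t in (0 : ℝ)..1, (z₁ - z₂) * Bilocal.weight l (z₂ + t * (z₁ - z₂)) z₁ z₂ = 1) ∧
    -- the 4-point function
    (∀ z₁ z₂ z₃ z₄ : ℂ, z₁ ≠ z₂ → z₃ ≠ z₄ →
      ‖z₃‖ < ‖z₁‖ → ‖z₃‖ < ‖z₂‖ → ‖z₄‖ < ‖z₁‖ → ‖z₄‖ < ‖z₂‖ →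
      HasSum (fun p : ℤ × ℤ × ℤ × ℤ =>
          Bilocal.vev (Bilocal.bilocal m p.1 p.2.1 * Bilocal.bilocal m p.2.2.1 p.2.2.2) *
            z₁ ^ p.1 * z₂ ^ p.2.1 * z₃ ^ p.2.2.1 * z₄ ^ p.2.2.2)
        (((z₁ - z₂) * (z₃ - z₄))⁻¹ *
          ((1 - (z₁ - z₂) * (z₃ - z₄) / ((z₁ - z₃) * (z₂ - z₄))) ^ (-(m : ℤ)) - 1))) ∧
    ∃ (V : ℕ → VertexOperator ℂ Bilocal.Fock) (C : ℕ → ℝ),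
      -- local quasiprimary fields of dimension `l + 1`
      (∀ l l' : ℕ, Bilocal.MutuallyLocal (V l).coeff (V l').coeff) ∧
      (∀ l : ℕ, Bilocal.Quasiprimary m (l + 1) (V l).coeff) ∧
      -- the expansion `V_m = ∑_l z₁₂ ^ l / l! ∫ p_l V^l`: the coefficients of `z₁₂ ^ k` agree
      (∀ k : ℕ, Bilocal.taylor (Bilocal.bilocal m) k =
        ∑ l ∈ Finset.range (k + 1),
          (1 / (l.factorial : ℂ)) • Bilocal.weightedIntegral l (V l).coeff (k - l)) ∧
      -- the 2-point functions
      (∀ (l l' : ℕ) (z₁ z₂ : ℂ), ‖z₂‖ < ‖z₁‖ →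
        HasSum (fun p : ℤ × ℤ =>
            ((l : ℂ) + 1) / (l.factorial : ℂ) *
              Bilocal.vev ((V l).coeff p.1 * (V l').coeff p.2) * z₁ ^ p.1 * z₂ ^ p.2)
          (if l = l' then (C l : ℂ) * (z₁ - z₂) ^ (-2 * (l : ℤ) - 2) else 0)) ∧
      -- the 3-point functions
      (∀ (l : ℕ) (z₁ z₂ z₃ : ℂ), ‖z₃‖ < ‖z₁‖ → ‖z₃‖ < ‖z₂‖ →
        HasSum (fun p : ℤ × ℤ × ℤ =>
            ((l : ℂ) + 1) * Bilocal.vev (Bilocal.bilocal m p.1 p.2.1 * (V l).coeff p.2.2) *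
              z₁ ^ p.1 * z₂ ^ p.2.1 * z₃ ^ p.2.2)
          ((C l : ℂ) * ((z₁ - z₂) ^ l / ((z₁ - z₃) * (z₂ - z₃)) ^ (l + 1)))) ∧
      -- the constants are positive, and are the only solution of the triangular system
      (∀ l : ℕ, 0 < C l) ∧
      (∀ c : ℕ → ℝ, Bilocal.TriangularSystem m c ↔ c = C) ∧
      -- `V^l` is computed from `V_m` by differentiation
      (∀ l : ℕ, (V l).coeff = ((l.factorial : ℂ) / ((2 * l).factorial : ℂ)) •
        Bilocal.diag (Bilocal.deriv₁^[l] ((fun D => -Bilocal.deriv₂ D)^[l]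
          (Bilocal.mulZ12^[l] (Bilocal.bilocal m))))) ∧
      -- `V^l` in terms of the Schur polynomials of the current
      (∀ l : ℕ, (V l).coeff = ((l.factorial : ℂ) ^ 2 / ((2 * l).factorial : ℂ)) •
        ∑ k ∈ Finset.range (l + 1),
          ((-1) ^ k * (l.choose k : ℂ) * ((2 * l - k).choose l : ℂ) * ((l - k).factorial : ℂ)) •
            Bilocal.deriv^[k]
              (Bilocal.npoly (Bilocal.current m) (Bilocal.schurDiff (l - k + 1)))) := by
  have h0 : m ≠ 0 := by omega
  refine ⟨Bilocal.regular_bilocal h0, fun l z₁ z₂ h => Bilocal.integral_weight_eq_one l h,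
    fun z₁ z₂ z₃ z₄ h12 h34 h31 h32 h41 h42 =>
      Bilocal.hasSum_vev_bilocal_bilocal h0 h12 h34 h31 h32 h41 h42,
    fun l => Bilocal.quasiVertexOperator m l h0, Bilocal.normConst m, ?_⟩
  simp only [Bilocal.coeff_quasiVertexOperator]
  exact ⟨Bilocal.mutuallyLocal_quasiField h0, Bilocal.quasiprimary_quasiField h0,
    Bilocal.bilocalTaylor_expansion m,
    fun l l' z₁ z₂ h => Bilocal.hasSum_vev_quasiField_quasiField h0 l l' h,
    fun l z₁ z₂ z₃ h₁ h₂ => Bilocal.hasSum_vev_bilocal_quasiField h0 l h₁ h₂,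
    Bilocal.normConst_pos h0, Bilocal.triangularSystem_iff_eq_normConst h0,
    Bilocal.quasiField_eq_diag h0, Bilocal.quasiField_eq_schur h0⟩
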